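/- Let $k$ be a field of characteristic $0$, let $\mathfrak{g}=\mathfrak{gl}_2(k)$, let $V=k^2\oplus (k^2)^*$ with its natural $\mathfrak{g}$-action, and let $U$ denote the universal enveloping algebra. Let $\gamma: V\times V\to U(\mathfrak{g})$ be a $\mathfrak{g}$-invariant skew-symmetric bilinear pairing that vanishes on $k^2\times k^2$ and on $(k^2)^*\times (k^2)^*$, and let $H_\gamma$ be the quotient of $U(\mathfrak{g})\ltimes T(V)$ by the relations $[v,w]=\gamma(v,w)$, $v,w\in V$, filtered by $\deg(\alpha)=0$ for $\alpha\in U(\mathfrak{g})$ and $\deg (v)=1$ for $v\in V$. Assume that $H_\gamma$ is an infinitesimal Cherednik algebra, that is, that the natural map $U(\mathfrak{g}\ltimes V)\to \mathrm{gr}(H_\gamma)$ is an isomorphism. Let $\tau\in\mathfrak{g}$ be the identity matrix, let $e,f,h$ be the standard basis of $\mathfrak{sl}_2$, let $x,y$ be the standard basis of $k^2$, and let $x_1,y_1$ be the basis of $(k^2)^*$ given by $x_1(s,t)=t$, $y_1(s,t)=-s$, so that $[e,x_1]=0$ and $[f,x_1]=y_1$. Put $$b=y_1x-x_1y,\qquad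 d=\tau b-\bigl(2e\,y_1y+h(y_1x+x_1y)-2f\,x_1x\bigr)$$ in $U(\mathfrak{g}\ltimes V)\cong\mathrm{gr}(H_\gamma)$. Write $Z(A)$ for the center of an algebra $A$. Then: 1. There are central elements $z_1,z_2\in Z(H_\gamma)$ whose leading terms in $\mathrm{gr}(H_\gamma)$ are $b$ and $d$, and for any such $z_1,z_2$ the center $Z(H_\gamma)$ is the polynomial algebra $k[z_1,z_2]$ in two variables. 2. $\mathrm{gr}(Z(H_\gamma))=Z(\mathrm{gr}(H_\gamma))$ inside $\mathrm{gr}(H_\gamma)$, where $Z(H_\gamma)$ carries the induced filtration. 3. The elements $b,d$ are central in $U(\mathfrak{g}\ltimes V)$, and $Z(U(\mathfrak{g}\ltimes V))$ is the polynomial algebra $k[b,d]$ in two variables. -/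

import Mathlib

attribute [local instance 100] LieRing.ofAssociativeRing

noncomputable section

namespace InfCherednik

universe u v w

/-! ### The Lie algebra `L ⋉ M` for a Lie module `M` -/

/-- A module `M`, regarded as an abelian Lie algebra. -/
def AbelianLie (M : Type*) := M

instance (M : Type*) [AddCommGroup M] : AddCommGroup (AbelianLie M) :=
  inferInstanceAs (AddCommGroup M)

instance (R M : Type*) [CommRing R] [AddCommGroup M] [Module R M] : Module R (AbelianLie M) :=
  inferInstanceAs (Module R M)

instance (M : Type*) [AddCommGroup M] : LieRing (AbelianLie M) where
  bracket _ _ := 0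
  add_lie _ _ _ := (add_zero 0).symm
  lie_add _ _ _ := (add_zero 0).symm
  lie_self _ := rfl
  leibniz_lie _ _ _ := (add_zero 0).symm

instance (R M : Type*) [CommRing R] [AddCommGroup M] [Module R M] :
    LieAlgebra R (AbelianLie M) where
  lie_smul r _ _ := (smul_zero r).symm

/-- The identity map from the abelian Lie algebra `M` to the module `M`. -/
def AbelianLie.val (R : Type*) {M : Type*} [CommRing R] [AddCommGroup M] [Module R M] :
    AbelianLie M ≃ₗ[R] M := LinearEquiv.refl R M

section Semidirect

variable (R : Type u) (L : Type v) (M : Type w) [CommRing R] [LieRing L] [LieAlgebra R L]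
  [AddCommGroup M] [Module R M] [LieRingModule L M] [LieModule R L M]

/-- The action of `L` on `M`, as derivations of the abelian Lie algebra `M`. -/
def abDer : L →ₗ⁅R⁆ LieDerivation R (AbelianLie M) (AbelianLie M) where
  toFun x :=
    { toLinearMap := (LieModule.toEnd R L M x : M →ₗ[R] M)
      leibniz' := fun _ _ => ((LieModule.toEnd R L M x).map_zero).trans (sub_zero 0).symm }
  map_add' x y := LieDerivation.ext fun m => add_lie (M := M) x y m
  map_smul' r x := LieDerivation.ext fun m => smul_lie (M := M) r x m
  map_lie' {x y} := LieDerivation.ext fun m => lie_lie (M := M) x y m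

/-- The semidirect product Lie algebra `L ⋉ M`, in which `M` is an abelian ideal and
`[x, m] = x • m` for `x` in `L`, `m` in `M`. -/
abbrev Semidirect : Type (max v w) := LieAlgebra.SemiDirectSum (AbelianLie M) L (abDer R L M)

variable {L M}

/-- The inclusion of `L` in `U(L ⋉ M)`. -/
def uLie (x : L) : UniversalEnvelopingAlgebra R (Semidirect R L M) :=
  UniversalEnvelopingAlgebra.ι R (⟨0, x⟩ : Semidirect R L M)

/-- The inclusion of `M` in `U(L ⋉ M)`. -/
def uVec (m : M) : UniversalEnvelopingAlgebra R (Semidirect R L M) :=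
  UniversalEnvelopingAlgebra.ι R (⟨(AbelianLie.val R).symm m, 0⟩ : Semidirect R L M)

end Semidirect

/-! ### The algebra `U(L) ⋉ T(M)` and its quotient `H_γ` -/

section Hecke

variable (R : Type u) (L : Type v) (M : Type w) [CommRing R] [LieRing L] [LieAlgebra R L]
  [AddCommGroup M] [Module R M] [LieRingModule L M]

/-- Defining relations of `U(L) ⋉ T(M)`: `x y - y x = [x, y]` and `x m - m x = x • m`
for `x, y` in `L` and `m` in `M`. -/
inductive SmashRel : TensorAlgebra R (L × M) → TensorAlgebra R (L × M) → Prop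
  | lie (x y : L) : SmashRel
      (TensorAlgebra.ι R (x, (0 : M)) * TensorAlgebra.ι R (y, (0 : M)))
      (TensorAlgebra.ι R (y, (0 : M)) * TensorAlgebra.ι R (x, (0 : M)) +
        TensorAlgebra.ι R (⁅x, y⁆, (0 : M)))
  | act (x : L) (m : M) : SmashRel
      (TensorAlgebra.ι R (x, (0 : M)) * TensorAlgebra.ι R ((0 : L), m))
      (TensorAlgebra.ι R ((0 : L), m) * TensorAlgebra.ι R (x, (0 : M)) +
        TensorAlgebra.ι R ((0 : L), ⁅x, m⁆))

/-- The semidirect product algebra `U(L) ⋉ T(M)`. -/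
def Smash : Type (max u v w) := RingQuot (SmashRel R L M)

instance : Ring (Smash R L M) := inferInstanceAs (Ring (RingQuot (SmashRel R L M)))

instance : Algebra R (Smash R L M) := inferInstanceAs (Algebra R (RingQuot (SmashRel R L M)))

/-- The quotient map onto `U(L) ⋉ T(M)`. -/
def Smash.mk : TensorAlgebra R (L × M) →ₐ[R] Smash R L M := RingQuot.mkAlgHom R (SmashRel R L M)

/-- The map `L × M → U(L) ⋉ T(M)`. -/
def Smash.ι : L × M →ₗ[R] Smash R L M :=
  (Smash.mk R L M).toLinearMap ∘ₗ TensorAlgebra.ι R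

/-- The canonical map `U(L) → U(L) ⋉ T(M)`. -/
def Smash.ofU : UniversalEnvelopingAlgebra R L →ₐ[R] Smash R L M :=
  UniversalEnvelopingAlgebra.lift R
    { toLinearMap := Smash.ι R L M ∘ₗ LinearMap.inl R L M
      map_lie' := fun {x y} => by
        have h : Smash.mk R L M _ = Smash.mk R L M _ :=
          RingQuot.mkAlgHom_rel R (SmashRel.lie (R := R) (M := M) x y)
        rw [map_mul, map_add, map_mul] at h
        exact (sub_eq_of_eq_add' h).symm }

/-- The canonical map `M → U(L) ⋉ T(M)`. -/
def Smash.ofV : M →ₗ[R] Smash R L M := Smash.ι R L M ∘ₗ LinearMap.inr R L M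

variable {R L M}
variable (γ : M →ₗ[R] M →ₗ[R] UniversalEnvelopingAlgebra R L)

/-- The relations `v w - w v = γ(v, w)`. -/
inductive HeckeRel : Smash R L M → Smash R L M → Prop
  | comm (v w : M) : HeckeRel (Smash.ofV R L M v * Smash.ofV R L M w)
      (Smash.ofV R L M w * Smash.ofV R L M v + Smash.ofU R L M (γ v w))

/-- The algebra `H_γ`, the quotient of `U(L) ⋉ T(M)` by the relations `[v, w] = γ(v, w)`. -/
def Hecke : Type (max u v w) := RingQuot (HeckeRel γ)

instance : Ring (Hecke γ) := inferInstanceAs (Ring (RingQuot (HeckeRel γ)))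

instance : Algebra R (Hecke γ) := inferInstanceAs (Algebra R (RingQuot (HeckeRel γ)))

/-- The quotient map `U(L) ⋉ T(M) → H_γ`. -/
def Hecke.mk : Smash R L M →ₐ[R] Hecke γ := RingQuot.mkAlgHom R (HeckeRel γ)

/-- The canonical map `U(L) → H_γ`. -/
def Hecke.ofU : UniversalEnvelopingAlgebra R L →ₐ[R] Hecke γ :=
  (Hecke.mk γ).comp (Smash.ofU R L M)

/-- The canonical map `M → H_γ`. -/
def Hecke.ofV : M →ₗ[R] Hecke γ :=
  (Hecke.mk γ).toLinearMap ∘ₗ Smash.ofV R L M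

theorem Hecke.ofV_comm (v w : M) : Hecke.ofV γ v * Hecke.ofV γ w =
    Hecke.ofV γ w * Hecke.ofV γ v + Hecke.ofU γ (γ v w) := by
  have h : Hecke.mk γ _ = Hecke.mk γ _ :=
    RingQuot.mkAlgHom_rel R (HeckeRel.comm (γ := γ) v w)
  rw [map_mul, map_add, map_mul] at h
  exact h

theorem Hecke.act (x : L) (m : M) :
    Hecke.ofU γ (UniversalEnvelopingAlgebra.ι R x) * Hecke.ofV γ m =
      Hecke.ofV γ m * Hecke.ofU γ (UniversalEnvelopingAlgebra.ι R x) + Hecke.ofV γ ⁅x, m⁆ := by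
  have h : Smash.mk R L M _ = Smash.mk R L M _ :=
    RingQuot.mkAlgHom_rel R (SmashRel.act (R := R) x m)
  have h' : Hecke.ofU γ (UniversalEnvelopingAlgebra.ι R x) =
      Hecke.mk γ (Smash.mk R L M (TensorAlgebra.ι R (x, (0 : M)))) :=
    congrArg (Hecke.mk γ) (UniversalEnvelopingAlgebra.lift_ι_apply R _ x)
  replace h := congrArg (Hecke.mk γ) h
  simp only [map_mul, map_add] at h
  rw [h']
  exact h

end Hecke

/-! ### Filtered algebras and their associated graded algebras -/

/-- An increasing multiplicative filtration of an algebra by submodules, indexed by `ℕ`. -/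
structure Filtr (R : Type u) (A : Type v) [CommRing R] [Ring A] [Algebra R A] where
  toFun : ℕ → Submodule R A
  mono : Monotone toFun
  one_mem : (1 : A) ∈ toFun 0
  mul_mem : ∀ {i j : ℕ} {a b : A}, a ∈ toFun i → b ∈ toFun j → a * b ∈ toFun (i + j)

namespace Filtr

variable {R : Type u} {A : Type v} [CommRing R] [Ring A] [Algebra R A] (F : Filtr R A)

/-- The previous step `F_{n-1}` of the filtration, with `F_{-1} = 0`. -/
def lt : ℕ → Submodule R A
  | 0 => ⊥
  | n + 1 => F.toFun n

theorem lt_mul {i j : ℕ} {a b : A} (ha : a ∈ F.lt i) (hb : b ∈ F.toFun j) :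
    a * b ∈ F.lt (i + j) := by
  cases i with
  | zero =>
    have h : a = 0 := by simpa [lt] using ha
    simp [h]
  | succ i =>
    rw [Nat.succ_add]
    exact F.mul_mem ha hb

theorem mul_lt {i j : ℕ} {a b : A} (ha : a ∈ F.toFun i) (hb : b ∈ F.lt j) :
    a * b ∈ F.lt (i + j) := by
  cases j with
  | zero =>
    have h : b = 0 := by simpa [lt] using hb
    simp [h]
  | succ j => exact F.mul_mem ha hb

/-- The graded piece `F_n / F_{n-1}`. -/
abbrev Piece (n : ℕ) : Type v := F.toFun n ⧸ (F.lt n).comap (F.toFun n).subtype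

/-- The projection `F_n → F_n / F_{n-1}`. -/
abbrev proj (n : ℕ) : F.toFun n →ₗ[R] F.Piece n :=
  ((F.lt n).comap (F.toFun n).subtype).mkQ

theorem proj_eq_proj {n : ℕ} {a b : F.toFun n} :
    F.proj n a = F.proj n b ↔ (a : A) - b ∈ F.lt n := by
  rw [Submodule.mkQ_apply, Submodule.mkQ_apply, Submodule.Quotient.eq]
  rfl

theorem gmk_proj_eq {i j : ℕ} (h : i = j) (a : F.toFun i) (b : F.toFun j) (hab : (a : A) = b) :
    (GradedMonoid.mk i (F.proj i a) : GradedMonoid F.Piece) = GradedMonoid.mk j (F.proj j b) := by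
  subst h
  rw [Subtype.ext hab]

/-- The product `F_i / F_{i-1} × F_j / F_{j-1} → F_{i+j} / F_{i+j-1}` induced by the product
of `A`. -/
def pieceMul {i j : ℕ} (p : F.Piece i) (q : F.Piece j) : F.Piece (i + j) :=
  Quotient.liftOn₂' p q (fun a b => F.proj (i + j) ⟨(a : A) * b, F.mul_mem a.2 b.2⟩) (by
    intro a₁ b₁ a₂ b₂ ha hb
    have ha' : (a₁ : A) - a₂ ∈ F.lt i := (Submodule.quotientRel_def ((F.lt i).comap (F.toFun i).subtype)).1 ha
    have hb' : (b₁ : A) - b₂ ∈ F.lt j := (Submodule.quotientRel_def ((F.lt j).comap (F.toFun j).subtype)).1 hb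
    rw [proj_eq_proj]
    have h : (a₁ : A) * b₁ - a₂ * b₂ = (a₁ - a₂) * b₁ + a₂ * (b₁ - b₂) := by noncomm_ring
    change (a₁ : A) * b₁ - a₂ * b₂ ∈ F.lt (i + j)
    rw [h]
    exact add_mem (F.lt_mul ha' b₁.2) (F.mul_lt a₂.2 hb'))

theorem pieceMul_proj {i j : ℕ} (a : F.toFun i) (b : F.toFun j) :
    F.pieceMul (F.proj i a) (F.proj j b) = F.proj (i + j) ⟨(a : A) * b, F.mul_mem a.2 b.2⟩ := rfl

theorem proj_surj {n : ℕ} (p : F.Piece n) : ∃ a, F.proj n a = p := Submodule.mkQ_surjective _ p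

instance : GradedMonoid.GMul F.Piece where
  mul p q := F.pieceMul p q

instance : GradedMonoid.GOne F.Piece where
  one := F.proj 0 ⟨1, F.one_mem⟩

instance : GradedMonoid.GMonoid F.Piece where
  one_mul := by
    rintro ⟨i, p⟩
    obtain ⟨a, rfl⟩ := F.proj_surj p
    exact F.gmk_proj_eq (zero_add i) _ _ (one_mul _)
  mul_one := by
    rintro ⟨i, p⟩
    obtain ⟨a, rfl⟩ := F.proj_surj p
    exact F.gmk_proj_eq (add_zero i) _ _ (mul_one _)
  mul_assoc := by
    rintro ⟨i, p⟩ ⟨j, q⟩ ⟨l, r⟩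
    obtain ⟨a, rfl⟩ := F.proj_surj p
    obtain ⟨b, rfl⟩ := F.proj_surj q
    obtain ⟨c, rfl⟩ := F.proj_surj r
    exact F.gmk_proj_eq (add_assoc i j l) _ _ (mul_assoc _ _ _)

theorem gmul_proj {i j : ℕ} (a : F.toFun i) (b : F.toFun j) :
    (GradedMonoid.GMul.mul (F.proj i a) (F.proj j b) : F.Piece (i + j)) =
      F.proj (i + j) ⟨(a : A) * b, F.mul_mem a.2 b.2⟩ := rfl

instance : DirectSum.GSemiring F.Piece where
  mul_zero := by
    intro i j p
    obtain ⟨a, rfl⟩ := F.proj_surj p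
    rw [← map_zero (F.proj j), gmul_proj, ← map_zero (F.proj (i + j))]
    exact congrArg _ (Subtype.ext (mul_zero _))
  zero_mul := by
    intro i j p
    obtain ⟨a, rfl⟩ := F.proj_surj p
    rw [← map_zero (F.proj i), gmul_proj, ← map_zero (F.proj (i + j))]
    exact congrArg _ (Subtype.ext (zero_mul _))
  mul_add := by
    intro i j p q r
    obtain ⟨a, rfl⟩ := F.proj_surj p
    obtain ⟨b, rfl⟩ := F.proj_surj q
    obtain ⟨c, rfl⟩ := F.proj_surj r
    rw [← map_add, gmul_proj, gmul_proj, gmul_proj, ← map_add]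
    exact congrArg _ (Subtype.ext (mul_add _ _ _))
  add_mul := by
    intro i j p q r
    obtain ⟨a, rfl⟩ := F.proj_surj p
    obtain ⟨b, rfl⟩ := F.proj_surj q
    obtain ⟨c, rfl⟩ := F.proj_surj r
    rw [← map_add, gmul_proj, gmul_proj, gmul_proj, ← map_add]
    exact congrArg _ (Subtype.ext (add_mul _ _ _))
  natCast n := n • F.proj 0 ⟨1, F.one_mem⟩
  natCast_zero := zero_smul _ _
  natCast_succ n := succ_nsmul _ n

instance : DirectSum.GRing F.Piece where
  intCast n := n • F.proj 0 ⟨1, F.one_mem⟩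
  intCast_ofNat n := natCast_zsmul _ n
  intCast_negSucc_ofNat n := negSucc_zsmul _ n

instance : DirectSum.GAlgebra R F.Piece where
  toFun :=
    { toFun := fun r => r • F.proj 0 ⟨1, F.one_mem⟩
      map_zero' := zero_smul _ _
      map_add' := fun r s => add_smul r s _ }
  map_one := one_smul _ _
  map_mul r s := F.gmk_proj_eq (zero_add 0).symm ((r * s) • ⟨1, F.one_mem⟩)
    ⟨(r • (1 : A)) * (s • (1 : A)), _⟩ (by simp [mul_smul, smul_comm r s])
  commutes := by
    rintro r ⟨i, p⟩
    obtain ⟨a, rfl⟩ := F.proj_surj p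
    exact F.gmk_proj_eq ((zero_add i).trans (add_zero i).symm) ⟨(r • (1 : A)) * a, _⟩
      ⟨a * (r • (1 : A)), _⟩ (by simp)
  smul_def := by
    rintro r ⟨i, p⟩
    obtain ⟨a, rfl⟩ := F.proj_surj p
    exact F.gmk_proj_eq (zero_add i).symm (r • a) ⟨(r • (1 : A)) * a, _⟩ (by simp)

/-- The associated graded algebra `⨁ n, F_n / F_{n-1}`. -/
def Gr : Type v := DirectSum ℕ F.Piece

instance : Ring F.Gr := inferInstanceAs (Ring (DirectSum ℕ F.Piece))

instance : Algebra R F.Gr := inferInstanceAs (Algebra R (DirectSum ℕ F.Piece))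

/-- The class in degree `n` of the associated graded algebra of an element of `F_n`. -/
def symbol (n : ℕ) : F.toFun n →ₗ[R] F.Gr := DirectSum.lof R ℕ F.Piece n ∘ₗ F.proj n

theorem symbol_mul {i j : ℕ} (a : F.toFun i) (b : F.toFun j) :
    F.symbol i a * F.symbol j b = F.symbol (i + j) ⟨(a : A) * b, F.mul_mem a.2 b.2⟩ :=
  DirectSum.of_mul_of _ _

theorem symbol_eq {i j : ℕ} (h : i = j) (a : F.toFun i) (b : F.toFun j)
    (hab : (a : A) - b ∈ F.lt j) : F.symbol i a = F.symbol j b := by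
  subst h
  exact congrArg (DirectSum.lof R ℕ F.Piece i) (F.proj_eq_proj.2 hab)

/-- `g` is the leading term of `a`: it is nonzero, and it is the class of `a` in
`F_n / F_{n-1}` for some `n`. -/
def IsLeadingTerm (a : A) (g : F.Gr) : Prop :=
  g ≠ 0 ∧ ∃ (n : ℕ) (ha : a ∈ F.toFun n), F.symbol n ⟨a, ha⟩ = g

/-- For a submodule `S` of `A` with the induced filtration `S ∩ F_n`, the submodule `gr S` of
`gr A`, with degree `n` component the image of `S ∩ F_n` in `F_n / F_{n-1}`. -/
def grSub (S : Submodule R A) : Submodule R F.Gr :=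
  ⨆ n : ℕ, (S.comap (F.toFun n).subtype).map (F.symbol n)

end Filtr

/-! ### The filtration of `H_γ` and the PBW property -/

section PBW

variable {R : Type u} {L : Type v} {M : Type w} [CommRing R] [LieRing L] [LieAlgebra R L]
  [AddCommGroup M] [Module R M] [LieRingModule L M]
variable (γ : M →ₗ[R] M →ₗ[R] UniversalEnvelopingAlgebra R L)

/-- The image of `U(L)` in `H_γ`, as a submodule. -/
def Hecke.imU : Submodule R (Hecke γ) := Subalgebra.toSubmodule (Hecke.ofU γ).range

/-- The span of the products of elements of `U(L)` and of at most `n` elements of `M`, in any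
order: `U(L) · ((R + M) · U(L))ⁿ`. -/
def Hecke.filtrFun (n : ℕ) : Submodule R (Hecke γ) :=
  Hecke.imU γ * ((1 ⊔ LinearMap.range (Hecke.ofV γ)) * Hecke.imU γ) ^ n

theorem Hecke.imU_mul_imU : Hecke.imU γ * Hecke.imU γ = Hecke.imU γ :=
  Subalgebra.isIdempotentElem_toSubmodule _

theorem Hecke.one_le_imU : 1 ≤ Hecke.imU γ := by
  rw [Submodule.one_le]
  exact one_mem (Hecke.ofU γ).range

theorem Hecke.filtrFun_mul_imU (n : ℕ) :
    Hecke.filtrFun γ n * Hecke.imU γ = Hecke.filtrFun γ n := by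
  cases n with
  | zero => simp [Hecke.filtrFun, Hecke.imU_mul_imU]
  | succ n => simp only [Hecke.filtrFun, pow_succ, mul_assoc, Hecke.imU_mul_imU]

theorem Hecke.filtrFun_mul (i j : ℕ) :
    Hecke.filtrFun γ i * Hecke.filtrFun γ j = Hecke.filtrFun γ (i + j) := by
  conv_lhs => rw [Hecke.filtrFun.eq_1 γ j, ← mul_assoc, Hecke.filtrFun_mul_imU]
  rw [Hecke.filtrFun, Hecke.filtrFun, mul_assoc, ← pow_add]

/-- The algebra filtration of `H_γ` with `deg α = 0` for `α` in `U(L)` and `deg v = 1` for `v`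
in `M`. -/
def Hecke.filtr : Filtr R (Hecke γ) where
  toFun := Hecke.filtrFun γ
  mono := by
    refine monotone_nat_of_le_succ fun n => ?_
    rw [Hecke.filtrFun, Hecke.filtrFun, pow_succ, ← mul_assoc]
    refine le_mul_of_one_le_right' ?_
    exact le_trans (one_mul (1 : Submodule R (Hecke γ))).ge
      (mul_le_mul' le_sup_left (Hecke.one_le_imU γ))
  one_mem := by
    rw [Hecke.filtrFun, pow_zero, mul_one]
    exact one_mem (Hecke.ofU γ).range
  mul_mem {i j a b} ha hb := by
    rw [← Hecke.filtrFun_mul]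
    exact Submodule.mul_mem_mul ha hb

theorem Hecke.ofU_mem (a : UniversalEnvelopingAlgebra R L) :
    Hecke.ofU γ a ∈ (Hecke.filtr γ).toFun 0 := by
  change _ ∈ Hecke.filtrFun γ 0
  rw [Hecke.filtrFun, pow_zero, mul_one]
  exact ⟨a, rfl⟩

theorem Hecke.ofV_mem (m : M) : Hecke.ofV γ m ∈ (Hecke.filtr γ).toFun 1 := by
  change _ ∈ Hecke.filtrFun γ 1
  rw [Hecke.filtrFun, pow_one]
  have h1 : (1 : Hecke γ) ∈ Hecke.imU γ := one_mem (Hecke.ofU γ).range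
  have h2 : Hecke.ofV γ m ∈ (1 ⊔ LinearMap.range (Hecke.ofV γ) : Submodule R (Hecke γ)) :=
    (le_sup_right : _ ≤ (1 ⊔ LinearMap.range (Hecke.ofV γ) : Submodule R (Hecke γ))) ⟨m, rfl⟩
  simpa using Submodule.mul_mem_mul h1 (Submodule.mul_mem_mul h2 h1)

/-- The associated graded algebra `gr(H_γ)`. -/
abbrev Hecke.Gr : Type (max u v w) := (Hecke.filtr γ).Gr

/-- The class in degree `0` of an element of `L`. -/
def Hecke.cls0 : L →ₗ[R] Hecke.Gr γ :=
  (Hecke.filtr γ).symbol 0 ∘ₗ LinearMap.codRestrict ((Hecke.filtr γ).toFun 0)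
    ((Hecke.ofU γ).toLinearMap ∘ₗ (UniversalEnvelopingAlgebra.ι R : L →ₗ⁅R⁆ _).toLinearMap)
    (fun _ => Hecke.ofU_mem γ _)

/-- The class in degree `1` of an element of `M`. -/
def Hecke.cls1 : M →ₗ[R] Hecke.Gr γ :=
  (Hecke.filtr γ).symbol 1 ∘ₗ LinearMap.codRestrict ((Hecke.filtr γ).toFun 1)
    (Hecke.ofV γ) (Hecke.ofV_mem γ)

theorem Hecke.cls0_apply (x : L) : Hecke.cls0 γ x = (Hecke.filtr γ).symbol 0
    ⟨Hecke.ofU γ (UniversalEnvelopingAlgebra.ι R x), Hecke.ofU_mem γ _⟩ := rfl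

theorem Hecke.cls1_apply (m : M) : Hecke.cls1 γ m = (Hecke.filtr γ).symbol 1
    ⟨Hecke.ofV γ m, Hecke.ofV_mem γ _⟩ := rfl

variable [LieModule R L M]

/-- The linear map `L ⋉ M → gr(H_γ)` sending `x` in `L` to its class in degree `0` and `m` in `M`
to its class in degree `1`. -/
def Hecke.natLin : Semidirect R L M →ₗ[R] Hecke.Gr γ :=
  Hecke.cls0 γ ∘ₗ (LieAlgebra.SemiDirectSum.projr (abDer R L M)).toLinearMap +
    Hecke.cls1 γ ∘ₗ (AbelianLie.val R).toLinearMap ∘ₗ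
      LieAlgebra.SemiDirectSum.projl (abDer R L M)

theorem Hecke.natLin_lie (p q : Semidirect R L M) :
    Hecke.natLin γ ⁅p, q⁆ = ⁅Hecke.natLin γ p, Hecke.natLin γ q⁆ := by
  obtain ⟨v, x⟩ := p
  obtain ⟨w, y⟩ := q
  have e1 : ∀ x y : L, Hecke.cls0 γ x * Hecke.cls0 γ y =
      Hecke.cls0 γ y * Hecke.cls0 γ x + Hecke.cls0 γ ⁅x, y⁆ := by
    intro x y
    simp only [Hecke.cls0_apply, Filtr.symbol_mul, ← map_add]
    refine congrArg _ (Subtype.ext ?_)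
    change _ * _ = _ * _ + _
    change _ = _ + Hecke.ofU γ (UniversalEnvelopingAlgebra.ι R ⁅x, y⁆)
    rw [LieHom.map_lie, Ring.lie_def, map_sub, map_mul, map_mul, add_sub_cancel]
  have e2 : ∀ (x : L) (m : M), Hecke.cls0 γ x * Hecke.cls1 γ m =
      Hecke.cls1 γ m * Hecke.cls0 γ x + Hecke.cls1 γ ⁅x, m⁆ := by
    intro x m
    simp only [Hecke.cls0_apply, Hecke.cls1_apply, Filtr.symbol_mul, ← map_add]
    refine Filtr.symbol_eq _ (zero_add 1) _ _ ?_
    change _ * _ - (_ * _ + _) ∈ _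
    rw [Hecke.act, sub_self]
    exact zero_mem _
  have e3 : ∀ v w : M, Hecke.cls1 γ v * Hecke.cls1 γ w = Hecke.cls1 γ w * Hecke.cls1 γ v := by
    intro v w
    simp only [Hecke.cls1_apply, Filtr.symbol_mul]
    refine Filtr.symbol_eq _ rfl _ _ ?_
    change _ * _ - _ * _ ∈ (Hecke.filtr γ).toFun 1
    rw [Hecke.ofV_comm, add_sub_cancel_left]
    exact (Hecke.filtr γ).mono zero_le_one (Hecke.ofU_mem γ _)
  have e4 : ∀ (v : AbelianLie M) (x : L), Hecke.natLin γ (⟨v, x⟩ : Semidirect R L M) =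
      Hecke.cls0 γ x + Hecke.cls1 γ (AbelianLie.val R v) := fun _ _ => rfl
  have e5 : AbelianLie.val R (⁅v, w⁆ + abDer R L M x w - abDer R L M y v) =
      ⁅x, AbelianLie.val R w⁆ - ⁅y, AbelianLie.val R v⁆ := by
    rw [map_sub, map_add]
    exact congrArg (· - _) (zero_add _)
  rw [LieAlgebra.SemiDirectSum.lie_eq_mk, e4, e4, e4, e5, map_sub, Ring.lie_def]
  simp only [mul_add, add_mul]
  rw [e1 x y, e2 x, e2 y, e3 (AbelianLie.val R v)]
  abel

/-- The natural algebra homomorphism `U(L ⋉ M) → gr(H_γ)`. -/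
def Hecke.natMap : UniversalEnvelopingAlgebra R (Semidirect R L M) →ₐ[R] Hecke.Gr γ :=
  UniversalEnvelopingAlgebra.lift R
    { toLinearMap := Hecke.natLin γ
      map_lie' := fun {p q} => Hecke.natLin_lie γ p q }

/-- `γ` is `L`-invariant: `γ(x v, w) + γ(v, x w) = [x, γ(v, w)]`. -/
def IsInvariant : Prop :=
  ∀ (x : L) (v w : M), γ ⁅x, v⁆ w + γ v ⁅x, w⁆ =
    UniversalEnvelopingAlgebra.ι R x * γ v w - γ v w * UniversalEnvelopingAlgebra.ι R x

/-- `H_γ` is an infinitesimal Hecke algebra: `γ` is an `L`-invariant skew-symmetric pairing and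
the natural map `U(L ⋉ M) → gr(H_γ)` is an isomorphism. -/
structure IsInfinitesimalHecke : Prop where
  invariant : IsInvariant γ
  alt : ∀ v : M, γ v v = 0
  pbw : Function.Bijective (Hecke.natMap γ)

end PBW

/-! ### The case of `gl_2` -/

section GL2

variable (k : Type u) [Field k]

/-- The Lie algebra `gl_2`. -/
abbrev Gl2 : Type u := Matrix (Fin 2) (Fin 2) k

/-- The `gl_2`-module `k² ⊕ (k²)*`. -/
abbrev V : Type u := (Fin 2 → k) × Module.Dual k (Fin 2 → k)

instance : LieRingModule (Gl2 k) (V k) where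
  bracket A v := (⁅A, v.1⁆, ⁅A, v.2⁆)
  add_lie A B v := Prod.ext (add_lie A B v.1) (add_lie A B v.2)
  lie_add A v w := Prod.ext (lie_add A v.1 w.1) (lie_add A v.2 w.2)
  leibniz_lie A B v := Prod.ext (leibniz_lie A B v.1) (leibniz_lie A B v.2)

instance : LieModule k (Gl2 k) (V k) where
  smul_lie t A v := Prod.ext (smul_lie t A v.1) (smul_lie t A v.2)
  lie_smul t A v := Prod.ext (lie_smul t A v.1) (lie_smul t A v.2)

variable {k} in
/-- `H_γ` is an infinitesimal Cherednik algebra of `gl_2`: it is an infinitesimal Hecke algebra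
for `gl_2` and `k² ⊕ (k²)*` with `γ` zero on `k² × k²` and on `(k²)* × (k²)*`. -/
structure IsInfinitesimalCherednik
    (γ : V k →ₗ[k] V k →ₗ[k] UniversalEnvelopingAlgebra k (Gl2 k)) : Prop
    extends IsInfinitesimalHecke γ where
  zero_left : ∀ v w : Fin 2 → k, γ (v, 0) (w, 0) = 0
  zero_right : ∀ v w : Module.Dual k (Fin 2 → k), γ (0, v) (0, w) = 0

/-- The algebra `U(gl_2 ⋉ (k² ⊕ (k²)*))`. -/
abbrev UV : Type u := UniversalEnvelopingAlgebra k (Semidirect k (Gl2 k) (V k))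

/-- The element `e` of `sl_2`, in the enveloping algebra. -/
def e : UV k := uLie k (!![0, 1; 0, 0] : Gl2 k)

/-- The element `f` of `sl_2`, in the enveloping algebra. -/
def f : UV k := uLie k (!![0, 0; 1, 0] : Gl2 k)

/-- The element `h` of `sl_2`, in the enveloping algebra. -/
def h : UV k := uLie k (!![1, 0; 0, -1] : Gl2 k)

/-- The identity matrix `τ` of `gl_2`, in the enveloping algebra. -/
def τ : UV k := uLie k (1 : Gl2 k)

/-- The first basis vector `x` of `k²`, in the enveloping algebra. -/
def x : UV k := uVec k ((![1, 0], 0) : V k)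

/-- The second basis vector `y` of `k²`, in the enveloping algebra. -/
def y : UV k := uVec k ((![0, 1], 0) : V k)

/-- The basis vector `x₁(a, b) = b` of `(k²)*`, in the enveloping algebra. It satisfies `[e, x₁] = 0`, `[f, x₁] = y₁`, `[h, x₁] = x₁`. -/
def x₁ : UV k := uVec k ((0, LinearMap.proj 1) : V k)

/-- The basis vector `y₁(a, b) = -a` of `(k²)*`, in the enveloping algebra. -/
def y₁ : UV k := uVec k ((0, -LinearMap.proj 0) : V k)

/-- `b = y₁ x - x₁ y`. -/
def b : UV k := y₁ k * x k - x₁ k * y k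

/-- `d = τ b - (2 e y₁ y + h (y₁ x + x₁ y) - 2 f x₁ x)`. -/
def d : UV k := τ k * b k -
  (2 * e k * y₁ k * y k + h k * (y₁ k * x k + x₁ k * y k) - 2 * f k * x₁ k * x k)

end GL2

end InfCherednik

end

/-! Write g = gl_2, let E_ij be the matrix units, and let v_i and w_i be the standard bases of k²
and its dual. The main tool is a calculus of difference operators. A matrix representation θ of a
Lie algebra gives an algebra map a ↦ a + θ(a) from U to matrices over U; if vectors v_l transform by
θ, then [u, v_l] = ∑ v_i D_il(u), where D = `diff` is this map minus the identity
(`commutator_eq_sum_diff`). D lowers the standard filtration by one. Modulo lower order it acts as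
∂/∂E_ij for the defining representation (`dV`) and as -∂/∂E_ji for the dual one (`dW`). Brackets
with V thus become first-order differential equations on top parts, handled with Euler's identity
(`euler`). All of this is phrased as congruences modulo the filtration, so gr U(g) never has to be
identified with a polynomial ring.

Centre of U(g ⋉ V). As a vector space this algebra is S(V) ⊗ U(g) (`mulMap`). If z commutes with V,
its gradient in the E_ij is, to top order, a 2 × 2 matrix killed on the left by the generic vector
and on the right by the generic covector, hence proportional to one rank-one matrix κ
(`CommV.kappa_smul`). By Euler's identity the top part of z is a power of the cubic C = ∑ κ_ij E_ij
times a coefficient in S(V) (`CommV.exists_factorial_smul`). That coefficient is g-invariant, so it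
is a polynomial in the pairing w_0 v_0 + w_1 v_1 (`exists_aeval_quadPoly_of_invariant`). Subtracting
and descending proves generation; comparing top parts proves independence. Up to nonzero scalars b
is the pairing and d is C.

Centre of H_γ. By the PBW hypothesis gr(H_γ) is U(g ⋉ V), so it suffices to lift b and d to central
elements; a general symbol argument then transports generation and independence (`aeval_injective`,
`aeval_surjective`, `grSub_center`). The same formulas in H_γ give z commuting with g, with [z, v_j]
= ∑ v_i G_ij and [z, w_j] = ∑ w_i G'_ij for G, G' over U(g). Since [v, w] lies in U(g) and so
commutes with z, the Jacobi identity yields dW_al G_ij = dV_ij G'_al (`HasBracket.cocycle`). In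
positive degree this forces G' = -Gᵀ on top parts and makes G a closed 1-form; degree one needs in
addition that there is no invariant antisymmetric form on g. The Poincaré lemma gives an invariant c
in U(g) with gradient G, and z - c has brackets of lower degree (`exists_central_diff_sub_mem`). The
descent ends with scalar G and G', which are equalised by a multiple of τ and then vanish because
some [w, v] is nonzero. If every [w, v] is zero, the uncorrected lifts are already central. -/

noncomputable section

/-! ### Standard filtration of an enveloping algebra and difference operators. -/

namespace UniversalEnvelopingAlgebra

section General

variable {k : Type*} {L : Type*} [CommRing k] [LieRing L] [LieAlgebra k L]

local notation "𝔘" => UniversalEnvelopingAlgebra k L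

/-- By the universal property, `ι` lifted into the subalgebra it generates and followed by the
inclusion is the identity, so every element lies in that subalgebra. -/
theorem adjoin_range_ι : Algebra.adjoin k (Set.range (ι k : L → 𝔘)) = ⊤ := by
  set S : Subalgebra k 𝔘 := Algebra.adjoin k (Set.range (ι k : L → 𝔘)) with hS
  let g : L →ₗ⁅k⁆ S :=
    { toFun := fun a => ⟨ι k a, Algebra.subset_adjoin ⟨a, rfl⟩⟩
      map_add' := fun a b => Subtype.ext (map_add (ι k) a b)
      map_smul' := fun r a => Subtype.ext (map_smul (ι k) r a)
      map_lie' := fun {a b} => Subtype.ext (LieHom.map_lie (ι k) a b) }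
  have h : S.val.comp (lift k g) = AlgHom.id k 𝔘 := by
    ext a
    change ((lift k g (ι k a) : S) : 𝔘) = ι k a
    rw [lift_ι_apply]
    rfl
  rw [eq_top_iff]
  intro u _
  have hu := congrArg (fun F : 𝔘 →ₐ[k] 𝔘 => F u) h
  change ((lift k g u : S) : 𝔘) = u at hu
  rw [← hu]
  exact (lift k g u).2

theorem induct {P : 𝔘 → Prop} (hC : ∀ r : k, P (algebraMap k 𝔘 r)) (hι : ∀ a : L, P (ι k a))
    (hadd : ∀ u v, P u → P v → P (u + v)) (hmul : ∀ u v, P u → P v → P (u * v)) (u : 𝔘) :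
    P u := by
  have hu : u ∈ Algebra.adjoin k (Set.range (ι k : L → 𝔘)) := by
    rw [adjoin_range_ι]; trivial
  induction hu using Algebra.adjoin_induction with
  | mem x hx => obtain ⟨a, rfl⟩ := hx; exact hι a
  | algebraMap r => exact hC r
  | add x y _ _ hx hy => exact hadd x y hx hy
  | mul x y _ _ hx hy => exact hmul x y hx hy

theorem ι_mul_ι (a b : L) : ι k a * ι k b = ι k b * ι k a + ι k ⁅a, b⁆ := by
  rw [LieHom.map_lie, Ring.lie_def, add_sub_cancel]

/-! ### The standard filtration -/

variable (k L) in
/-- The standard filtration of the enveloping algebra with a shifted index: `filt 0 = 0`, and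
`filt (n + 1)` is the span of the products of at most `n` elements of `L`. -/
def filt : ℕ → Submodule k 𝔘
  | 0 => ⊥
  | n + 1 => (1 ⊔ LinearMap.range (ι k : L →ₗ⁅k⁆ 𝔘).toLinearMap) ^ n

theorem filt_zero : filt k L 0 = ⊥ := rfl

theorem filt_one : filt k L 1 = 1 := pow_zero _

theorem mem_filt_one {u : 𝔘} : u ∈ filt k L 1 ↔ ∃ r : k, algebraMap k 𝔘 r = u := by
  rw [filt_one, Submodule.mem_one]

theorem filt_succ (n : ℕ) : filt k L (n + 2) =
    filt k L (n + 1) * (1 ⊔ LinearMap.range (ι k : L →ₗ⁅k⁆ 𝔘).toLinearMap) := pow_succ _ _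

theorem filt_mul (m n : ℕ) : filt k L (m + 1) * filt k L (n + 1) = filt k L (m + n + 1) :=
  (pow_add _ _ _).symm

theorem mul_mem_filt {m n : ℕ} {u v : 𝔘} (hu : u ∈ filt k L (m + 1)) (hv : v ∈ filt k L (n + 1)) :
    u * v ∈ filt k L (m + n + 1) := by
  rw [← filt_mul]
  exact Submodule.mul_mem_mul hu hv

theorem mul_mem_filt_left {m n : ℕ} {u v : 𝔘} (hu : u ∈ filt k L (m + 1)) (hv : v ∈ filt k L n) :
    u * v ∈ filt k L (m + n) := by
  cases n with
  | zero => rw [filt_zero, Submodule.mem_bot] at hv; simp [hv]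
  | succ n => exact mul_mem_filt hu hv

theorem mul_mem_filt_right {m n : ℕ} {u v : 𝔘} (hu : u ∈ filt k L m) (hv : v ∈ filt k L (n + 1)) :
    u * v ∈ filt k L (m + n) := by
  cases m with
  | zero => rw [filt_zero, Submodule.mem_bot] at hu; simp [hu]
  | succ m => rw [Nat.succ_add]; exact mul_mem_filt hu hv

theorem algebraMap_mem_filt (r : k) : algebraMap k 𝔘 r ∈ filt k L 1 := mem_filt_one.2 ⟨r, rfl⟩

theorem ι_mem_filt (a : L) : ι k a ∈ filt k L 2 := by
  rw [filt, pow_one]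
  exact Submodule.mem_sup_right ⟨a, rfl⟩

theorem filt_mono : Monotone (filt k L) := by
  refine monotone_nat_of_le_succ fun n => ?_
  cases n with
  | zero => exact bot_le
  | succ n =>
    rw [filt_succ]
    exact le_mul_of_one_le_right' le_sup_left

theorem ι_mul_mem_filt {n : ℕ} (a : L) {u : 𝔘} (hu : u ∈ filt k L n) :
    ι k a * u ∈ filt k L (n + 1) := by
  rw [add_comm]
  exact mul_mem_filt_left (ι_mem_filt a) hu

theorem mul_ι_mem_filt {n : ℕ} (a : L) {u : 𝔘} (hu : u ∈ filt k L n) :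
    u * ι k a ∈ filt k L (n + 1) := mul_mem_filt_right hu (ι_mem_filt a)

/-- The induction on degree behind the filtration estimates: peeling one letter off on the right
reduces a claim about the next step to lower elements and to products w · a. -/
theorem filt_succ_induction {n : ℕ} {P : 𝔘 → Prop} (hw : ∀ w ∈ filt k L (n + 1), P w)
    (hmul : ∀ w ∈ filt k L (n + 1), ∀ a : L, P (w * ι k a))
    (hadd : ∀ u v, P u → P v → P (u + v)) {u : 𝔘} (hu : u ∈ filt k L (n + 2)) : P u := by
  rw [filt_succ] at hu
  refine Submodule.mul_induction_on hu (fun w hw' a ha => ?_) hadd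
  obtain ⟨c, hc, l, hl, rfl⟩ := Submodule.mem_sup.1 ha
  obtain ⟨r, rfl⟩ := Submodule.mem_one.1 hc
  obtain ⟨a, rfl⟩ := hl
  rw [mul_add]
  refine hadd _ _ (hw _ ?_) (hmul w hw' a)
  rw [← Algebra.commutes, ← Algebra.smul_def]
  exact Submodule.smul_mem _ _ hw'

theorem exists_mem_filt (u : 𝔘) : ∃ n, u ∈ filt k L (n + 1) := by
  induction u using induct with
  | hC r => exact ⟨0, algebraMap_mem_filt r⟩
  | hι a => exact ⟨1, ι_mem_filt a⟩
  | hadd u v hu hv =>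
    obtain ⟨m, hm⟩ := hu
    obtain ⟨n, hn⟩ := hv
    exact ⟨max m n, add_mem (filt_mono (by omega) hm) (filt_mono (by omega) hn)⟩
  | hmul u v hu hv =>
    obtain ⟨m, hm⟩ := hu
    obtain ⟨n, hn⟩ := hv
    exact ⟨m + n, mul_mem_filt hm hn⟩

/-- Bracketing with a is a derivation that sends letters to letters, so it does not raise the
degree. -/
theorem ι_commutator_mem_filt (a : L) {n : ℕ} {u : 𝔘} (hu : u ∈ filt k L n) :
    ι k a * u - u * ι k a ∈ filt k L n := by
  match n with
  | 0 => rw [filt_zero, Submodule.mem_bot] at hu; simp [hu]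
  | n + 1 =>
    induction n generalizing u with
    | zero =>
      obtain ⟨r, rfl⟩ := mem_filt_one.1 hu
      rw [Algebra.commutes, sub_self]
      exact zero_mem _
    | succ n ih =>
      refine filt_succ_induction (fun w hw => filt_mono (Nat.le_succ _) (ih hw))
        (fun w hw c => ?_) (fun u v hu hv => ?_) hu
      · have h : ι k a * (w * ι k c) - w * ι k c * ι k a =
            (ι k a * w - w * ι k a) * ι k c + w * ι k ⁅a, c⁆ := by
          rw [LieHom.map_lie, Ring.lie_def]
          noncomm_ring
        rw [h]
        exact add_mem (mul_ι_mem_filt c (ih hw)) (mul_ι_mem_filt _ hw)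
      · rw [mul_add, add_mul, add_sub_add_comm]
        exact add_mem hu hv

/-! ### Difference operators attached to a matrix representation -/

variable {n : Type*} [Fintype n] [DecidableEq n]

section Diff

variable (θ : L →ₗ⁅k⁆ Matrix n n k)

/-- The homomorphism `U(L) → M_n(U(L))` sending `a` in `L` to `a + θ(a)`. -/
def twist : 𝔘 →ₐ[k] Matrix n n 𝔘 :=
  lift k
    { toFun := fun a => Matrix.scalar n (ι k a) + (θ a).map (algebraMap k 𝔘)
      map_add' := fun a b => by
        rw [map_add, map_add, map_add, Matrix.map_add _ (map_add _)]
        abel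
      map_smul' := fun r a => by
        ext i j
        by_cases hij : i = j <;>
        simp [Matrix.scalar_apply, hij, ← Algebra.smul_def]
      map_lie' := fun {a b} => by
        rw [LieHom.map_lie, LieHom.map_lie, Ring.lie_def, Ring.lie_def, Ring.lie_def]
        have hc : ∀ (u : L) (M : Matrix n n k), Matrix.scalar n (ι k u) * M.map (algebraMap k 𝔘) =
            M.map (algebraMap k 𝔘) * Matrix.scalar n (ι k u) := by
          intro u M
          ext i j
          simp [Matrix.scalar_apply, Algebra.commutes]
        rw [map_sub, map_mul, map_mul, Matrix.map_sub _ (map_sub _), Matrix.map_mul, Matrix.map_mul]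
        simp only [mul_add, add_mul, hc]
        abel }

theorem twist_ι (a : L) :
    twist θ (ι k a) = Matrix.scalar n (ι k a) + (θ a).map (algebraMap k 𝔘) :=
  lift_ι_apply k _ a

theorem twist_ι_apply (a : L) (i j : n) :
    twist θ (ι k a) i j = (if i = j then ι k a else 0) + algebraMap k 𝔘 (θ a i j) := by
  rw [twist_ι]
  simp [Matrix.scalar_apply, Matrix.diagonal_apply]

/-- The difference operators: the entries of `u ↦ twist θ u - u`. -/
def diff (i j : n) : 𝔘 →ₗ[k] 𝔘 :=
  LinearMap.proj j ∘ₗ LinearMap.proj i ∘ₗ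
    (Matrix.ofLinearEquiv k).symm.toLinearMap ∘ₗ (twist θ).toLinearMap -
    if i = j then LinearMap.id else 0

theorem diff_apply (i j : n) (u : 𝔘) :
    diff θ i j u = twist θ u i j - if i = j then u else 0 := by
  rw [diff, LinearMap.sub_apply]
  congr 1
  split_ifs <;> rfl

theorem twist_apply (i j : n) (u : 𝔘) :
    twist θ u i j = diff θ i j u + if i = j then u else 0 := by
  rw [diff_apply, sub_add_cancel]

theorem diff_ι (i j : n) (a : L) : diff θ i j (ι k a) = algebraMap k 𝔘 (θ a i j) := by
  rw [diff_apply, twist_ι_apply, add_sub_cancel_left]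

theorem diff_algebraMap (i j : n) (r : k) : diff θ i j (algebraMap k 𝔘 r) = 0 := by
  rw [diff_apply, AlgHom.commutes, Matrix.algebraMap_matrix_apply, sub_self]

/-- Multiplicativity of `twist`, rewritten for `twist` minus the identity: the Leibniz rule with a
quadratic correction, which lowers the degree by two and so does not affect top parts. -/
theorem diff_mul (i j : n) (u v : 𝔘) : diff θ i j (u * v) =
    diff θ i j u * v + u * diff θ i j v + ∑ l, diff θ i l u * diff θ l j v := by
  rw [diff_apply, map_mul]
  simp only [Matrix.mul_apply, twist_apply, add_mul, mul_add,
    Finset.sum_add_distrib, mul_ite, ite_mul, mul_zero, zero_mul, Finset.sum_ite_eq,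
    Finset.sum_ite_eq', Finset.mem_univ, if_true]
  abel

theorem diff_mul_ι (i j : n) (u : 𝔘) (a : L) : diff θ i j (u * ι k a) =
    diff θ i j u * ι k a + (θ a i j • u + ∑ l, θ a l j • diff θ i l u) := by
  rw [diff_mul]
  simp only [diff_ι, Algebra.smul_def, Algebra.commutes, add_assoc]

theorem diff_ι_mul (i j : n) (u : 𝔘) (a : L) : diff θ i j (ι k a * u) =
    ι k a * diff θ i j u + (θ a i j • u + ∑ l, θ a i l • diff θ l j u) := by
  rw [diff_mul]
  simp only [diff_ι, Algebra.smul_def]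
  abel

theorem diff_mem_filt (i j : n) {m : ℕ} {u : 𝔘} (hu : u ∈ filt k L (m + 1)) :
    diff θ i j u ∈ filt k L m := by
  induction m generalizing u i j with
  | zero =>
    obtain ⟨r, rfl⟩ := mem_filt_one.1 hu
    rw [diff_algebraMap]
    exact zero_mem _
  | succ m ih =>
    refine filt_succ_induction (fun w hw => filt_mono (Nat.le_succ _) (ih i j hw))
        (fun w hw a => ?_) (fun u v hu hv => ?_) hu
    · rw [diff_mul_ι]
      refine add_mem (mul_ι_mem_filt a (ih i j hw)) (add_mem (Submodule.smul_mem _ _ hw) ?_)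
      exact sum_mem fun l _ => Submodule.smul_mem _ _ (filt_mono (Nat.le_succ _) (ih i l hw))
    · rw [map_add]
      exact add_mem hu hv

theorem diff_eq_zero (i j : n) {u : 𝔘} (hu : u ∈ filt k L 1) : diff θ i j u = 0 := by
  simpa [filt_zero] using diff_mem_filt θ i j hu

/-- For dual representations the scalar terms θ_ij and θ'_ji produced by a letter cancel. The
first-order parts are therefore opposite, and the sum loses two degrees instead of one. -/
theorem diff_add_diff_mem_filt {θ' : L →ₗ⁅k⁆ Matrix n n k} (h : ∀ a, θ' a = -(θ a).transpose)
    (i j : n) {m : ℕ} {u : 𝔘} (hu : u ∈ filt k L (m + 2)) :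
    diff θ i j u + diff θ' j i u ∈ filt k L m := by
  have key : ∀ {m : ℕ} (w : 𝔘) (a : L), w ∈ filt k L (m + 1) →
      diff θ i j (w * ι k a) + diff θ' j i (w * ι k a) -
        (diff θ i j w + diff θ' j i w) * ι k a ∈ filt k L m := by
    intro m w a hw
    have e : diff θ i j (w * ι k a) + diff θ' j i (w * ι k a) -
        (diff θ i j w + diff θ' j i w) * ι k a =
        ∑ l, θ a l j • diff θ i l w + ∑ l, θ' a l i • diff θ' j l w := by
      simp only [diff_mul_ι, h a, Matrix.neg_apply, Matrix.transpose_apply, neg_smul]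
      noncomm_ring
    rw [e]
    exact add_mem (sum_mem fun l _ => Submodule.smul_mem _ _ (diff_mem_filt θ _ _ hw))
      (sum_mem fun l _ => Submodule.smul_mem _ _ (diff_mem_filt θ' _ _ hw))
  induction m generalizing u with
  | zero =>
    -- Since `filt 0` is zero, the cancellation must be exact in degree at most one.
    refine filt_succ_induction (P := fun u => diff θ i j u + diff θ' j i u ∈ filt k L 0)
      (fun w hw => ?_) (fun w hw a => ?_) (fun u v hu hv => ?_) hu
    · rw [diff_eq_zero θ i j hw, diff_eq_zero θ' j i hw, add_zero]
      exact zero_mem _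
    · have := key w a hw
      rwa [diff_eq_zero θ i j hw, diff_eq_zero θ' j i hw, add_zero, zero_mul, sub_zero] at this
    · rw [map_add, map_add, add_add_add_comm]
      exact add_mem hu hv
  | succ m ih =>
    refine filt_succ_induction (fun w hw => filt_mono (Nat.le_succ _) (ih hw))
      (fun w hw a => ?_) (fun u v hu hv => ?_) hu
    · exact (Submodule.sub_mem_iff_left _ (mul_ι_mem_filt a (ih hw))).1 (key w a hw)
    · rw [map_add, map_add, add_add_add_comm]
      exact add_mem hu hv

/-- Elements which transform under `L` as a basis of the representation `θ` satisfy
`u v_l = ∑ v_i (twist θ u)_{il}`. -/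
theorem mul_eq_sum_twist {B : Type*} [Ring B] [Algebra k B] (φ : 𝔘 →ₐ[k] B) (v : n → B)
    (hv : ∀ a l, φ (ι k a) * v l = v l * φ (ι k a) + ∑ i, θ a i l • v i) (u : 𝔘) (l : n) :
    φ u * v l = ∑ i, v i * φ (twist θ u i l) := by
  induction u using induct generalizing l with
  | hC r =>
    simp only [AlgHom.commutes, Matrix.algebraMap_matrix_apply, apply_ite φ, map_zero, mul_ite,
      mul_zero, Finset.sum_ite_eq', Finset.mem_univ, if_true, Algebra.commutes]
  | hι a =>
    rw [hv]
    simp only [twist_ι_apply, map_add, mul_add, Finset.sum_add_distrib, apply_ite φ, map_zero,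
      mul_ite, mul_zero, Finset.sum_ite_eq', Finset.mem_univ, if_true, AlgHom.commutes,
      Algebra.smul_def, Algebra.commutes]
  | hadd u v hu hv => simp [add_mul, hu, hv, mul_add, Finset.sum_add_distrib]
  | hmul u v hu hv =>
    rw [map_mul, mul_assoc, hv, Finset.mul_sum]
    simp only [← mul_assoc, hu, map_mul, Matrix.mul_apply, map_sum, Finset.mul_sum,
      Finset.sum_mul]
    exact Finset.sum_comm

theorem commutator_eq_sum_diff {B : Type*} [Ring B] [Algebra k B] (φ : 𝔘 →ₐ[k] B) (v : n → B)
    (hv : ∀ a l, φ (ι k a) * v l = v l * φ (ι k a) + ∑ i, θ a i l • v i) (u : 𝔘) (l : n) :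
    φ u * v l - v l * φ u = ∑ i, v i * φ (diff θ i l u) := by
  rw [mul_eq_sum_twist θ φ v hv]
  simp only [twist_apply, map_add, mul_add, Finset.sum_add_distrib, apply_ite φ, map_zero,
      mul_ite, mul_zero, Finset.sum_ite_eq', Finset.mem_univ, if_true, add_sub_cancel_right]

end Diff

end General

end UniversalEnvelopingAlgebra
end


/-! ### Calculus on U(gl_n): Euler's identity and the Poincaré lemma modulo lower order. -/

noncomputable section

namespace UniversalEnvelopingAlgebra

section Gl

variable (k : Type*) [Field k] (n : Type*) [Fintype n] [DecidableEq n]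

/-- The dual of the defining representation of `gl_n`. -/
def dualRep : Matrix n n k →ₗ⁅k⁆ Matrix n n k where
  toFun a := -a.transpose
  map_add' a b := by rw [Matrix.transpose_add, neg_add]
  map_smul' r a := by rw [Matrix.transpose_smul, smul_neg, RingHom.id_apply]
  map_lie' {a b} := by
    simp only [Ring.lie_def, Matrix.transpose_sub, Matrix.transpose_mul, neg_mul_neg, neg_sub]

theorem dualRep_apply (a : Matrix n n k) : dualRep k n a = -a.transpose := rfl

variable {n}

/-- The image of a matrix unit in `U(gl_n)`. -/
def unit (i j : n) : UniversalEnvelopingAlgebra k (Matrix n n k) :=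
  ι k (Matrix.single i j (1 : k))

/-- The difference operators of the defining representation of `gl_n`. -/
abbrev dV (i j : n) := diff (LieHom.id : Matrix n n k →ₗ⁅k⁆ Matrix n n k) i j

/-- The difference operators of the dual of the defining representation of `gl_n`. -/
abbrev dW (i j : n) := diff (dualRep k n) i j

variable {k}

local notation "𝔘" => UniversalEnvelopingAlgebra k (Matrix n n k)
local notation "𝔽" => filt k (Matrix n n k)

theorem ι_eq_sum_unit (a : Matrix n n k) : ι k a = ∑ i, ∑ j, a i j • unit k i j := by
  conv_lhs => rw [Matrix.matrix_eq_sum_single a]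
  simp only [map_sum, unit]
  refine Finset.sum_congr rfl fun i _ => Finset.sum_congr rfl fun j _ => ?_
  rw [← map_smul, Matrix.smul_single, smul_eq_mul, mul_one]

theorem unit_commutator (a b i j : n) : unit k a b * unit k i j - unit k i j * unit k a b =
    (if b = i then unit k a j else 0) - if j = a then unit k i b else 0 := by
  rw [unit, unit, ← Ring.lie_def, ← LieHom.map_lie, Ring.lie_def, map_sub]
  congr 1
  · split_ifs with h
    · subst h; rw [Matrix.single_mul_single_same, mul_one]; rfl
    · rw [Matrix.single_mul_single_of_ne _ _ _ _ h, map_zero]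
  · split_ifs with h
    · subst h; rw [Matrix.single_mul_single_same, mul_one]; rfl
    · rw [Matrix.single_mul_single_of_ne _ _ _ _ h, map_zero]

theorem dV_unit (i j a b : n) : dV k i j (unit k a b) = if a = i ∧ b = j then 1 else 0 := by
  rw [dV, unit, diff_ι, LieHom.id_apply, Matrix.single_apply, apply_ite (algebraMap k 𝔘), map_one,
    map_zero]

theorem dV_add_dW_mem {m : ℕ} {u : 𝔘} (hu : u ∈ 𝔽 (m + 2)) (i j : n) :
    dV k i j u + dW k j i u ∈ 𝔽 m :=
  diff_add_diff_mem_filt _ (fun a => dualRep_apply k n a) i j hu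

/-- The contraction `∑ E_{ij} F_{ij}`. -/
def contr : (n → n → 𝔘) →ₗ[k] 𝔘 where
  toFun F := ∑ i, ∑ j, unit k i j * F i j
  map_add' F G := by simp only [Pi.add_apply, mul_add, Finset.sum_add_distrib]
  map_smul' r F := by simp only [Pi.smul_apply, mul_smul_comm, Finset.smul_sum, RingHom.id_apply]

theorem contr_apply (F : n → n → 𝔘) : contr F = ∑ i, ∑ j, unit k i j * F i j := rfl

theorem contr_mem {m : ℕ} {F : n → n → 𝔘} (hF : ∀ i j, F i j ∈ 𝔽 m) : contr F ∈ 𝔽 (m + 1) :=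
  sum_mem fun i _ => sum_mem fun j _ => ι_mul_mem_filt _ (hF i j)

/-- Euler's identity for homogeneous polynomials, modulo lower order. With the shifted index, `𝔽 (m
+ 1)` is degree at most m, whence the eigenvalue m. Reordering letters costs only commutators, which
do not raise the degree. -/
theorem euler {m : ℕ} {u : 𝔘} (hu : u ∈ 𝔽 (m + 1)) :
    contr (fun i j => dV k i j u) - (m : k) • u ∈ 𝔽 m := by
  induction m generalizing u with
  | zero =>
    have h : (fun i j => dV k i j u) = (0 : n → n → 𝔘) := by
      ext i j
      exact diff_eq_zero _ i j hu
    rw [h, map_zero, Nat.cast_zero, zero_smul, sub_zero]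
    exact zero_mem _
  | succ m ih =>
    refine filt_succ_induction (P := fun u => contr (fun i j => dV k i j u) -
      ((m + 1 : ℕ) : k) • u ∈ 𝔽 (m + 1)) (fun w hw => ?_) (fun w hw a => ?_)
      (fun u v hu hv => ?_) hu
    · exact sub_mem (contr_mem fun i j => diff_mem_filt _ i j hw) (Submodule.smul_mem _ _ hw)
    · have e : contr (fun i j => dV k i j (w * ι k a)) - ((m + 1 : ℕ) : k) • (w * ι k a) =
          (contr (fun i j => dV k i j w) - (m : k) • w) * ι k a + (ι k a * w - w * ι k a) +
          contr (fun i j => ∑ l, a l j • dV k i l w) := by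
        have h1 : ∑ i, ∑ j, a i j • (unit k i j * w) = ι k a * w := by
          simp only [ι_eq_sum_unit a, Finset.sum_mul, smul_mul_assoc]
        simp only [dV, diff_mul_ι, LieHom.id_apply, contr_apply, mul_add, Finset.sum_add_distrib,
          sub_mul, Finset.sum_mul, mul_assoc, mul_smul_comm, smul_mul_assoc, Nat.cast_add,
          Nat.cast_one, add_smul, one_smul, h1]
        abel
      rw [e]
      refine add_mem (add_mem (mul_ι_mem_filt a (ih hw)) (ι_commutator_mem_filt a hw))
        (contr_mem fun i j => sum_mem fun l _ => Submodule.smul_mem _ _ (diff_mem_filt _ _ _ hw))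
    · have e : contr (fun i j => dV k i j (u + v)) - ((m + 1 : ℕ) : k) • (u + v) =
          (contr (fun i j => dV k i j u) - ((m + 1 : ℕ) : k) • u) +
          (contr (fun i j => dV k i j v) - ((m + 1 : ℕ) : k) • v) := by
        rw [smul_add, ← add_sub_add_comm, ← map_add]
        congr 2
        ext i j
        exact map_add _ _ _
      rw [e]
      exact add_mem hu hv

theorem euler_dW {m : ℕ} {u : 𝔘} (hu : u ∈ 𝔽 (m + 2)) :
    contr (fun i j => dW k j i u) + ((m + 1 : ℕ) : k) • u ∈ 𝔽 (m + 1) := by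
  have h := sub_mem (contr_mem fun i j => dV_add_dW_mem hu i j) (euler hu)
  convert h using 1
  have e : contr (fun i j => dV k i j u + dW k j i u) = contr (fun i j => dV k i j u) +
    contr (fun i j => dW k j i u) := map_add contr _ _
  rw [e]
  abel

/-- The product rule: differentiating the coefficient E_ij by -∂/∂E_la leaves -F_la, differentiating
F gives the contraction, and the mixed terms have lower degree. -/
theorem dW_contr {m : ℕ} {F : n → n → 𝔘} (hF : ∀ i j, F i j ∈ 𝔽 (m + 1)) (a l : n) :
    dW k a l (contr F) - (contr (fun i j => dW k a l (F i j)) - F l a) ∈ 𝔽 m := by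
  have e : dW k a l (contr F) - (contr (fun i j => dW k a l (F i j)) - F l a) =
      ∑ i, ∑ j, ∑ q, dualRep k n (Matrix.single i j 1) a q • dW k q l (F i j) := by
    have h1 : ∑ i, ∑ j, dualRep k n (Matrix.single i j (1 : k)) a l • F i j = - F l a := by
      rw [Finset.sum_eq_single l, Finset.sum_eq_single a]
      · simp [dualRep_apply]
      · intro j _ hj
        simp [dualRep_apply, hj]
      · simp
      · intro i _ hi
        refine Finset.sum_eq_zero fun j _ => ?_
        simp [dualRep_apply, hi]
      · simp
    simp only [contr_apply, map_sum, unit, dW, diff_ι_mul, Finset.sum_add_distrib, h1]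
    abel
  rw [e]
  exact sum_mem fun i _ => sum_mem fun j _ => sum_mem fun q _ =>
    Submodule.smul_mem _ _ (diff_mem_filt _ _ _ (hF i j))

variable {G G' : n → n → UniversalEnvelopingAlgebra k (Matrix n n k)}

section Cocycle

variable (hc : ∀ i j a l, dW k a l (G i j) = dV k i j (G' a l))

include hc

theorem cocycle_euler {m : ℕ} (hG' : ∀ i j, G' i j ∈ 𝔽 (m + 1)) (a l : n) :
    contr (fun i j => dW k a l (G i j)) - (m : k) • G' a l ∈ 𝔽 m := by
  have h := euler (hG' a l)
  simpa only [hc] using h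

/-- The compatibility relation turns dW_al G_ij into dV_ij G'_al, whose contraction is a multiple of
G'_al by Euler. For the transposed summand, dW_al may be replaced by -dV_la modulo lower order; the
relation then gives -dW_ji G_la, and Euler applies again. -/
theorem cocycle_euler_sum {m : ℕ} (hG : ∀ i j, G i j ∈ 𝔽 (m + 2))
    (hG' : ∀ i j, G' i j ∈ 𝔽 (m + 2)) (a l : n) :
    contr (fun i j => dW k a l (G i j + G' j i)) - ((m + 1 : ℕ) : k) • (G l a + G' a l) ∈
      𝔽 (m + 1) := by
  have h1 := cocycle_euler hc hG' a l
  have h2 := euler_dW (hG l a)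
  have h3 : contr (fun i j => dV k l a (G' j i) + dW k a l (G' j i)) ∈ 𝔽 (m + 1) :=
    contr_mem fun i j => dV_add_dW_mem (hG' j i) l a
  have h := sub_mem (add_mem h1 h3) h2
  convert h using 1
  have e1 : contr (fun i j => dW k a l (G i j + G' j i)) = contr (fun i j => dW k a l (G i j)) +
      contr (fun i j => dW k a l (G' j i)) := by
    rw [← map_add]
    congr 1
    ext i j
    exact map_add _ _ _
  have e2 : contr (fun i j => dV k l a (G' j i) + dW k a l (G' j i)) =
      contr (fun i j => dV k l a (G' j i)) + contr (fun i j => dW k a l (G' j i)) := map_add _ _ _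
  have e3 : (fun i j => dW k j i (G l a)) = fun i j => dV k l a (G' j i) := by
    ext i j
    exact hc l a j i
  rw [e1, e2, e3, smul_add]
  abel

variable [CharZero k]

/-- On top parts S = G + G'ᵀ satisfies ∂_p S_q = -∂_q S_p. Second derivatives are symmetric, so such
an S vanishes in degree at least two. Euler's identity makes this quantitative through the
contraction of S. -/
theorem cocycle_sum_mem_of_two_le {m : ℕ} (hG : ∀ i j, G i j ∈ 𝔽 (m + 3))
    (hG' : ∀ i j, G' i j ∈ 𝔽 (m + 3)) (i j : n) : G i j + G' j i ∈ 𝔽 (m + 2) := by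
  set S : n → n → 𝔘 := fun i j => G i j + G' j i with hS
  have hSm : ∀ i j, S i j ∈ 𝔽 (m + 3) := fun i j => add_mem (hG i j) (hG' j i)
  -- The factor m + 1 is the degree of S minus one. It is zero in degree one, which is why that case
  -- needs another argument.
  have h1 : ∀ a l, dW k a l (contr S) - ((m + 1 : ℕ) : k) • S l a ∈ 𝔽 (m + 2) := by
    intro a l
    have h := add_mem (dW_contr hSm a l) (cocycle_euler_sum hc hG hG' a l)
    convert h using 1
    rw [Nat.cast_succ (m + 1), hS]
    module
  -- Contracting `h1` and applying Euler's identity to `contr S` give it two eigenvalues of opposite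
  -- sign, m + 1 and -(m + 3), so its top part vanishes.
  have h2 : contr S ∈ 𝔽 (m + 3) := by
    have h := sub_mem (euler_dW (contr_mem hSm)) (contr_mem fun i j => h1 j i)
    have e : contr (fun i j => dW k j i (contr S) - ((m + 1 : ℕ) : k) • S i j) =
        contr (fun i j => dW k j i (contr S)) - ((m + 1 : ℕ) : k) • contr S := by
      rw [← map_smul, ← map_sub]
      rfl
    have e' : ∀ (p q : k) (X Y : 𝔘), X + p • Y - (X - q • Y) = (p + q) • Y := by
      intros; module
    rw [e, e', ← Nat.cast_add] at h
    exact (Submodule.smul_mem_iff _ (Nat.cast_ne_zero.2 (by omega))).1 h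
  have h3 := sub_mem (diff_mem_filt (dualRep k n) j i h2) (h1 j i)
  rw [sub_sub_cancel] at h3
  exact (Submodule.smul_mem_iff _ (Nat.cast_ne_zero.2 (Nat.succ_ne_zero _))).1 h3

-- The Poincaré lemma: once S has no top part, the relation says that G is closed, and the
-- contraction ∑ E_ij G_ij is a potential up to the factor degree plus one.
omit [CharZero k] in
theorem dW_contr_of_cocycle {m : ℕ} (hG : ∀ i j, G i j ∈ 𝔽 (m + 1))
    (hG' : ∀ i j, G' i j ∈ 𝔽 (m + 1)) (hS : ∀ i j, G i j + G' j i ∈ 𝔽 m) (a l : n) :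
    dW k a l (contr G) - ((m + 1 : ℕ) : k) • G' a l ∈ 𝔽 m := by
  have h := sub_mem (add_mem (dW_contr hG a l) (cocycle_euler hc hG' a l)) (hS l a)
  convert h using 1
  rw [Nat.cast_succ, add_smul, one_smul]
  abel

omit [CharZero k] in
theorem dV_contr_of_cocycle {m : ℕ} (hG : ∀ i j, G i j ∈ 𝔽 (m + 1))
    (hG' : ∀ i j, G' i j ∈ 𝔽 (m + 1)) (hS : ∀ i j, G i j + G' j i ∈ 𝔽 m) (a l : n) :
    dV k a l (contr G) - ((m + 1 : ℕ) : k) • G a l ∈ 𝔽 m := by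
  have h := sub_mem (sub_mem (dV_add_dW_mem (contr_mem hG) a l)
    (dW_contr_of_cocycle hc hG hG' hS l a)) (Submodule.smul_mem _ ((m + 1 : ℕ) : k) (hS a l))
  convert h using 1
  rw [smul_add]
  abel

end Cocycle

/-- The `gl_n`-equivariance of a matrix over `U(gl_n)`. -/
def Equivariant (G : n → n → UniversalEnvelopingAlgebra k (Matrix n n k)) : Prop :=
  ∀ a b i j, unit k a b * G i j - G i j * unit k a b =
    (if b = j then G i a else 0) - if i = a then G b j else 0

/-- `Equivariant` says that G_ij transforms like E_ji, so ∑ E_ij G_ij is a trace pairing and is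
invariant. -/
theorem Equivariant.commute_contr (hG : Equivariant G) (a b : n) :
    Commute (unit k a b) (contr G) := by
  have e : ∀ i j, unit k a b * (unit k i j * G i j) - unit k i j * G i j * unit k a b =
      (if b = i then unit k a j * G i j else 0) - (if j = a then unit k i b * G i j else 0) +
      ((if b = j then unit k i j * G i a else 0) - if i = a then unit k i j * G b j else 0) := by
    intro i j
    have h1 := congrArg (· * G i j) (unit_commutator (k := k) a b i j)
    have h2 := congrArg (unit k i j * ·) (hG a b i j)
    simp only [sub_mul, mul_sub, ite_mul, mul_ite, zero_mul, mul_zero] at h1 h2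
    rw [← h1, ← h2]
    noncomm_ring
  rw [commute_iff_eq, ← sub_eq_zero, contr_apply, Finset.mul_sum, Finset.sum_mul,
    ← Finset.sum_sub_distrib]
  simp only [Finset.mul_sum, Finset.sum_mul, ← Finset.sum_sub_distrib, e]
  simp only [Finset.sum_add_distrib, Finset.sum_sub_distrib, Finset.sum_ite_eq,
    Finset.sum_ite_eq', Finset.mem_univ, if_true]
  rw [Finset.sum_comm (f := fun i j => if b = i then unit k a j * G i j else 0),
    Finset.sum_comm (f := fun i j => if i = a then unit k i j * G b j else 0)]
  simp only [Finset.sum_ite_eq, Finset.sum_ite_eq', Finset.mem_univ, if_true]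
  abel

theorem commute_of_commute_unit {u : 𝔘} (h : ∀ a b, Commute (unit k a b) u) (v : 𝔘) :
    Commute v u := by
  induction v using induct with
  | hC r => exact Algebra.commutes r u
  | hι a =>
    rw [ι_eq_sum_unit]
    exact Commute.sum_left _ _ _ fun i _ => Commute.sum_left _ _ _ fun j _ =>
      Commute.smul_left (h i j) _
  | hadd u v hu hv => exact hu.add_left hv
  | hmul u v hu hv => exact hu.mul_left hv

end Gl

end UniversalEnvelopingAlgebra
end


/-! ### The descent step for gl_2. -/

noncomputable section

namespace UniversalEnvelopingAlgebra

section Gl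

instance (k L : Type*) [Field k] [LieRing L] [LieAlgebra k L] :
    Nontrivial (UniversalEnvelopingAlgebra k L) :=
  (lift k (0 : L →ₗ⁅k⁆ k)).toRingHom.domain_nontrivial

variable {k : Type*} [Field k]

section Scalar

variable {n : Type*} [Fintype n] [DecidableEq n]
  {G : n → n → UniversalEnvelopingAlgebra k (Matrix n n k)}

/-- Scalars commute with every matrix unit, so equivariance says that the matrix G commutes with all
matrices. -/
theorem Equivariant.eq_scalar (hG : Equivariant G) (hG1 : ∀ i j, G i j ∈ filt k (Matrix n n k) 1) :
    ∃ p : k, ∀ i j, G i j = if i = j then algebraMap k _ p else 0 := by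
  have h0 : ∀ a b i j, (if b = j then G i a else 0) - (if i = a then G b j else 0) = 0 := by
    intro a b i j
    rw [← hG]
    obtain ⟨r, hr⟩ := mem_filt_one.1 (hG1 i j)
    rw [← hr, Algebra.commutes, sub_self]
  rcases isEmpty_or_nonempty n with hn | ⟨⟨i₀⟩⟩
  · exact ⟨0, fun i => hn.elim i⟩
  · obtain ⟨p, hp⟩ := mem_filt_one.1 (hG1 i₀ i₀)
    refine ⟨p, fun i j => ?_⟩
    split_ifs with hij
    · subst hij
      have := h0 i₀ i i₀ i
      simp only [if_true] at this
      rw [hp, sub_eq_zero.1 this]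
    · simpa [hij] using h0 i i i j

end Scalar

local notation "𝔽" => filt k (Matrix (Fin 2) (Fin 2) k)

theorem dV_unit_commutator {u : UniversalEnvelopingAlgebra k (Matrix (Fin 2) (Fin 2) k)}
    (hu : u ∈ 𝔽 2) (a b i j : Fin 2) :
    dV k i j (unit k a b * u - u * unit k a b) =
      (if a = i then dV k b j u else 0) - if b = j then dV k i a u else 0 := by
  have h : unit k a b * dV k i j u = dV k i j u * unit k a b := by
    obtain ⟨r, hr⟩ := mem_filt_one.1 (diff_mem_filt LieHom.id i j hu)
    rw [dV, ← hr, Algebra.commutes]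
  rw [map_sub]
  simp only [dV, unit] at h ⊢
  rw [diff_ι_mul, diff_mul_ι, h]
  simp only [LieHom.id_apply, Matrix.single_apply, ite_and, ite_smul, one_smul, zero_smul]
  by_cases h1 : a = i <;> by_cases h2 : b = j <;> simp [h1, h2]

/-- As a gl_2-module, Λ²(k ⊕ sl_2) = sl_2 ⊕ Λ² sl_2 is two copies of sl_2, which has no invariants;
gl_2 is self-dual, so the same holds for antisymmetric forms. -/
theorem eq_zero_of_invariant_of_antisymm [CharZero k] {t : Fin 2 → Fin 2 → Fin 2 → Fin 2 → k}
    (hanti : ∀ i j a b, t i j a b = -t a b i j)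
    (hinv : ∀ a b i j c d, (if a = c then t i j b d else 0) - (if b = d then t i j c a else 0) =
      (if b = j then t i a c d else 0) - if i = a then t b j c d else 0) (i j a b : Fin 2) :
    t i j a b = 0 := by
  have two : ∀ r : k, r = -r → r = 0 := fun r hr => self_eq_neg.1 hr
  have h1 : ∀ a b, t a b a b = 0 := fun a b => two _ (hanti a b a b)
  -- These instances of invariance under E_01, E_10 and E_00 form a linear system which, together
  -- with antisymmetry, has only the zero solution.
  have e1 := hinv 0 1 0 1 0 0
  have e2 := hinv 0 1 0 1 1 1
  have e3 := hinv 0 1 0 1 0 1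
  have e4 := hinv 0 1 0 0 0 1
  have e5 := hinv 0 1 1 1 0 1
  have e6 := hinv 1 0 1 0 1 0
  have e7 := hinv 1 0 0 0 1 0
  have e8 := hinv 1 0 1 1 1 0
  have e9 := hinv 0 0 0 1 0 0
  have e10 := hinv 0 0 0 1 1 1
  have e11 := hinv 0 0 1 0 0 0
  have e12 := hinv 0 0 1 0 1 1
  simp [h1] at e1 e2 e3 e4 e5 e6 e7 e8 e9 e10 e11 e12
  have a1 := hanti 0 0 0 1
  have a2 := hanti 0 0 1 0
  have a3 := hanti 0 0 1 1
  have a4 := hanti 0 1 1 0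
  have a5 := hanti 0 1 1 1
  have a6 := hanti 1 0 1 1
  fin_cases i <;> fin_cases j <;> fin_cases a <;> fin_cases b <;> simp [h1] <;> grind

section Descent

variable [CharZero k]
  {G G' : Fin 2 → Fin 2 → UniversalEnvelopingAlgebra k (Matrix (Fin 2) (Fin 2) k)}
  (hc : ∀ i j a l, dW k a l (G i j) = dV k i j (G' a l))

include hc

/-- The degree-one case missing from `cocycle_sum_mem_of_two_le`. Here the gradient of S consists of
scalars, and the relation with equivariance makes it an invariant antisymmetric form on gl_2, hence
zero. -/
theorem cocycle_sum_mem_of_equivariant (hE : Equivariant G) (hE' : Equivariant fun i j => G' j i)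
    (hG : ∀ i j, G i j ∈ 𝔽 2) (hG' : ∀ i j, G' i j ∈ 𝔽 2) (i j : Fin 2) :
    G i j + G' j i ∈ 𝔽 1 := by
  set S : Fin 2 → Fin 2 → UniversalEnvelopingAlgebra k (Matrix (Fin 2) (Fin 2) k) :=
    fun i j => G i j + G' j i with hS
  have hSm : ∀ i j, S i j ∈ 𝔽 2 := fun i j => add_mem (hG i j) (hG' j i)
  have hSE : ∀ a b i j, unit k a b * S i j - S i j * unit k a b =
      (if b = j then S i a else 0) - if i = a then S b j else 0 := by
    intro a b i j
    have h := congrArg₂ (· + ·) (hE a b i j) (hE' a b i j)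
    simp only at h
    rw [hS, mul_add, add_mul, add_sub_add_comm, h]
    split_ifs <;> simp <;> abel
  have hneg : ∀ {u}, u ∈ 𝔽 2 → ∀ i j, dW k j i u = -dV k i j u := by
    intro u hu i j
    have := dV_add_dW_mem (m := 0) hu i j
    rw [filt_zero, Submodule.mem_bot] at this
    exact eq_neg_of_add_eq_zero_right this
  choose t ht using fun i j a b => mem_filt_one.1 (diff_mem_filt LieHom.id a b (hSm i j))
  have hinj := (algebraMap k (UniversalEnvelopingAlgebra k (Matrix (Fin 2) (Fin 2) k))).injective
  have ht0 : ∀ i j a b, t i j a b = 0 := by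
    refine eq_zero_of_invariant_of_antisymm (fun i j a b => hinj ?_) (fun a b i j c d => hinj ?_)
    · have h1 := hc i j b a
      have h2 := hc a b j i
      rw [hneg (hG _ _)] at h1 h2
      rw [map_neg, ht, ht, hS]
      simp only [map_add]
      simp only [dV] at h1 h2
      rw [← h1, ← h2]
      abel
    · have h := congrArg (dV k c d) (hSE a b i j)
      rw [dV_unit_commutator (hSm i j)] at h
      simp only [map_sub, apply_ite (algebraMap k _), apply_ite (dV k c d), map_zero] at h ⊢
      simp only [ht]
      exact h
  -- With zero gradient, Euler's identity in degree one leaves only -S, which therefore has degree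
  -- zero.
  have h := euler (m := 1) (hSm i j)
  have h0 : (fun a b => dV k a b (S i j)) = 0 := by
    ext a b
    rw [dV, ← ht, ht0, map_zero]
    rfl
  rw [h0, map_zero, zero_sub, Nat.cast_one, one_smul] at h
  exact neg_mem_iff.1 h

/-- One descent step: c is the contraction of G divided by degree plus one, invariant by
equivariance, with gradients agreeing with G and G' to top order. -/
theorem exists_central_diff_sub_mem {m : ℕ} (hE : Equivariant G)
    (hE' : Equivariant fun i j => G' j i) (hG : ∀ i j, G i j ∈ 𝔽 (m + 2))
    (hG' : ∀ i j, G' i j ∈ 𝔽 (m + 2)) :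
    ∃ c, (∀ a b, Commute (unit k a b) c) ∧ (∀ i j, G i j - dV k i j c ∈ 𝔽 (m + 1)) ∧
      ∀ i j, G' i j - dW k i j c ∈ 𝔽 (m + 1) := by
  have hS : ∀ i j, G i j + G' j i ∈ 𝔽 (m + 1) := by
    cases m with
    | zero => exact cocycle_sum_mem_of_equivariant hc hE hE' hG hG'
    | succ m => exact cocycle_sum_mem_of_two_le hc hG hG'
  have hm : ((m + 1 + 1 : ℕ) : k) ≠ 0 := Nat.cast_ne_zero.2 (Nat.succ_ne_zero _)
  have hsub : ∀ X Y, X - ((m + 1 + 1 : ℕ) : k) • Y ∈ 𝔽 (m + 1) →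
      Y - ((m + 1 + 1 : ℕ) : k)⁻¹ • X ∈ 𝔽 (m + 1) := by
    intro X Y h
    rw [← neg_mem_iff, neg_sub]
    have := Submodule.smul_mem _ ((m + 1 + 1 : ℕ) : k)⁻¹ h
    rwa [smul_sub, inv_smul_smul₀ hm] at this
  refine ⟨((m + 1 + 1 : ℕ) : k)⁻¹ • contr G, fun a b => (hE.commute_contr a b).smul_right _,
    fun i j => ?_, fun i j => ?_⟩
  · rw [map_smul]
    exact hsub _ _ (dV_contr_of_cocycle hc hG hG' hS i j)
  · rw [map_smul]
    exact hsub _ _ (dW_contr_of_cocycle hc hG hG' hS i j)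

end Descent

end Gl

end UniversalEnvelopingAlgebra
end


/-! ### The decomposition U(L ⋉ M) = S(M) ⊗ U(L). -/

noncomputable section

namespace SemidirectPBW

open InfCherednik TensorProduct
open UniversalEnvelopingAlgebra (ι lift)

variable {k L M σ : Type*} [CommRing k] [LieRing L] [LieAlgebra k L]
  [AddCommGroup M] [Module k M] [LieRingModule L M] [LieModule k L M]

local notation "𝔘" => UniversalEnvelopingAlgebra k L
local notation "𝔘V" => UniversalEnvelopingAlgebra k (Semidirect k L M)
local notation "𝔖" => MvPolynomial σ k

/-! ### Commutation relations in `U(L ⋉ M)` -/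

theorem uLie_mul_uVec (a : L) (m : M) :
    uLie k a * uVec k m = uVec k m * uLie k a + uVec k ⁅a, m⁆ := by
  rw [uLie, uVec, UniversalEnvelopingAlgebra.ι_mul_ι, uVec, LieAlgebra.SemiDirectSum.lie_eq_mk]
  congr 2
  refine LieAlgebra.SemiDirectSum.ext ?_ (lie_zero a)
  · change ⁅(0 : AbelianLie M), _⁆ + abDer k L M a _ - abDer k L M 0 _ = _
    rw [map_zero, zero_lie, zero_add]
    exact sub_zero _

theorem uVec_mul_uVec (m m' : M) :
    (uVec k m * uVec k m' : 𝔘V) = uVec k m' * uVec k m := by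
  rw [uVec, uVec, UniversalEnvelopingAlgebra.ι_mul_ι, LieAlgebra.SemiDirectSum.lie_eq_mk]
  refine add_eq_left.2 ?_
  rw [← map_zero (ι k)]
  congr 1
  refine LieAlgebra.SemiDirectSum.ext ?_ (zero_lie (0 : L))
  change (0 : AbelianLie M) + abDer k L M 0 _ - abDer k L M 0 _ = 0
  rw [map_zero, zero_add]
  exact sub_self _

variable (k L M) in
/-- The linear map `M → U(L ⋉ M)`. -/
def vecLin : M →ₗ[k] 𝔘V where
  toFun := uVec k
  map_add' m m' := by
    rw [uVec, uVec, uVec, ← map_add]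
    congr 1
    refine LieAlgebra.SemiDirectSum.ext ?_ (add_zero (0 : L)).symm
    exact map_add (AbelianLie.val k).symm m m'
  map_smul' r m := by
    rw [RingHom.id_apply, uVec, uVec, ← map_smul]
    congr 1
    refine LieAlgebra.SemiDirectSum.ext ?_ (smul_zero r).symm
    exact map_smul (AbelianLie.val k).symm r m

theorem vecLin_apply (m : M) : vecLin k L M m = uVec k m := rfl

variable (k L M) in
/-- The homomorphism `U(L) → U(L ⋉ M)`. -/
def ofU : 𝔘 →ₐ[k] 𝔘V :=
  lift k ((ι k).comp (LieAlgebra.SemiDirectSum.inr (abDer k L M)))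

theorem ofU_ι (a : L) : ofU k L M (ι k a) = uLie k a :=
  UniversalEnvelopingAlgebra.lift_ι_apply k _ a

theorem ι_eq_add (p : Semidirect k L M) :
    ι k p = uVec k (AbelianLie.val k p.left) + uLie k p.right := by
  rw [uVec, uLie, ← map_add]
  congr 1
  exact LieAlgebra.SemiDirectSum.ext (add_zero p.left).symm (zero_add p.right).symm

theorem induct {P : 𝔘V → Prop} (hC : ∀ r : k, P (algebraMap k 𝔘V r))
    (hL : ∀ a : L, P (uLie k a)) (hM : ∀ m : M, P (uVec k m))
    (hadd : ∀ u v, P u → P v → P (u + v)) (hmul : ∀ u v, P u → P v → P (u * v)) (u : 𝔘V) :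
    P u :=
  UniversalEnvelopingAlgebra.induct hC
    (fun p => by rw [ι_eq_add]; exact hadd _ _ (hM _) (hL _)) hadd hmul u

/-! ### The polynomial subalgebra -/

variable (B : Module.Basis σ k M)

/-- The embedding of `M` in the polynomial algebra on a basis. -/
def linPoly : M →ₗ[k] 𝔖 := B.constr k MvPolynomial.X

theorem linPoly_basis (i : σ) : linPoly B (B i) = MvPolynomial.X i := B.constr_basis _ _ _

/-- The action of `L` on the polynomial algebra by derivations. -/
def der (a : L) : Derivation k 𝔖 𝔖 := MvPolynomial.mkDerivation k fun i => linPoly B ⁅a, B i⁆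

omit [LieAlgebra k L] [LieModule k L M] in
theorem der_X (a : L) (i : σ) : der B a (MvPolynomial.X i) = linPoly B ⁅a, B i⁆ :=
  MvPolynomial.mkDerivation_X _ _ _

theorem der_linPoly (a : L) (m : M) : der B a (linPoly B m) = linPoly B ⁅a, m⁆ := by
  have h : (der B a).toLinearMap ∘ₗ linPoly B = linPoly B ∘ₗ LieModule.toEnd k L M a := by
    refine B.ext fun i => ?_
    rw [LinearMap.comp_apply, linPoly_basis]
    exact der_X B a i
  exact LinearMap.congr_fun h m

omit [LieAlgebra k L] [LieModule k L M] in
theorem der_add (a a' : L) : der B (a + a') = der B a + der B a' := by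
  refine MvPolynomial.derivation_ext fun i => ?_
  rw [Derivation.add_apply, der_X, der_X, der_X, add_lie, map_add]

theorem der_smul (r : k) (a : L) : der B (r • a) = r • der B a := by
  refine MvPolynomial.derivation_ext fun i => ?_
  rw [Derivation.smul_apply, der_X, der_X, smul_lie, map_smul]

theorem der_lie (a a' : L) (s : 𝔖) : der B ⁅a, a'⁆ s = der B a (der B a' s) - der B a' (der B a s) := by
  have h : der B ⁅a, a'⁆ = ⁅der B a, der B a'⁆ := by
    refine MvPolynomial.derivation_ext fun i => ?_
    rw [Derivation.commutator_apply, der_X, der_X, der_X, der_linPoly, der_linPoly, lie_lie,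
      map_sub]
  rw [h, Derivation.commutator_apply]

variable (k L M) in
/-- The commutative subalgebra of `U(L ⋉ M)` generated by `M`. -/
def vecAlg : Subalgebra k 𝔘V := Algebra.adjoin k (Set.range (uVec k : M → 𝔘V))

instance : IsMulCommutative (vecAlg k L M) :=
  Algebra.isMulCommutative_adjoin k (by
    rintro _ ⟨m, rfl⟩ _ ⟨m', rfl⟩
    exact uVec_mul_uVec m m')

open scoped IsMulCommutative in
/-- The homomorphism from the polynomial algebra on a basis of `M` to `U(L ⋉ M)`. -/
def ofPoly : 𝔖 →ₐ[k] 𝔘V :=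
  (vecAlg k L M).val.comp (MvPolynomial.aeval fun i => ⟨uVec k (B i), Algebra.subset_adjoin ⟨_, rfl⟩⟩)

open scoped IsMulCommutative in
theorem ofPoly_X (i : σ) : (ofPoly B (MvPolynomial.X i) : 𝔘V) = uVec k (B i) := by
  unfold ofPoly
  simp

theorem ofPoly_linPoly (m : M) : (ofPoly B (linPoly B m) : 𝔘V) = uVec k m := by
  have h : (ofPoly B : 𝔖 →ₐ[k] 𝔘V).toLinearMap ∘ₗ linPoly B = vecLin k L M := by
    refine B.ext fun i => ?_
    rw [LinearMap.comp_apply, linPoly_basis]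
    exact ofPoly_X B i
  exact LinearMap.congr_fun h m

theorem uLie_mul_ofPoly (a : L) (s : 𝔖) :
    (uLie k a * ofPoly B s : 𝔘V) = ofPoly B s * uLie k a + ofPoly B (der B a s) := by
  induction s using MvPolynomial.induction_on with
  | C r =>
    rw [MvPolynomial.derivation_C, map_zero, add_zero, ← MvPolynomial.algebraMap_eq, AlgHom.commutes]
    exact (Algebra.commutes _ _).symm
  | add p q hp hq =>
    simp only [map_add, mul_add, add_mul, hp, hq]
    abel
  | mul_X p i hp =>
    rw [map_mul, ← mul_assoc, hp, add_mul, mul_assoc, ofPoly_X, uLie_mul_uVec, Derivation.leibniz,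
      der_X, map_add, smul_eq_mul, smul_eq_mul, map_mul, map_mul, ofPoly_linPoly, ofPoly_X, mul_add]
    have h := (Commute.all (MvPolynomial.X i) (der B a p)).map (ofPoly B : 𝔖 →ₐ[k] 𝔘V)
    rw [commute_iff_eq, ofPoly_X] at h
    rw [h]
    simp only [mul_assoc, add_assoc]

/-! ### The decomposition `U(L ⋉ M) = S(M) ⊗ U(L)` -/

/-- The action of `L ⋉ M` on `S(M) ⊗ U(L)`. -/
def action : Semidirect k L M →ₗ⁅k⁆ Module.End k (𝔖 ⊗[k] 𝔘) where
  toFun p := LinearMap.rTensor 𝔘 (LinearMap.mulLeft k (linPoly B (AbelianLie.val k p.left)) +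
    (der B p.right).toLinearMap) + LinearMap.lTensor 𝔖 (LinearMap.mulLeft k (ι k p.right))
  map_add' p q := by
    refine TensorProduct.ext' fun s u => ?_
    simp [der_add, add_tmul, tmul_add, add_mul]
    abel
  map_smul' r p := by
    refine TensorProduct.ext' fun s u => ?_
    simp [der_smul, smul_tmul', tmul_smul]
  map_lie' {p q} := by
    obtain ⟨v, a⟩ := p
    obtain ⟨w, b⟩ := q
    have e5 : AbelianLie.val k (⁅v, w⁆ + abDer k L M a w - abDer k L M b v) =
        ⁅a, AbelianLie.val k w⁆ - ⁅b, AbelianLie.val k v⁆ := by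
      rw [map_sub, map_add]
      exact congrArg (· - _) (zero_add _)
    refine TensorProduct.ext' fun s u => ?_
    rw [LieAlgebra.SemiDirectSum.lie_eq_mk, Ring.lie_def]
    simp only [e5]
    simp only [LinearMap.add_apply, LinearMap.sub_apply, Module.End.mul_apply,
      LinearMap.rTensor_tmul, LinearMap.lTensor_tmul, LinearMap.mulLeft_apply, map_add, map_sub,
      Derivation.coeFn_coe, der_lie, LieHom.map_lie, Ring.lie_def,
      Derivation.leibniz, der_linPoly, smul_eq_mul, sub_mul, add_tmul, sub_tmul, tmul_sub, mul_add,
      mul_assoc]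
    rw [mul_left_comm (linPoly B (AbelianLie.val k v)),
      mul_comm s (linPoly B ⁅a, _⁆), mul_comm s (linPoly B ⁅b, _⁆)]
    abel

/-- The multiplication map `S(M) ⊗ U(L) → U(L ⋉ M)`. -/
def mulMap : 𝔖 ⊗[k] 𝔘 →ₗ[k] 𝔘V :=
  TensorProduct.lift ((LinearMap.mul k 𝔘V).compl₁₂ (ofPoly B).toLinearMap (ofU k L M).toLinearMap)

theorem mulMap_tmul (s : 𝔖) (u : 𝔘) : (mulMap B (s ⊗ₜ u) : 𝔘V) = ofPoly B s * ofU k L M u := rfl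

theorem ofPoly_mul_mulMap (s : 𝔖) (n : 𝔖 ⊗[k] 𝔘) :
    (ofPoly B s * mulMap B n : 𝔘V) = mulMap B (s • n) := by
  induction n with
  | zero => simp
  | tmul t u => rw [smul_tmul', mulMap_tmul, mulMap_tmul, smul_eq_mul, map_mul, mul_assoc]
  | add x y hx hy => rw [map_add, mul_add, smul_add, map_add, hx, hy]

theorem uVec_mul_mulMap (m : M) (n : 𝔖 ⊗[k] 𝔘) :
    (uVec k m * mulMap B n : 𝔘V) = mulMap B (linPoly B m • n) := by
  rw [← ofPoly_linPoly B, ofPoly_mul_mulMap]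

theorem uLie_mul_mulMap (a : L) (n : 𝔖 ⊗[k] 𝔘) :
    (uLie k a * mulMap B n : 𝔘V) = mulMap B ((der B a).toLinearMap.rTensor 𝔘 n +
      (LinearMap.mulLeft k (ι k a)).baseChange 𝔖 n) := by
  induction n with
  | zero => simp
  | tmul t u =>
    rw [LinearMap.rTensor_tmul, LinearMap.baseChange_tmul, map_add, mulMap_tmul, mulMap_tmul,
      mulMap_tmul, LinearMap.mulLeft_apply, map_mul, ofU_ι, ← mul_assoc, uLie_mul_ofPoly, add_mul,
      mul_assoc, add_comm]
    rfl
  | add x y hx hy =>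
    rw [map_add, mul_add, hx, hy, ← map_add]
    congr 1
    rw [map_add, map_add]
    abel

theorem mulMap_mul_ofU (n : 𝔖 ⊗[k] 𝔘) (u : 𝔘) :
    (mulMap B n * ofU k L M u : 𝔘V) = mulMap B ((LinearMap.mulRight k u).baseChange 𝔖 n) := by
  induction n with
  | zero => simp
  | tmul t u => rw [LinearMap.baseChange_tmul, mulMap_tmul, mulMap_tmul, LinearMap.mulRight_apply,
      map_mul, mul_assoc]
  | add x y hx hy => rw [map_add, add_mul, hx, hy, map_add, map_add]

theorem mulMap_surjective : Function.Surjective (mulMap B : 𝔖 ⊗[k] 𝔘 →ₗ[k] 𝔘V) := by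
  -- The image is stable under left multiplication and contains 1.
  have h : ∀ (a : 𝔘V) (n : 𝔖 ⊗[k] 𝔘), ∃ n', mulMap B n' = a * mulMap B n := by
    intro a
    induction a using induct with
    | hC r => exact fun n => ⟨r • n, by rw [map_smul, Algebra.smul_def]⟩
    | hL a => exact fun n => ⟨_, (uLie_mul_mulMap B a n).symm⟩
    | hM m => exact fun n => ⟨_, (uVec_mul_mulMap B m n).symm⟩
    | hadd u v hu hv =>
      intro n
      obtain ⟨n₁, h₁⟩ := hu n
      obtain ⟨n₂, h₂⟩ := hv n
      exact ⟨n₁ + n₂, by rw [map_add, h₁, h₂, add_mul]⟩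
    | hmul u v hu hv =>
      intro n
      obtain ⟨n₁, h₁⟩ := hv n
      obtain ⟨n₂, h₂⟩ := hu n₁
      exact ⟨n₂, by rw [h₂, h₁, mul_assoc]⟩
  intro a
  obtain ⟨n, hn⟩ := h a (1 ⊗ₜ 1)
  exact ⟨n, by rw [hn, mulMap_tmul, map_one, map_one, mul_one, mul_one]⟩

/-- L ⋉ M acts on S(M) ⊗ U(L), with M multiplying and L acting by derivation plus left
multiplication. Applying the image of n to 1 ⊗ 1 returns n, which gives a left inverse. -/
theorem mulMap_injective : Function.Injective (mulMap B : 𝔖 ⊗[k] 𝔘 →ₗ[k] 𝔘V) := by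
  have hL : ∀ a : L, lift k (action B) (uLie k a) = (der B a).toLinearMap.rTensor 𝔘 +
      LinearMap.lTensor 𝔖 (LinearMap.mulLeft k (ι k a)) := by
    intro a
    rw [uLie, UniversalEnvelopingAlgebra.lift_ι_apply]
    refine TensorProduct.ext' fun s u => ?_
    change ((linPoly B (AbelianLie.val k 0)) * s + der B a s) ⊗ₜ u + _ = der B a s ⊗ₜ u + _
    rw [map_zero, map_zero, zero_mul, zero_add]
  have hM : ∀ m : M, lift k (action B) (uVec k m : 𝔘V) =
      LinearMap.rTensor 𝔘 (LinearMap.mulLeft k (linPoly B m)) := by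
    intro m
    rw [uVec, UniversalEnvelopingAlgebra.lift_ι_apply]
    refine TensorProduct.ext' fun s u => ?_
    change (linPoly B m * s + der B (0 : L) s) ⊗ₜ u + s ⊗ₜ (ι k (0 : L) * u) = (linPoly B m * s) ⊗ₜ u
    have h0 : der B (0 : L) = 0 := by simpa using der_smul B (0 : k) (0 : L)
    rw [h0, map_zero, zero_mul, tmul_zero, add_zero, Derivation.zero_apply, add_zero]
  have hU : ∀ u u' : 𝔘, lift k (action B) (ofU k L M u) (1 ⊗ₜ u') = 1 ⊗ₜ (u * u') := by
    intro u
    induction u using UniversalEnvelopingAlgebra.induct with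
    | hC r => intro u'; simp [← Algebra.smul_def]
    | hι a => intro u'; rw [ofU_ι, hL]; simp
    | hadd u v hu hv => intro u'; rw [map_add, map_add, LinearMap.add_apply, hu, hv, add_mul, tmul_add]
    | hmul u v hu hv =>
      intro u'
      rw [map_mul, map_mul, Module.End.mul_apply, hv, hu, mul_assoc]
  have hS : ∀ (s t : 𝔖) (u : 𝔘), lift k (action B) (ofPoly B s) (t ⊗ₜ u) = (s * t) ⊗ₜ u := by
    intro s
    induction s using MvPolynomial.induction_on with
    | C r =>
      intro t u
      rw [← MvPolynomial.algebraMap_eq, AlgHom.commutes, AlgHom.commutes,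
        Module.algebraMap_end_apply, ← Algebra.smul_def, smul_tmul']
    | add p q hp hq => intro t u; rw [map_add, map_add, LinearMap.add_apply, hp, hq, add_mul, add_tmul]
    | mul_X p i hp =>
      intro t u
      rw [map_mul, map_mul, Module.End.mul_apply, ofPoly_X, hM, LinearMap.rTensor_tmul, hp,
        linPoly_basis, LinearMap.mulLeft_apply, mul_assoc]
  have h : ∀ n : 𝔖 ⊗[k] 𝔘, lift k (action B) (mulMap B n) (1 ⊗ₜ 1) = n := by
    intro n
    induction n with
    | zero => simp
    | tmul s u => rw [mulMap_tmul, map_mul, Module.End.mul_apply, hU, hS, mul_one, mul_one]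
    | add x y hx hy => rw [map_add, map_add, LinearMap.add_apply, hx, hy]
  exact fun n n' hn => by rw [← h n, ← h n', hn]

/-- The factor in S(M) commutes with v_l, so only the factor in U(L) contributes, through its
difference operators. -/
theorem mulMap_mul_uVec {n : Type*} [Fintype n] [DecidableEq n] (θ : L →ₗ⁅k⁆ Matrix n n k)
    (v : n → M) (hv : ∀ a l, ⁅a, v l⁆ = ∑ i, θ a i l • v i) (z : 𝔖 ⊗[k] 𝔘) (l : n) :
    (mulMap B z * uVec k (v l) - uVec k (v l) * mulMap B z : 𝔘V) =
      mulMap B (∑ i, linPoly B (v i) • (UniversalEnvelopingAlgebra.diff θ i l).baseChange 𝔖 z) := by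
  have h : ∀ a l, ofU k L M (ι k a) * vecLin k L M (v l) =
      vecLin k L M (v l) * ofU k L M (ι k a) + ∑ i, θ a i l • vecLin k L M (v i) := by
    intro a l
    have e : uVec k ⁅a, v l⁆ = ∑ i, θ a i l • vecLin k L M (v i) := by
      rw [hv, ← vecLin_apply, map_sum]
      simp only [map_smul]
    rw [ofU_ι, vecLin_apply, uLie_mul_uVec, e]
  induction z with
  | zero => simp
  | tmul s u =>
    have e := UniversalEnvelopingAlgebra.commutator_eq_sum_diff θ (ofU k L M)
      (fun i => vecLin k L M (v i)) h u l
    have hc : (uVec k (v l) * ofPoly B s : 𝔘V) = ofPoly B s * uVec k (v l) := by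
      rw [← ofPoly_linPoly B, ← map_mul, mul_comm, map_mul]
    rw [mulMap_tmul, ← mul_assoc, hc, mul_assoc, mul_assoc, ← mul_sub, ← vecLin_apply, e, map_sum,
      Finset.mul_sum]
    refine Finset.sum_congr rfl fun i _ => ?_
    rw [← uVec_mul_mulMap, LinearMap.baseChange_tmul, mulMap_tmul, ← mul_assoc, ← mul_assoc,
      vecLin_apply, ← ofPoly_linPoly B (v i), ← map_mul, ← map_mul, mul_comm s]
  | add x y hx hy =>
    simp only [map_add, mul_add, add_mul, smul_add, Finset.sum_add_distrib, ← hx, ← hy]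
    abel

end SemidirectPBW
end


/-! ### Commutators with the two invariants, and base change of the standard filtration. -/

noncomputable section

/-! ### The elements `b` and `d` in an arbitrary ring -/

namespace Gl2Relations

variable {R : Type*} [Ring R]

/-- Elements of a ring satisfying the relations between matrix units and a pair of dual
representations of `gl_2`. -/
structure Rel (E : Fin 2 → Fin 2 → R) (v w : Fin 2 → R) : Prop where
  lie : ∀ a b i j, E a b * E i j - E i j * E a b =
    (if b = i then E a j else 0) - if j = a then E i b else 0
  act_v : ∀ i j l, E i j * v l - v l * E i j = if j = l then v i else 0
  act_w : ∀ i j l, E i j * w l - w l * E i j = -if i = l then w j else 0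
  comm_v : ∀ i j, v i * v j = v j * v i
  comm_w : ∀ i j, w i * w j = w j * w i

/-- The quadratic invariant. -/
def quad (v w : Fin 2 → R) : R := w 0 * v 0 + w 1 * v 1

/-- The cubic invariant. -/
def cubic (E : Fin 2 → Fin 2 → R) (v w : Fin 2 → R) : R :=
  E 0 0 * (w 1 * v 1) - E 0 1 * (w 0 * v 1) - E 1 0 * (w 1 * v 0) + E 1 1 * (w 0 * v 0)

theorem commutator_mul (e a b : R) :
    e * (a * b) - a * b * e = (e * a - a * e) * b + a * (e * b - b * e) := by noncomm_ring

theorem mul_commutator (e a b : R) :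
    a * b * e - e * (a * b) = (a * e - e * a) * b + a * (b * e - e * b) := by noncomm_ring

namespace Rel

variable {E : Fin 2 → Fin 2 → R} {v w : Fin 2 → R} (H : Rel E v w)

include H

theorem commute_quad (a b : Fin 2) : Commute (E a b) (quad v w) := by
  rw [commute_iff_eq, ← sub_eq_zero]
  have e : E a b * quad v w - quad v w * E a b = (E a b * (w 0 * v 0) - w 0 * v 0 * E a b) +
      (E a b * (w 1 * v 1) - w 1 * v 1 * E a b) := by
    rw [quad]; noncomm_ring
  rw [e]
  simp only [commutator_mul, H.act_v, H.act_w]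
  fin_cases a <;> fin_cases b <;> simp

theorem commute_cubic (a b : Fin 2) : Commute (E a b) (cubic E v w) := by
  rw [commute_iff_eq, ← sub_eq_zero]
  have e : E a b * cubic E v w - cubic E v w * E a b =
      (E a b * (E 0 0 * (w 1 * v 1)) - E 0 0 * (w 1 * v 1) * E a b) -
      (E a b * (E 0 1 * (w 0 * v 1)) - E 0 1 * (w 0 * v 1) * E a b) -
      (E a b * (E 1 0 * (w 1 * v 0)) - E 1 0 * (w 1 * v 0) * E a b) +
      (E a b * (E 1 1 * (w 0 * v 0)) - E 1 1 * (w 0 * v 0) * E a b) := by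
    rw [cubic]; noncomm_ring
  rw [e]
  simp only [commutator_mul, H.act_v, H.act_w, H.lie]
  fin_cases a <;> fin_cases b <;> simp <;> noncomm_ring

theorem quad_mul_v (l : Fin 2) : quad v w * v l - v l * quad v w =
    ∑ i, (w i * v l - v l * w i) * v i := by
  have e : quad v w * v l - v l * quad v w = (w 0 * v 0 * v l - v l * (w 0 * v 0)) +
      (w 1 * v 1 * v l - v l * (w 1 * v 1)) := by
    rw [quad]; noncomm_ring
  rw [e]
  simp only [mul_commutator, H.comm_v _ l, sub_self, mul_zero, add_zero, Fin.sum_univ_two]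

theorem quad_mul_w (l : Fin 2) : quad v w * w l - w l * quad v w =
    ∑ i, w i * (v i * w l - w l * v i) := by
  have e : quad v w * w l - w l * quad v w = (w 0 * v 0 * w l - w l * (w 0 * v 0)) +
      (w 1 * v 1 * w l - w l * (w 1 * v 1)) := by
    rw [quad]; noncomm_ring
  rw [e]
  simp only [mul_commutator, H.comm_w _ l, sub_self, zero_mul, zero_add, Fin.sum_univ_two]

/-- Besides the terms E [w, v_l] v, the brackets [E, v_l] produce cubic products v w v. These cancel
after reordering and leave the conditional terms in g. -/
theorem cubic_mul_v {g : Fin 2 → Fin 2 → R} (hg : ∀ i j, w i * v j - v j * w i = g i j)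
    (l : Fin 2) : cubic E v w * v l - v l * cubic E v w =
      (E 1 1 * g 0 l - E 1 0 * g 1 l + if l = 0 then g 1 1 else -g 0 1) * v 0 +
      (E 0 0 * g 1 l - E 0 1 * g 0 l + if l = 0 then -g 1 0 else g 0 0) * v 1 := by
  have e : cubic E v w * v l - v l * cubic E v w =
      (E 0 0 * (w 1 * v 1) * v l - v l * (E 0 0 * (w 1 * v 1))) -
      (E 0 1 * (w 0 * v 1) * v l - v l * (E 0 1 * (w 0 * v 1))) -
      (E 1 0 * (w 1 * v 0) * v l - v l * (E 1 0 * (w 1 * v 0))) +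
      (E 1 1 * (w 0 * v 0) * v l - v l * (E 1 1 * (w 0 * v 0))) := by
    rw [cubic]; noncomm_ring
  rw [e]
  simp only [mul_commutator, H.comm_v _ l, sub_self, mul_zero, add_zero, H.act_v, hg]
  have h01 : v 1 * v 0 = v 0 * v 1 := H.comm_v 1 0
  have hw : ∀ i j, v j * w i = w i * v j - g i j := fun i j => by rw [← hg, sub_sub_cancel]
  fin_cases l <;> simp <;> simp only [← mul_assoc, hw, sub_mul] <;>
    simp only [mul_assoc, h01, add_mul, sub_mul, neg_mul] <;> abel

/-- Here the brackets [E, w_l] give products w w v, which cancel without correction because the w_i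
commute. -/
theorem cubic_mul_w {g : Fin 2 → Fin 2 → R} (hg : ∀ i j, w i * v j - v j * w i = g i j)
    (l : Fin 2) : cubic E v w * w l - w l * cubic E v w =
      E 1 0 * (w 1 * g l 0) - E 0 0 * (w 1 * g l 1) +
      (E 0 1 * (w 0 * g l 1) - E 1 1 * (w 0 * g l 0)) := by
  have e : cubic E v w * w l - w l * cubic E v w =
      (E 0 0 * (w 1 * v 1) * w l - w l * (E 0 0 * (w 1 * v 1))) -
      (E 0 1 * (w 0 * v 1) * w l - w l * (E 0 1 * (w 0 * v 1))) -
      (E 1 0 * (w 1 * v 0) * w l - w l * (E 1 0 * (w 1 * v 0))) +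
      (E 1 1 * (w 0 * v 0) * w l - w l * (E 1 1 * (w 0 * v 0))) := by
    rw [cubic]; noncomm_ring
  have hg' : ∀ i j, v j * w i - w i * v j = -g i j := fun i j => by rw [← hg, neg_sub]
  rw [e]
  simp only [mul_commutator, H.comm_w _ l, sub_self, zero_mul, zero_add, H.act_w, hg']
  have h01 : w 1 * w 0 = w 0 * w 1 := H.comm_w 1 0
  fin_cases l <;> simp <;> simp only [← mul_assoc, h01] <;> noncomm_ring

end Rel

end Gl2Relations

/-! ### Extension of scalars and the standard filtration -/

namespace UniversalEnvelopingAlgebra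

open TensorProduct

section Commute

variable {k L : Type*} [CommRing k] [LieRing L] [LieAlgebra k L]
  {m n : Type*} [Fintype m] [DecidableEq m] [Fintype n] [DecidableEq n]
  (θ : L →ₗ⁅k⁆ Matrix m m k) (θ' : L →ₗ⁅k⁆ Matrix n n k)

/-- Each twist is the coproduct followed by a representation on one factor, and the coproduct is
cocommutative; the identity is checked on generators. -/
theorem twist_twist_comm (i j : m) (a b : n) (u : UniversalEnvelopingAlgebra k L) :
    twist θ (twist θ' u a b) i j = twist θ' (twist θ u i j) a b := by
  induction u using induct generalizing i j a b with
  | hC r =>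
    simp only [AlgHom.commutes, Matrix.algebraMap_matrix_apply]
    split_ifs <;> simp [Matrix.algebraMap_matrix_apply, *]
  | hι c =>
    simp only [twist_ι_apply, map_add, AlgHom.commutes, Matrix.add_apply,
      Matrix.algebraMap_matrix_apply]
    split_ifs with h1 h2 h2 <;> simp only [twist_ι_apply, h1, h2, if_true, if_false, map_zero,
      Matrix.zero_apply] <;> abel
  | hadd u v hu hv => simp only [map_add, Matrix.add_apply, hu, hv]
  | hmul u v hu hv =>
    simp only [map_mul, Matrix.mul_apply, map_sum, Matrix.sum_apply, hu, hv]
    exact Finset.sum_comm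

theorem diff_diff_comm (i j : m) (a b : n) (u : UniversalEnvelopingAlgebra k L) :
    diff θ i j (diff θ' a b u) = diff θ' a b (diff θ i j u) := by
  rw [diff_apply θ' a b u, diff_apply θ i j u, map_sub, map_sub, diff_apply θ i j (twist θ' u a b),
    diff_apply θ' a b (twist θ u i j), twist_twist_comm]
  split_ifs with h1 h2 h2 <;> simp only [diff_apply, h1, h2, if_true, if_false, map_zero] <;> abel

end Commute

section BaseChange

variable {k L : Type*} [Field k] [LieRing L] [LieAlgebra k L] (S : Type*) [CommRing S] [Algebra k S]

local notation "𝔘" => UniversalEnvelopingAlgebra k L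

variable {S}

theorem baseChange_map_mem {M N : Type*} [AddCommGroup M] [Module k M] [AddCommGroup N] [Module k N]
    {p : Submodule k M} {q : Submodule k N}
    {φ : M →ₗ[k] N} (h : ∀ u ∈ p, φ u ∈ q) {z : S ⊗[k] M} (hz : z ∈ p.baseChange S) :
    φ.baseChange S z ∈ q.baseChange S := by
  rw [Submodule.baseChange_eq_span] at hz
  induction hz using Submodule.span_induction with
  | mem x hx =>
    obtain ⟨u, hu, rfl⟩ := hx
    exact Submodule.tmul_mem_baseChange_of_mem _ (h u hu)
  | zero => rw [map_zero]; exact zero_mem _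
  | add x y _ _ hx hy => rw [map_add]; exact add_mem hx hy
  | smul s x _ hx => rw [map_smul]; exact Submodule.smul_mem _ _ hx

/-- The map D is only k-linear, as for a derivation of S, so `baseChange_map_mem` does not apply; D
acts on the factor S alone and leaves p untouched. -/
theorem rTensor_mem_baseChange {M : Type*} [AddCommGroup M] [Module k M] {p : Submodule k M}
    (D : S →ₗ[k] S) {z : S ⊗[k] M} (hz : z ∈ p.baseChange S) :
    D.rTensor M z ∈ p.baseChange S := by
  obtain ⟨y, hy⟩ := Submodule.toBaseChange_surjective S p ⟨z, hz⟩
  have hy' : z = (p.toBaseChange S y : S ⊗[k] M) := by rw [hy]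
  rw [hy']
  clear hy hy' hz
  induction y with
  | zero => simp
  | tmul s u =>
    rw [Submodule.coe_toBaseChange_tmul, LinearMap.rTensor_tmul]
    exact Submodule.tmul_mem_baseChange_of_mem _ u.2
  | add x y hx hy => rw [map_add, Submodule.coe_add, map_add]; exact add_mem hx hy

/-- The quotient by the extended subspace is S ⊗ (M/p). It is free over the domain S because M/p is
a vector space, so it has no torsion. -/
theorem mem_baseChange_of_smul_mem [IsDomain S] {M : Type*} [AddCommGroup M] [Module k M]
    {p : Submodule k M} {s : S} (hs : s ≠ 0) {z : S ⊗[k] M} (hz : s • z ∈ p.baseChange S) :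
    z ∈ p.baseChange S := by
  have h : ∀ z : S ⊗[k] M, z ∈ p.baseChange S ↔ p.mkQ.baseChange S z = 0 := by
    intro z
    constructor
    · intro hz
      have := baseChange_map_mem (φ := p.mkQ) (q := ⊥)
        (fun u hu => by rwa [Submodule.mem_bot, Submodule.mkQ_apply, Submodule.Quotient.mk_eq_zero]) hz
      simpa using this
    · intro hz
      have hex := lTensor_exact S (f := p.subtype) (g := p.mkQ)
        (by rw [LinearMap.exact_iff, Submodule.ker_mkQ, Submodule.range_subtype]) p.mkQ_surjective
      obtain ⟨y, rfl⟩ := (hex z).1 hz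
      clear hz
      induction y with
      | zero => rw [map_zero]; exact zero_mem _
      | tmul s u => exact Submodule.tmul_mem_baseChange_of_mem _ u.2
      | add x y hx hy => rw [map_add]; exact add_mem hx hy
  rw [h, map_smul, smul_eq_zero] at hz
  exact (h z).2 (hz.resolve_left hs)

theorem mem_baseChange_filt_one {z : S ⊗[k] 𝔘} (hz : z ∈ (filt k L 1).baseChange S) :
    ∃ s : S, z = s ⊗ₜ 1 := by
  rw [Submodule.baseChange_eq_span] at hz
  induction hz using Submodule.span_induction with
  | mem x hx =>
    obtain ⟨u, hu, rfl⟩ := hx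
    obtain ⟨r, rfl⟩ := mem_filt_one.1 hu
    exact ⟨r • 1, by rw [Algebra.algebraMap_eq_smul_one, smul_tmul]; rfl⟩
  | zero => exact ⟨0, (zero_tmul _ _).symm⟩
  | add x y _ _ hx hy =>
    obtain ⟨s, rfl⟩ := hx
    obtain ⟨t, rfl⟩ := hy
    exact ⟨s + t, (add_tmul _ _ _).symm⟩
  | smul s x _ hx =>
    obtain ⟨t, rfl⟩ := hx
    exact ⟨s * t, smul_tmul' _ _ _⟩

theorem exists_mem_baseChange_filt (z : S ⊗[k] 𝔘) : ∃ n, z ∈ (filt k L (n + 1)).baseChange S := by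
  induction z with
  | zero => exact ⟨0, zero_mem _⟩
  | tmul s u =>
    obtain ⟨n, hn⟩ := exists_mem_filt u
    exact ⟨n, Submodule.tmul_mem_baseChange_of_mem _ hn⟩
  | add x y hx hy =>
    obtain ⟨m, hm⟩ := hx
    obtain ⟨n, hn⟩ := hy
    exact ⟨max m n, add_mem (Submodule.baseChange_mono S (filt_mono (by omega)) hm)
      (Submodule.baseChange_mono S (filt_mono (by omega)) hn)⟩

/-- The augmentation of U(L) provides a retraction. -/
theorem tmul_one_injective : Function.Injective fun s : S => s ⊗ₜ[k] (1 : 𝔘) := by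
  intro s t h
  have := congrArg (fun z => TensorProduct.rid k S
    ((lift k (0 : L →ₗ⁅k⁆ k)).toLinearMap.lTensor S z)) h
  simpa using this

end BaseChange

end UniversalEnvelopingAlgebra
end


/-! ### The basis of V, invariants of gl_2 in S(V), and a divisibility lemma. -/

noncomputable section

namespace Gl2Center

open InfCherednik SemidirectPBW UniversalEnvelopingAlgebra

variable (k : Type*) [Field k]

/-! ### The standard basis of `k² ⊕ (k²)*` -/

/-- The standard basis of `k² ⊕ (k²)*`. -/
def stdBasis : Module.Basis (Fin 2 ⊕ Fin 2) k (V k) :=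
  (Pi.basisFun k (Fin 2)).prod (Pi.basisFun k (Fin 2)).dualBasis

/-- The standard basis of `k²`. -/
def vec (i : Fin 2) : V k := (Pi.single i 1, 0)

/-- The standard basis of `(k²)*`. -/
def covec (i : Fin 2) : V k := (0, LinearMap.proj i)

variable {k}

theorem stdBasis_inl (i : Fin 2) : stdBasis k (Sum.inl i) = vec k i := by
  simp [stdBasis, vec]

theorem stdBasis_inr (i : Fin 2) : stdBasis k (Sum.inr i) = covec k i := by
  simp only [stdBasis, covec, Module.Basis.prod_apply, Sum.elim_inr, Function.comp_apply]
  refine Prod.ext rfl (LinearMap.ext fun u => ?_)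
  simp

theorem lie_vec (A : Gl2 k) (l : Fin 2) :
    ⁅A, vec k l⁆ = ∑ i, (LieHom.id : Gl2 k →ₗ⁅k⁆ Gl2 k) A i l • vec k i := by
  have h : ⁅A, vec k l⁆ = (A.mulVec (Pi.single l 1), ⁅A, (0 : Module.Dual k (Fin 2 → k))⁆) := rfl
  rw [h, lie_zero]
  refine Prod.ext (funext fun j => ?_) ?_
  · fin_cases j <;> simp [vec, Matrix.col_apply]
  · simp [vec]

theorem lie_covec (A : Gl2 k) (l : Fin 2) :
    ⁅A, covec k l⁆ = ∑ i, dualRep k (Fin 2) A i l • covec k i := by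
  have h : ⁅A, covec k l⁆ = (A.mulVec 0, ⁅A, (LinearMap.proj l : Module.Dual k (Fin 2 → k))⁆) := rfl
  have h2 : ∀ u : Fin 2 → k, ⁅A, (LinearMap.proj l : Module.Dual k (Fin 2 → k))⁆ u =
      -(A.mulVec u l) := by
    intro u
    simp
  rw [h]
  refine Prod.ext ?_ (LinearMap.ext fun u => ?_)
  · simp [covec]
  · rw [h2]
    simp [covec, dualRep_apply, Matrix.mulVec, dotProduct]
    ring

/-! ### Invariant polynomials -/

local notation "𝔖" => MvPolynomial (Fin 2 ⊕ Fin 2) k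

open MvPolynomial (X)

variable (k) in
/-- The quadratic invariant polynomial. -/
def quadPoly : 𝔖 := X (Sum.inr 0) * X (Sum.inl 0) + X (Sum.inr 1) * X (Sum.inl 1)

theorem der_single (i j : Fin 2) (t : 𝔖) :
    der (stdBasis k) (Matrix.single i j (1 : k)) t =
      X (Sum.inl i) * MvPolynomial.pderiv (Sum.inl j) t -
        X (Sum.inr j) * MvPolynomial.pderiv (Sum.inr i) t := by
  have h : der (stdBasis k) (Matrix.single i j (1 : k)) =
      (X (Sum.inl i) : 𝔖) • MvPolynomial.pderiv (Sum.inl j) -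
        (X (Sum.inr j) : 𝔖) • MvPolynomial.pderiv (Sum.inr i) := by
    refine MvPolynomial.derivation_ext fun c => ?_
    rw [der_X]
    rcases c with l | l
    · rw [stdBasis_inl, lie_vec]
      simp only [map_sum, map_smul, ← stdBasis_inl, linPoly_basis, LieHom.id_apply]
      fin_cases i <;> fin_cases j <;> fin_cases l <;> simp [MvPolynomial.pderiv_X]
    · rw [stdBasis_inr, lie_covec]
      simp only [map_sum, map_smul, ← stdBasis_inr, linPoly_basis, dualRep_apply]
      fin_cases i <;> fin_cases j <;> fin_cases l <;> simp [MvPolynomial.pderiv_X]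
  rw [h]
  rfl

theorem coeff_X_mul_pderiv {σ : Type*} (i : σ) (m : σ →₀ ℕ) (t : MvPolynomial σ k) :
    (X i * MvPolynomial.pderiv i t).coeff m = m i * t.coeff m := by
  classical
  rw [MvPolynomial.coeff_X_mul']
  split_ifs with h
  · have h1 : m - Finsupp.single i 1 + Finsupp.single i 1 = m :=
      tsub_add_cancel_of_le (Finsupp.single_le_iff.2 (Nat.one_le_iff_ne_zero.2 (Finsupp.mem_support_iff.1 h)))
    rw [MvPolynomial.coeff_pderiv, h1, ← h1]
    simp [mul_comm]
  · rw [Finsupp.notMem_support_iff.1 h, Nat.cast_zero, zero_mul]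

/-- The exponent of `(x₀ ξ₀)ᵃ (x₁ ξ₁)ᵇ`. -/
def bidegree (a b : ℕ) : Fin 2 ⊕ Fin 2 →₀ ℕ :=
  Finsupp.equivFunOnFinite.symm (Sum.elim ![a, b] ![a, b])

section

variable [CharZero k] {t : MvPolynomial (Fin 2 ⊕ Fin 2) k}
  (ht : ∀ A : Gl2 k, der (stdBasis k) A t = 0)

include ht

/-- E_ii acts on a monomial by the exponent of v_i minus that of w_i, so invariance under the
diagonal forces these exponents to agree. -/
theorem exists_bidegree_of_coeff_ne_zero {m : Fin 2 ⊕ Fin 2 →₀ ℕ} (hm : t.coeff m ≠ 0) :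
    ∃ a b, m = bidegree a b := by
  have h : ∀ i : Fin 2, m (Sum.inl i) = m (Sum.inr i) := by
    intro i
    have h1 := congrArg (MvPolynomial.coeff m) (ht (Matrix.single i i 1))
    rw [der_single, MvPolynomial.coeff_sub, coeff_X_mul_pderiv, coeff_X_mul_pderiv,
      MvPolynomial.coeff_zero, ← sub_mul] at h1
    exact_mod_cast sub_eq_zero.1 ((mul_eq_zero.1 h1).resolve_right hm)
  refine ⟨m (Sum.inl 0), m (Sum.inl 1), Finsupp.ext fun c => ?_⟩
  rcases c with i | i <;> fin_cases i <;> simp [bidegree, h]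

-- Invariance under E_01 = v_0 ∂/∂v_1 - w_1 ∂/∂w_0, read off at one monomial. The recursion
-- determines an invariant from its coefficients with b = 0.
omit [CharZero k] in
theorem coeff_bidegree_succ (a b : ℕ) : (b + 1 : k) * t.coeff (bidegree a (b + 1)) =
    (a + 1) * t.coeff (bidegree (a + 1) b) := by
  have h1 := congrArg (MvPolynomial.coeff
    (bidegree a b + Finsupp.single (Sum.inl 0) 1 + Finsupp.single (Sum.inr 1) 1))
    (ht (Matrix.single 0 1 1))
  rw [der_single, MvPolynomial.coeff_sub, MvPolynomial.coeff_zero] at h1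
  rw [mul_comm (X (Sum.inr 1)), MvPolynomial.coeff_mul_X, add_right_comm,
    mul_comm (X (Sum.inl 0)), MvPolynomial.coeff_mul_X,
    MvPolynomial.coeff_pderiv, MvPolynomial.coeff_pderiv] at h1
  have e1 : bidegree a b + Finsupp.single (Sum.inr 1) 1 + Finsupp.single (Sum.inl 1) 1 =
      bidegree a (b + 1) := by
    ext c
    rcases c with i | i <;> fin_cases i <;> simp [bidegree]
  have e2 : bidegree a b + Finsupp.single (Sum.inl 0) 1 + Finsupp.single (Sum.inr 0) 1 =
      bidegree (a + 1) b := by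
    ext c
    rcases c with i | i <;> fin_cases i <;> simp [bidegree]
  rw [e1, e2] at h1
  simp [bidegree] at h1
  rw [bidegree, bidegree]
  linear_combination h1

theorem eq_zero_of_coeff_bidegree_eq_zero (h0 : ∀ a, t.coeff (bidegree a 0) = 0) : t = 0 := by
  have h : ∀ b a, t.coeff (bidegree a b) = 0 := by
    intro b
    induction b with
    | zero => exact h0
    | succ b ih =>
      intro a
      have := coeff_bidegree_succ ht a b
      rw [ih, mul_zero] at this
      exact (mul_eq_zero.1 this).resolve_left (Nat.cast_add_one_ne_zero b)
  ext m
  by_contra hm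
  obtain ⟨a, b, rfl⟩ := exists_bidegree_of_coeff_ne_zero ht hm
  exact hm (h b a)

end

variable (k) in
/-- The restriction of a polynomial to a line on which the quadratic invariant is a coordinate. -/
def restrict : 𝔖 →ₐ[k] Polynomial k :=
  MvPolynomial.aeval (Sum.elim ![Polynomial.X, 0] ![1, 0])

theorem restrict_quadPoly : restrict k (quadPoly k) = Polynomial.X := by
  simp [restrict, quadPoly]

theorem restrict_aeval_quadPoly (p : Polynomial k) :
    restrict k (Polynomial.aeval (quadPoly k) p) = p := by
  rw [← Polynomial.aeval_algHom_apply, restrict_quadPoly, Polynomial.aeval_X_left_apply]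

theorem der_quadPoly (A : Gl2 k) : der (stdBasis k) A (quadPoly k) = 0 := by
  rw [Matrix.matrix_eq_sum_single A]
  have hs : ∀ (i j : Fin 2) (r : k), Matrix.single i j r = r • Matrix.single i j 1 := by
    intro i j r
    rw [Matrix.smul_single, smul_eq_mul, mul_one]
  simp only [Fin.sum_univ_two, der_add, Derivation.add_apply]
  rw [hs 0 0, hs 0 1, hs 1 0, hs 1 1]
  simp only [der_smul, Derivation.smul_apply, der_single, quadPoly]
  simp [MvPolynomial.pderiv_X]
  simp [mul_comm]

/-- The first fundamental theorem for one vector and one covector. -/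
theorem exists_aeval_quadPoly_of_invariant [CharZero k] {t : 𝔖}
    (ht : ∀ A : Gl2 k, der (stdBasis k) A t = 0) :
    ∃ p : Polynomial k, t = Polynomial.aeval (quadPoly k) p := by
  refine ⟨restrict k t, sub_eq_zero.1 ?_⟩
  set r := t - Polynomial.aeval (quadPoly k) (restrict k t) with hr
  have hrt : ∀ A : Gl2 k, der (stdBasis k) A r = 0 := by
    intro A
    rw [hr, map_sub, ht, Derivation.map_aeval, der_quadPoly, smul_zero, sub_zero]
  have hr0 : restrict k r = 0 := by rw [hr, map_sub, restrict_aeval_quadPoly, sub_self]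
  refine eq_zero_of_coeff_bidegree_eq_zero hrt fun a => ?_
  have h := congrArg (Polynomial.coeff · a) hr0
  simp only [restrict, MvPolynomial.aeval_def, MvPolynomial.eval₂_eq', Polynomial.finsetSum_coeff,
    Polynomial.coeff_zero] at h
  -- `restrict` kills v_1 and w_1, so only invariant monomials with b = 0 survive, and the exponent
  -- of X records a.
  rw [Finset.sum_eq_single (bidegree a 0)] at h
  · simpa [bidegree] using h
  · intro m hm hne
    obtain ⟨a', b', rfl⟩ := exists_bidegree_of_coeff_ne_zero hrt (MvPolynomial.mem_support_iff.1 hm)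
    rcases Nat.eq_zero_or_pos b' with rfl | hb
    · have : a ≠ a' := fun h => hne (by rw [h])
      simp [bidegree, Polynomial.coeff_X_pow, this]
    · simp [bidegree, zero_pow hb.ne']
  · intro hm
    rw [MvPolynomial.notMem_support_iff.1 hm, map_zero, zero_mul, Polynomial.coeff_zero]

theorem not_X_dvd_X_pow {σ : Type*} {i j : σ} (h : i ≠ j) (m : ℕ) :
    ¬ (X i : MvPolynomial σ k) ∣ X j ^ m := by
  classical
  rintro ⟨q, hq⟩
  have := congrArg (MvPolynomial.eval fun l => if l = i then (0 : k) else 1) hq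
  simp [h.symm] at this

/-- X_a and X_b are primes not dividing X_c X_d, so their m-th powers can be extracted from s one
after the other. -/
theorem exists_eq_pow_mul {σ : Type*} {a b c d : σ} (hac : a ≠ c) (had : a ≠ d) (hbc : b ≠ c)
    (hbd : b ≠ d) {m : ℕ} {r s : MvPolynomial σ k}
    (h : (X a * X b) ^ m * r = (X c * X d) ^ m * s) : ∃ t, s = (X a * X b) ^ m * t := by
  have hp : ∀ i : σ, Prime (X i : MvPolynomial σ k) := fun i => MvPolynomial.X_prime
  have hn : ∀ i, i ≠ c → i ≠ d → ¬ (X i : MvPolynomial σ k) ∣ (X c * X d) ^ m := by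
    intro i hc hd hdvd
    rw [mul_pow] at hdvd
    rcases (hp i).dvd_or_dvd hdvd with h | h
    · exact not_X_dvd_X_pow hc m h
    · exact not_X_dvd_X_pow hd m h
  obtain ⟨s₁, rfl⟩ : X a ^ m ∣ s := by
    refine (hp a).pow_dvd_of_dvd_mul_left m (hn a hac had) ?_
    rw [← h, mul_pow, mul_assoc]
    exact dvd_mul_right _ _
  have h' : X b ^ m * r = (X c * X d) ^ m * s₁ := by
    have hne : (X a : MvPolynomial σ k) ^ m ≠ 0 := pow_ne_zero _ (MvPolynomial.X_ne_zero a)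
    refine mul_left_cancel₀ hne ?_
    rw [← mul_assoc, ← mul_pow, h]
    ring
  obtain ⟨s₂, rfl⟩ : X b ^ m ∣ s₁ := by
    refine (hp b).pow_dvd_of_dvd_mul_left m (hn b hbc hbd) ?_
    rw [← h']
    exact dvd_mul_right _ _
  exact ⟨s₂, by ring⟩

end Gl2Center
end


/-! ### Top parts of elements commuting with V. -/

noncomputable section

namespace Gl2Center

open InfCherednik SemidirectPBW UniversalEnvelopingAlgebra TensorProduct
open MvPolynomial (X)

variable {k : Type*} [Field k]

local notation "𝔖" => MvPolynomial (Fin 2 ⊕ Fin 2) k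
local notation "𝔘" => UniversalEnvelopingAlgebra k (Gl2 k)
local notation "ℕ𝔘" => MvPolynomial (Fin 2 ⊕ Fin 2) k ⊗[k] UniversalEnvelopingAlgebra k (Gl2 k)

variable (k) in
/-- The filtration of `S(V) ⊗ U(gl_2)` induced by the standard filtration of `U(gl_2)`. -/
abbrev tfilt (n : ℕ) : Submodule 𝔖 ℕ𝔘 := (filt k (Gl2 k) n).baseChange 𝔖

theorem tfilt_mono : Monotone (tfilt k) := fun _ _ h => Submodule.baseChange_mono _ (filt_mono h)

theorem tfilt_zero {z : ℕ𝔘} : z ∈ tfilt k 0 ↔ z = 0 := by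
  rw [tfilt, filt_zero, Submodule.baseChange_bot, Submodule.mem_bot]

theorem tmul_one_mem_tfilt (s : 𝔖) : s ⊗ₜ[k] (1 : 𝔘) ∈ tfilt k 1 :=
  Submodule.tmul_mem_baseChange_of_mem _ (by simpa using algebraMap_mem_filt (L := Gl2 k) (1 : k))

/-- The `S(V)`-linear extension of the difference operators of `k²`. -/
abbrev DV (i j : Fin 2) : ℕ𝔘 →ₗ[𝔖] ℕ𝔘 := (dV k i j).baseChange 𝔖

/-- The `S(V)`-linear extension of the difference operators of `(k²)*`. -/
abbrev DW (i j : Fin 2) : ℕ𝔘 →ₗ[𝔖] ℕ𝔘 := (dW k i j).baseChange 𝔖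

/-- Right multiplication by a matrix unit. -/
abbrev mulUnit (i j : Fin 2) : ℕ𝔘 →ₗ[𝔖] ℕ𝔘 := (LinearMap.mulRight k (unit k i j)).baseChange 𝔖

variable (k) in
/-- The coefficients of the cubic invariant. -/
def kappa (i j : Fin 2) : 𝔖 :=
  ![![-(X (Sum.inr 1) * X (Sum.inl 1)), X (Sum.inr 0) * X (Sum.inl 1)],
    ![X (Sum.inr 1) * X (Sum.inl 0), -(X (Sum.inr 0) * X (Sum.inl 0))]] i j

variable (k) in
/-- The principal part of the multiplication by the cubic invariant. -/
def mulCubic : Module.End 𝔖 ℕ𝔘 := ∑ i, ∑ j, kappa k i j • mulUnit i j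

theorem mulCubic_apply (z : ℕ𝔘) : mulCubic k z = ∑ i, ∑ j, kappa k i j • mulUnit i j z := by
  simp [mulCubic]

theorem DV_mem {m : ℕ} {z : ℕ𝔘} (i j : Fin 2) (hz : z ∈ tfilt k (m + 1)) : DV i j z ∈ tfilt k m :=
  baseChange_map_mem (fun _ hu => diff_mem_filt _ i j hu) hz

theorem mulUnit_mem {m : ℕ} {z : ℕ𝔘} (i j : Fin 2) (hz : z ∈ tfilt k m) :
    mulUnit i j z ∈ tfilt k (m + 1) :=
  baseChange_map_mem (fun _ hu => mul_ι_mem_filt _ hu) hz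

theorem mulCubic_mem {m : ℕ} {z : ℕ𝔘} (hz : z ∈ tfilt k m) : mulCubic k z ∈ tfilt k (m + 1) := by
  rw [mulCubic_apply]
  exact sum_mem fun i _ => sum_mem fun j _ => Submodule.smul_mem _ _ (mulUnit_mem i j hz)

theorem mulCubic_pow_mem (m : ℕ) {p : ℕ} {z : ℕ𝔘} (hz : z ∈ tfilt k p) :
    (mulCubic k ^ m) z ∈ tfilt k (p + m) := by
  induction m with
  | zero => exact hz
  | succ m ih =>
    rw [pow_succ', Module.End.mul_apply]
    exact mulCubic_mem ih

theorem mulCubic_pow_tmul_one_mem (s : 𝔖) (m : ℕ) :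
    (mulCubic k ^ m) (s ⊗ₜ[k] (1 : 𝔘)) ∈ tfilt k (m + 1) := by
  rw [add_comm]
  exact mulCubic_pow_mem m (tmul_one_mem_tfilt s)

/-- Euler's identity with the matrix units on the right, the side on which multiplication in U(gl_2
⋉ V) does not touch the factor S(V). -/
theorem euler_right {m : ℕ} {u : 𝔘} (hu : u ∈ filt k (Gl2 k) (m + 1)) :
    ∑ i, ∑ j, dV k i j u * unit k i j - (m : k) • u ∈ filt k (Gl2 k) m := by
  have h := sub_mem (euler hu) (sum_mem fun i (_ : i ∈ Finset.univ) => sum_mem fun j (_ : j ∈ Finset.univ) =>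
    ι_commutator_mem_filt (Matrix.single i j (1 : k)) (diff_mem_filt LieHom.id i j hu))
  convert h using 1
  simp only [contr_apply, unit, Finset.sum_sub_distrib]
  abel

theorem euler_tfilt {m : ℕ} {z : ℕ𝔘} (hz : z ∈ tfilt k (m + 1)) :
    ∑ i, ∑ j, mulUnit i j (DV i j z) - (m : 𝔖) • z ∈ tfilt k m := by
  have h := baseChange_map_mem (S := 𝔖)
    (φ := ∑ i, ∑ j, LinearMap.mulRight k (unit k i j) ∘ₗ dV k i j - (m : k) • LinearMap.id)
    (fun u hu => by simpa [LinearMap.sum_apply] using euler_right hu) hz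
  convert h using 1
  simp only [Fin.sum_univ_two, LinearMap.baseChange_sub, LinearMap.baseChange_add,
    LinearMap.baseChange_comp, LinearMap.baseChange_smul, LinearMap.baseChange_id,
    LinearMap.sub_apply, LinearMap.add_apply, LinearMap.comp_apply, LinearMap.smul_apply,
    LinearMap.id_apply]
  rw [Nat.cast_smul_eq_nsmul, Nat.cast_smul_eq_nsmul]

theorem DV_mulUnit {m : ℕ} {z : ℕ𝔘} (hz : z ∈ tfilt k (m + 1)) (i j a b : Fin 2) :
    DV i j (mulUnit a b z) - mulUnit a b (DV i j z) - (if a = i ∧ b = j then (1 : 𝔖) else 0) • z ∈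
      tfilt k m := by
  have h := baseChange_map_mem (S := 𝔖)
    (φ := dV k i j ∘ₗ LinearMap.mulRight k (unit k a b) - LinearMap.mulRight k (unit k a b) ∘ₗ dV k i j
      - (if a = i ∧ b = j then (1 : k) else 0) • LinearMap.id) (q := filt k (Gl2 k) m)
    (fun u hu => by
      simp only [LinearMap.sub_apply, LinearMap.comp_apply, LinearMap.mulRight_apply,
        LinearMap.smul_apply, LinearMap.id_apply]
      rw [unit, dV, diff_mul_ι, LieHom.id_apply, Matrix.single_apply, add_sub_cancel_left,
        add_sub_cancel_left]
      exact sum_mem fun l _ => Submodule.smul_mem _ _ (diff_mem_filt _ _ _ hu)) hz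
  convert h using 1
  simp only [LinearMap.baseChange_sub, LinearMap.baseChange_comp, LinearMap.baseChange_smul,
    LinearMap.baseChange_id, LinearMap.sub_apply, LinearMap.comp_apply, LinearMap.smul_apply,
    LinearMap.id_apply]
  split_ifs <;> simp

/-- The principal part of the cubic is linear in the E_ij with ∂/∂E_ij equal to κ_ij, so the
commutator of `DV i j` with it is κ_ij to top order. -/
theorem DV_mulCubic {m : ℕ} {z : ℕ𝔘} (hz : z ∈ tfilt k (m + 1)) (i j : Fin 2) :
    DV i j (mulCubic k z) - mulCubic k (DV i j z) - kappa k i j • z ∈ tfilt k m := by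
  have h := sum_mem fun a (_ : a ∈ Finset.univ) => sum_mem fun b (_ : b ∈ Finset.univ) =>
    Submodule.smul_mem (tfilt k m) (kappa k a b) (DV_mulUnit hz i j a b)
  convert h using 1
  have e : kappa k i j • z = ∑ a, ∑ b, kappa k a b • (if a = i ∧ b = j then (1 : 𝔖) else 0) • z := by
    simp only [ite_and, ite_smul, one_smul, zero_smul, smul_ite, smul_zero]
    rw [Finset.sum_eq_single i]
    · simp
    · intro a _ ha
      simp [ha]
    · simp
  simp only [mulCubic_apply, map_sum, map_smul, smul_sub, Finset.sum_sub_distrib, ← e]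

theorem DV_tmul_one (i j : Fin 2) (s : 𝔖) : DV i j (s ⊗ₜ[k] (1 : 𝔘)) = 0 :=
  tfilt_zero.1 (DV_mem i j (tmul_one_mem_tfilt s))

theorem DV_mulCubic_pow (i j : Fin 2) (s : 𝔖) (m : ℕ) :
    DV i j ((mulCubic k ^ (m + 1)) (s ⊗ₜ[k] (1 : 𝔘))) -
      ((m + 1 : 𝔖) * kappa k i j) • (mulCubic k ^ m) (s ⊗ₜ[k] (1 : 𝔘)) ∈ tfilt k m := by
  induction m with
  | zero =>
    have h := DV_mulCubic (tmul_one_mem_tfilt s) i j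
    rw [DV_tmul_one, map_zero, sub_zero] at h
    simpa using h
  | succ m ih =>
    have h1 := DV_mulCubic (mulCubic_pow_tmul_one_mem s (m + 1)) i j
    have h := add_mem h1 (mulCubic_mem ih)
    convert h using 1
    rw [pow_succ' _ (m + 1), Module.End.mul_apply, map_sub, map_smul, pow_succ' _ m,
      Module.End.mul_apply]
    push_cast
    module

theorem DV_pow_mem (i j : Fin 2) (m : ℕ) {p : ℕ} {z : ℕ𝔘} (hz : z ∈ tfilt k (p + m)) :
    (DV i j ^ m) z ∈ tfilt k p := by
  induction m generalizing z with
  | zero => exact hz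
  | succ m ih =>
    rw [pow_succ, Module.End.mul_apply]
    exact ih (DV_mem i j hz)

theorem DV_pow_eq_zero (i j : Fin 2) {m : ℕ} {z : ℕ𝔘} (hz : z ∈ tfilt k m) :
    (DV i j ^ m) z = 0 :=
  tfilt_zero.1 (DV_pow_mem i j m (by rwa [zero_add]))

/-- Exact, although `DV_mulCubic_pow` is only a congruence: m further applications of `DV` kill
`tfilt m`, and with it the error. -/
theorem DV_pow_mulCubic_pow (i j : Fin 2) (s : 𝔖) (m : ℕ) :
    (DV i j ^ m) ((mulCubic k ^ m) (s ⊗ₜ[k] (1 : 𝔘))) =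
      ((m.factorial : 𝔖) * kappa k i j ^ m) • s ⊗ₜ[k] (1 : 𝔘) := by
  induction m with
  | zero => simp
  | succ m ih =>
    have h := DV_pow_eq_zero i j (DV_mulCubic_pow i j s m)
    rw [map_sub, sub_eq_zero, map_smul, ih, smul_smul] at h
    rw [pow_succ, Module.End.mul_apply, h, Nat.factorial_succ]
    congr 1
    push_cast
    ring

/-- The m-th derivative recovers s up to the nonzero factor m! κ_01^m, so different coefficients
give different top parts. -/
theorem eq_zero_of_mulCubic_pow_mem [CharZero k] {m : ℕ} {s : 𝔖}
    (h : (mulCubic k ^ m) (s ⊗ₜ[k] (1 : 𝔘)) ∈ tfilt k m) : s = 0 := by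
  have h1 := DV_pow_eq_zero 0 1 h
  rw [DV_pow_mulCubic_pow, smul_tmul', ← zero_tmul 𝔖 (1 : 𝔘)] at h1
  have h2 := tmul_one_injective h1
  refine (mul_eq_zero.1 h2).resolve_left (mul_ne_zero ?_ (pow_ne_zero _ ?_))
  · exact_mod_cast m.factorial_ne_zero
  · exact mul_ne_zero (MvPolynomial.X_ne_zero _) (MvPolynomial.X_ne_zero _)

/-- The elements of `S(V) ⊗ U(gl_2)` which commute with `V`. -/
structure CommV (z : ℕ𝔘) : Prop where
  vec : ∀ j, ∑ i, (X (Sum.inl i) : 𝔖) • DV i j z = 0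
  covec : ∀ j, ∑ i, (X (Sum.inr i) : 𝔖) • DW i j z = 0

/-- The defining equations have coefficients in S(V) and involve difference operators, which commute
with `DV a b`. This lets the induction pass from z to its derivative. -/
theorem CommV.map {z : ℕ𝔘} (hz : CommV z) (a b : Fin 2) : CommV (DV a b z) := by
  have h1 : ∀ i j, DV i j (DV a b z) = DV a b (DV i j z) := by
    intro i j
    have : dV k i j ∘ₗ dV k a b = dV k a b ∘ₗ dV k i j :=
      LinearMap.ext fun u => diff_diff_comm LieHom.id LieHom.id i j a b u
    simp only [DV, ← LinearMap.comp_apply, ← LinearMap.baseChange_comp, this]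
  have h2 : ∀ i j, DW i j (DV a b z) = DV a b (DW i j z) := by
    intro i j
    have : dW k i j ∘ₗ dV k a b = dV k a b ∘ₗ dW k i j :=
      LinearMap.ext fun u => diff_diff_comm (dualRep k (Fin 2)) LieHom.id i j a b u
    simp only [DV, DW, ← LinearMap.comp_apply, ← LinearMap.baseChange_comp, this]
  constructor
  · intro j
    have h := congrArg (DV a b) (hz.vec j)
    rw [map_sum, map_zero] at h
    simpa only [h1, map_smul] using h
  · intro j
    have h := congrArg (DV a b) (hz.covec j)
    rw [map_sum, map_zero] at h
    simpa only [h2, map_smul] using h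

theorem CommV.covec_smul_mem {z : ℕ𝔘} (hz : CommV z) {m : ℕ} (hm : z ∈ tfilt k (m + 2)) :
    (X (Sum.inr 0) : 𝔖) • DV 0 0 z + (X (Sum.inr 1) : 𝔖) • DV 0 1 z ∈ tfilt k m := by
  have h1 : ∀ i j, DV i j z + DW j i z ∈ tfilt k m := fun i j => by
    have h : DV i j z + DW j i z = (dV k i j + dW k j i).baseChange 𝔖 z := by
      rw [LinearMap.baseChange_add, LinearMap.add_apply]
    rw [h]
    exact baseChange_map_mem (p := filt k (Gl2 k) (m + 2)) (fun u hu => dV_add_dW_mem hu i j) hm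
  have h2 := add_mem (Submodule.smul_mem _ (X (Sum.inr 0) : 𝔖) (h1 0 0))
    (Submodule.smul_mem _ (X (Sum.inr 1) : 𝔖) (h1 0 1))
  have h3 := hz.covec 0
  rw [Fin.sum_univ_two] at h3
  rwa [smul_add, smul_add, add_add_add_comm, h3, add_zero] at h2

/-- A 2 × 2 matrix annihilated by (x, y) on the left and by (w₀, w₁) on the right is proportional to
the rank-one matrix κ. The second condition is assumed, and the conclusion drawn, modulo p. -/
theorem rank_one_relations {S N : Type*} [CommRing S] [AddCommGroup N] [Module S N]
    (p : Submodule S N) {x y w₀ w₁ : S} {z : Fin 2 → Fin 2 → N}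
    (h0 : x • z 0 0 + y • z 1 0 = 0) (h1 : x • z 0 1 + y • z 1 1 = 0)
    (hR : w₀ • z 0 0 + w₁ • z 0 1 ∈ p) :
    (w₀ * y) • z 0 0 - (-(w₁ * y)) • z 0 1 ∈ p ∧ (w₀ * y) • z 1 0 - (w₁ * x) • z 0 1 ∈ p ∧
      (w₀ * y) • z 1 1 - (-(w₀ * x)) • z 0 1 ∈ p := by
  refine ⟨?_, ?_, ?_⟩
  · have e : (w₀ * y) • z 0 0 - (-(w₁ * y)) • z 0 1 = y • (w₀ • z 0 0 + w₁ • z 0 1) := by module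
    rw [e]
    exact p.smul_mem _ hR
  · have e : (w₀ * y) • z 1 0 - (w₁ * x) • z 0 1 =
        w₀ • (x • z 0 0 + y • z 1 0) - x • (w₀ • z 0 0 + w₁ • z 0 1) := by module
    rw [e, h0, smul_zero, zero_sub]
    exact neg_mem (p.smul_mem _ hR)
  · have e : (w₀ * y) • z 1 1 - (-(w₀ * x)) • z 0 1 = w₀ • (x • z 0 1 + y • z 1 1) := by module
    rw [e, h1, smul_zero]
    exact p.zero_mem

theorem CommV.kappa_smul {z : ℕ𝔘} (hz : CommV z) {m : ℕ} (hm : z ∈ tfilt k (m + 2)) (i j : Fin 2) :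
    kappa k 0 1 • DV i j z - kappa k i j • DV 0 1 z ∈ tfilt k m := by
  have hv0 := hz.vec 0
  have hv1 := hz.vec 1
  rw [Fin.sum_univ_two] at hv0 hv1
  have h := rank_one_relations (tfilt k m) (z := fun i j => DV i j z) hv0 hv1 (hz.covec_smul_mem hm)
  match i, j with
  | 0, 0 => exact h.1
  | 0, 1 => rw [sub_self]; exact zero_mem _
  | 1, 0 => exact h.2.1
  | 1, 1 => exact h.2.2

/-- Proportionality of the gradient to κ and Euler's identity give m κ_01 z ≡ C · ∂_01 z. As ∂_01 z
commutes with V as well, the argument iterates down to degree zero. -/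
theorem CommV.exists_mulCubic_pow {m : ℕ} {z : ℕ𝔘} (hz : CommV z) (hm : z ∈ tfilt k (m + 1)) :
    ∃ s : 𝔖, ((m.factorial : 𝔖) * kappa k 0 1 ^ m) • z - (mulCubic k ^ m) (s ⊗ₜ[k] (1 : 𝔘)) ∈
      tfilt k m := by
  induction m generalizing z with
  | zero =>
    obtain ⟨s, rfl⟩ := mem_baseChange_filt_one hm
    exact ⟨s, by simp⟩
  | succ m ih =>
    obtain ⟨s, hs⟩ := ih (hz.map 0 1) (DV_mem 0 1 hm)
    refine ⟨s, ?_⟩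
    have h1 : ((m + 1 : ℕ) : 𝔖) • kappa k 0 1 • z - mulCubic k (DV 0 1 z) ∈ tfilt k (m + 1) := by
      have h2 := Submodule.smul_mem _ (kappa k 0 1) (euler_tfilt hm)
      have h3 := sum_mem fun i (_ : i ∈ Finset.univ) => sum_mem fun j (_ : j ∈ Finset.univ) =>
        mulUnit_mem i j (hz.kappa_smul hm i j)
      have h := sub_mem h3 h2
      convert h using 1
      simp only [map_sub, map_smul, Finset.sum_sub_distrib, mulCubic_apply, smul_sub,
        Finset.smul_sum]
      module
    have h := add_mem (Submodule.smul_mem _ ((m.factorial : 𝔖) * kappa k 0 1 ^ m) h1)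
      (mulCubic_mem hs)
    convert h using 1
    rw [map_sub, map_smul, pow_succ' (mulCubic k), Module.End.mul_apply, Nat.factorial_succ]
    push_cast
    module

/-- Removes the denominator κ_01^m: an m-fold derivative in the direction 10 gives κ_01^m r = κ_10^m
s, and κ_01 = w_0 v_1 is coprime to κ_10 = w_1 v_0. -/
theorem CommV.exists_factorial_smul [CharZero k] {m : ℕ} {z : ℕ𝔘} (hz : CommV z)
    (hm : z ∈ tfilt k (m + 1)) :
    ∃ t : 𝔖, (m.factorial : 𝔖) • z - (mulCubic k ^ m) (t ⊗ₜ[k] (1 : 𝔘)) ∈ tfilt k m := by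
  obtain ⟨s, hs⟩ := hz.exists_mulCubic_pow hm
  have hfac : (m.factorial : 𝔖) ≠ 0 := by exact_mod_cast m.factorial_ne_zero
  obtain ⟨r, hr⟩ := mem_baseChange_filt_one
    (DV_pow_mem 1 0 m (p := 1) (z := z) (by rwa [add_comm]))
  have h := DV_pow_eq_zero 1 0 hs
  rw [map_sub, map_smul, DV_pow_mulCubic_pow, hr, smul_tmul', smul_tmul', sub_eq_zero] at h
  have h' := tmul_one_injective h
  simp only [smul_eq_mul, mul_assoc] at h'
  obtain ⟨t, rfl⟩ := exists_eq_pow_mul (a := Sum.inr (0 : Fin 2)) (b := Sum.inl (1 : Fin 2))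
    (c := Sum.inr (1 : Fin 2)) (d := Sum.inl (0 : Fin 2)) (by simp) (by simp) (by simp) (by simp)
    (mul_left_cancel₀ hfac h')
  refine ⟨t, mem_baseChange_of_smul_mem (s := kappa k 0 1 ^ m) (pow_ne_zero _ ?_) ?_⟩
  · exact mul_ne_zero (MvPolynomial.X_ne_zero _) (MvPolynomial.X_ne_zero _)
  · have e : kappa k 0 1 ^ m • (mulCubic k ^ m) (t ⊗ₜ[k] (1 : 𝔘)) =
        (mulCubic k ^ m) (((X (Sum.inr 0) * X (Sum.inl 1)) ^ m * t) ⊗ₜ[k] (1 : 𝔘)) := by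
      rw [← map_smul, smul_tmul']
      rfl
    rw [smul_sub, e, smul_smul, mul_comm]
    exact hs

end Gl2Center
end


/-! ### The centre of U(gl_2 ⋉ V). -/

noncomputable section

namespace Gl2Center

open InfCherednik SemidirectPBW UniversalEnvelopingAlgebra TensorProduct Gl2Relations
open MvPolynomial (X)

variable {k : Type*} [Field k]

local notation "𝔖" => MvPolynomial (Fin 2 ⊕ Fin 2) k
local notation "𝔘" => UniversalEnvelopingAlgebra k (Gl2 k)
local notation "ℕ𝔘" => MvPolynomial (Fin 2 ⊕ Fin 2) k ⊗[k] UniversalEnvelopingAlgebra k (Gl2 k)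

theorem lie_single_vec (i j l : Fin 2) :
    ⁅(Matrix.single i j 1 : Gl2 k), vec k l⁆ = if j = l then vec k i else 0 := by
  rw [lie_vec, Fin.sum_univ_two]
  fin_cases i <;> fin_cases j <;> fin_cases l <;> simp

theorem lie_single_covec (i j l : Fin 2) :
    ⁅(Matrix.single i j 1 : Gl2 k), covec k l⁆ = -if i = l then covec k j else 0 := by
  rw [lie_covec, Fin.sum_univ_two]
  fin_cases i <;> fin_cases j <;> fin_cases l <;> simp [dualRep_apply] <;>
    exact neg_one_smul k (covec k _)

variable (k) in
/-- The matrix units in `U(gl_2 ⋉ V)`. -/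
def uUnit (i j : Fin 2) : UV k := uLie k (Matrix.single i j 1 : Gl2 k)

variable (k) in
/-- The basis of `k²` in `U(gl_2 ⋉ V)`. -/
def uv (i : Fin 2) : UV k := uVec k (vec k i)

variable (k) in
/-- The basis of `(k²)*` in `U(gl_2 ⋉ V)`. -/
def uw (i : Fin 2) : UV k := uVec k (covec k i)

theorem uRel : Rel (uUnit k) (uv k) (uw k) where
  lie a b i j := by
    have h := congrArg (ofU k (Gl2 k) (V k)) (unit_commutator (k := k) a b i j)
    simp only [map_sub, map_mul, apply_ite (ofU k (Gl2 k) (V k)), map_zero, UniversalEnvelopingAlgebra.unit,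
      ofU_ι] at h
    exact h
  act_v i j l := by
    rw [uUnit, uv, uLie_mul_uVec, add_sub_cancel_left, lie_single_vec, apply_ite (uVec k),
      ← vecLin_apply, ← vecLin_apply, map_zero]
    rfl
  act_w i j l := by
    rw [uUnit, uw, uLie_mul_uVec, add_sub_cancel_left, lie_single_covec, ← vecLin_apply, map_neg,
      apply_ite (vecLin k (Gl2 k) (V k)), map_zero]
    rfl
  comm_v i j := uVec_mul_uVec _ _
  comm_w i j := uVec_mul_uVec _ _

variable (k) in
/-- The quadratic central element of `U(gl_2 ⋉ V)`. -/
def uQuad : UV k := quad (uv k) (uw k)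

variable (k) in
/-- The cubic central element of `U(gl_2 ⋉ V)`. -/
def uCubic : UV k := -cubic (uUnit k) (uv k) (uw k)

theorem mem_center_of_commute {z : UV k} (hE : ∀ i j, Commute (uUnit k i j) z)
    (hv : ∀ i, Commute (uv k i) z) (hw : ∀ i, Commute (uw k i) z) :
    z ∈ Subalgebra.center k (UV k) := by
  rw [Subalgebra.mem_center_iff]
  intro u
  change Commute u z
  induction u using SemidirectPBW.induct with
  | hC r => exact Algebra.commutes r z
  | hL A =>
    have h : uLie k A = ∑ i, ∑ j, A i j • uUnit k i j := by
      rw [← ofU_ι, ι_eq_sum_unit, map_sum]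
      simp only [map_sum, map_smul, UniversalEnvelopingAlgebra.unit, ofU_ι]
      rfl
    rw [h]
    exact Commute.sum_left _ _ _ fun i _ => Commute.sum_left _ _ _ fun j _ => (hE i j).smul_left _
  | hM m =>
    have h : (uVec k m : UV k) = ∑ c, (stdBasis k).repr m c • uVec k (stdBasis k c) := by
      conv_lhs => rw [← (stdBasis k).sum_repr m, ← vecLin_apply, map_sum]
      simp only [map_smul, vecLin_apply]
    rw [h]
    refine Commute.sum_left _ _ _ fun c _ => Commute.smul_left ?_ _
    rcases c with i | i
    · rw [stdBasis_inl]; exact hv i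
    · rw [stdBasis_inr]; exact hw i
  | hadd u v hu hv => exact hu.add_left hv
  | hmul u v hu hv => exact hu.mul_left hv

theorem commutator_uw_uv (i j : Fin 2) : uw k i * uv k j - uv k j * uw k i = 0 :=
  sub_eq_zero.2 (uVec_mul_uVec _ _)

theorem uQuad_mem_center : uQuad k ∈ Subalgebra.center k (UV k) := by
  have hc : ∀ i j, uv k i * uw k j - uw k j * uv k i = 0 := fun i j =>
    sub_eq_zero.2 (uVec_mul_uVec _ _)
  refine mem_center_of_commute (fun i j => uRel.commute_quad i j) (fun l => ?_) (fun l => ?_)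
  · have h := (uRel (k := k)).quad_mul_v l
    simp only [commutator_uw_uv, zero_mul, Finset.sum_const_zero] at h
    exact (sub_eq_zero.1 h).symm
  · have h := (uRel (k := k)).quad_mul_w l
    simp only [hc, mul_zero, Finset.sum_const_zero] at h
    exact (sub_eq_zero.1 h).symm

theorem uCubic_mem_center : uCubic k ∈ Subalgebra.center k (UV k) := by
  refine neg_mem (mem_center_of_commute (fun i j => uRel.commute_cubic i j) (fun l => ?_) fun l => ?_)
  · have h := (uRel (k := k)).cubic_mul_v (g := fun _ _ => 0) commutator_uw_uv l
    simp only [mul_zero, neg_zero, ite_self, sub_self, add_zero, zero_mul] at h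
    exact (sub_eq_zero.1 h).symm
  · have h := (uRel (k := k)).cubic_mul_w (g := fun _ _ => 0) commutator_uw_uv l
    simp only [mul_zero, sub_self, add_zero] at h
    exact (sub_eq_zero.1 h).symm

/-! ### The centre of `U(gl_2 ⋉ V)` -/

local notation "mm" => mulMap (L := Gl2 k) (stdBasis k)

theorem ofPoly_quadPoly : ofPoly (L := Gl2 k) (stdBasis k) (quadPoly k) = uQuad k := by
  simp only [quadPoly, map_add, map_mul, ofPoly_X, stdBasis_inl, stdBasis_inr]
  rfl

theorem mulMap_tmul_one (s : 𝔖) : mm (s ⊗ₜ 1) = ofPoly (stdBasis k) s := by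
  rw [mulMap_tmul, map_one, mul_one]

/-- The bracket with an element of `gl_2`, on `S(V) ⊗ U(gl_2)`. -/
def bracketMap (A : Gl2 k) : ℕ𝔘 →ₗ[k] ℕ𝔘 :=
  (der (stdBasis k) A).toLinearMap.rTensor 𝔘 +
    ((LinearMap.mulLeft k (ι k A) - LinearMap.mulRight k (ι k A)).baseChange 𝔖).restrictScalars k

theorem bracketMap_tmul_one (A : Gl2 k) (s : 𝔖) :
    bracketMap A (s ⊗ₜ[k] (1 : 𝔘)) = der (stdBasis k) A s ⊗ₜ[k] (1 : 𝔘) := by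
  simp [bracketMap]

theorem bracketMap_mem (A : Gl2 k) {m : ℕ} {n : ℕ𝔘} (hn : n ∈ tfilt k m) :
    bracketMap A n ∈ tfilt k m :=
  add_mem (rTensor_mem_baseChange _ hn)
    (baseChange_map_mem (fun _ hu => ι_commutator_mem_filt A hu) hn)

theorem mulMap_bracketMap (A : Gl2 k) (n : ℕ𝔘) :
    mm (bracketMap A n) = uLie k A * mm n - mm n * uLie k A := by
  rw [uLie_mul_mulMap, ← ofU_ι, mulMap_mul_ofU, ← map_sub, bracketMap]
  congr 1
  rw [LinearMap.baseChange_sub]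
  simp only [LinearMap.add_apply, LinearMap.restrictScalars_apply, LinearMap.sub_apply]
  abel

variable (k) in
/-- The multiplication by the cubic central element, on `S(V) ⊗ U(gl_2)`. -/
def cubicMap : Module.End k ℕ𝔘 :=
  ∑ i, ∑ j, (bracketMap (Matrix.single i j 1) + (mulUnit i j).restrictScalars k) ∘ₗ
    (LinearMap.lsmul 𝔖 ℕ𝔘 (kappa k i j)).restrictScalars k

theorem cubicMap_apply (n : ℕ𝔘) : cubicMap k n =
    ∑ i, ∑ j, bracketMap (Matrix.single i j 1) (kappa k i j • n) + mulCubic k n := by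
  simp only [cubicMap, LinearMap.sum_apply, LinearMap.comp_apply, LinearMap.add_apply,
    mulCubic_apply, ← Finset.sum_add_distrib, LinearMap.restrictScalars_apply,
    LinearMap.lsmul_apply, map_smul]

/-- Moving the matrix units from the left to the right costs brackets with gl_2, which do not raise
the degree; so powers of the true multiplication and of `mulCubic` share their top parts. -/
theorem cubicMap_sub_mem {m : ℕ} {n : ℕ𝔘} (hn : n ∈ tfilt k m) :
    cubicMap k n - mulCubic k n ∈ tfilt k m := by
  rw [cubicMap_apply, add_sub_cancel_right]
  exact sum_mem fun i _ => sum_mem fun j _ => bracketMap_mem _ (Submodule.smul_mem _ _ hn)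

theorem cubicMap_mem {m : ℕ} {n : ℕ𝔘} (hn : n ∈ tfilt k m) : cubicMap k n ∈ tfilt k (m + 1) := by
  have h := add_mem (tfilt_mono (Nat.le_succ m) (cubicMap_sub_mem hn)) (mulCubic_mem hn)
  rwa [sub_add_cancel] at h

theorem cubicMap_pow_sub_mem (s : 𝔖) (m : ℕ) : (cubicMap k ^ m) (s ⊗ₜ[k] (1 : 𝔘)) -
    (mulCubic k ^ m) (s ⊗ₜ[k] (1 : 𝔘)) ∈ tfilt k m := by
  induction m with
  | zero => simp
  | succ m ih =>
    have h := add_mem (cubicMap_mem ih) (cubicMap_sub_mem (mulCubic_pow_tmul_one_mem s m))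
    rwa [map_sub, sub_add_sub_cancel, ← Module.End.mul_apply, ← Module.End.mul_apply, ← pow_succ',
      ← pow_succ'] at h

theorem cubicMap_pow_tmul_one_mem (s : 𝔖) (m : ℕ) :
    (cubicMap k ^ m) (s ⊗ₜ[k] (1 : 𝔘)) ∈ tfilt k (m + 1) := by
  have h := add_mem (tfilt_mono (Nat.le_succ m) (cubicMap_pow_sub_mem s m))
    (mulCubic_pow_tmul_one_mem s m)
  rwa [sub_add_cancel] at h

theorem eq_zero_of_cubicMap_pow_mem [CharZero k] {m : ℕ} {s : 𝔖}
    (h : (cubicMap k ^ m) (s ⊗ₜ[k] (1 : 𝔘)) ∈ tfilt k m) : s = 0 := by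
  refine eq_zero_of_mulCubic_pow_mem (m := m) ?_
  have h' := sub_mem h (cubicMap_pow_sub_mem s m)
  rwa [sub_sub_cancel] at h'

theorem uCubic_mul_mulMap (n : ℕ𝔘) : uCubic k * mm n = mm (cubicMap k n) := by
  have h : uCubic k = ∑ i, ∑ j, uUnit k i j * ofPoly (stdBasis k) (kappa k i j) := by
    simp only [Fin.sum_univ_two, kappa, Matrix.cons_val_zero, Matrix.cons_val_one, map_neg, map_mul,
      ofPoly_X, stdBasis_inl, stdBasis_inr, uCubic, cubic, uv, uw]
    noncomm_ring
  rw [h, Finset.sum_mul, cubicMap, LinearMap.sum_apply, map_sum]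
  refine Finset.sum_congr rfl fun i _ => ?_
  rw [Finset.sum_mul, LinearMap.sum_apply, map_sum]
  refine Finset.sum_congr rfl fun j _ => ?_
  rw [mul_assoc, ofPoly_mul_mulMap, LinearMap.comp_apply, LinearMap.add_apply, map_add,
    mulMap_bracketMap, LinearMap.restrictScalars_apply, LinearMap.restrictScalars_apply, mulUnit,
    ← mulMap_mul_ofU, UniversalEnvelopingAlgebra.unit, ofU_ι, sub_add_cancel]
  rfl

theorem uCubic_pow_mul_mulMap (m : ℕ) (n : ℕ𝔘) :
    uCubic k ^ m * mm n = mm ((cubicMap k ^ m) n) := by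
  induction m with
  | zero => simp
  | succ m ih => rw [pow_succ', mul_assoc, ih, uCubic_mul_mulMap, pow_succ', Module.End.mul_apply]

theorem commV_of_mem_center {n : ℕ𝔘} (hn : mm n ∈ Subalgebra.center k (UV k)) : CommV n := by
  rw [Subalgebra.mem_center_iff] at hn
  constructor
  · intro j
    have h := mulMap_mul_uVec (stdBasis k) LieHom.id (vec k) lie_vec n j
    rw [hn, sub_self, ← map_zero mm] at h
    have h' := mulMap_injective _ h
    simp only [← stdBasis_inl, linPoly_basis] at h'
    exact h'.symm
  · intro j
    have h := mulMap_mul_uVec (stdBasis k) (dualRep k (Fin 2)) (covec k) lie_covec n j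
    rw [hn, sub_self, ← map_zero mm] at h
    have h' := mulMap_injective _ h
    simp only [← stdBasis_inr, linPoly_basis] at h'
    exact h'.symm

/-- The top part of a central element is t C^m with t in S(V). Since the element and C commute with
gl_2, t is invariant and hence a polynomial in the pairing. -/
theorem exists_leading_term_of_mem_center [CharZero k] {m : ℕ} {n : ℕ𝔘}
    (hn : mm n ∈ Subalgebra.center k (UV k)) (hm : n ∈ tfilt k (m + 1)) :
    ∃ p : Polynomial k, ∃ n' ∈ tfilt k m,
      mm n' = (m.factorial : UV k) * mm n - uCubic k ^ m * Polynomial.aeval (uQuad k) p := by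
  obtain ⟨t, ht⟩ := (commV_of_mem_center hn).exists_factorial_smul hm
  set n' := (m.factorial : 𝔖) • n - (cubicMap k ^ m) (t ⊗ₜ[k] (1 : 𝔘)) with hn'
  have hn'm : n' ∈ tfilt k m := by
    have h := sub_mem ht (cubicMap_pow_sub_mem t m)
    rwa [sub_sub_sub_cancel_right] at h
  have e1 : mm n' = (m.factorial : UV k) * mm n - uCubic k ^ m * ofPoly (stdBasis k) t := by
    rw [hn', map_sub, ← ofPoly_mul_mulMap, map_natCast, ← uCubic_pow_mul_mulMap, mulMap_tmul_one]
  have hinv : ∀ A : Gl2 k, der (stdBasis k) A t = 0 := by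
    intro A
    have hC : Commute (uLie k A) (uCubic k ^ m) :=
      Subalgebra.mem_center_iff.1 (pow_mem uCubic_mem_center m) _
    have hz : Commute (uLie k A) ((m.factorial : UV k) * mm n) :=
      Commute.mul_right (Nat.cast_commute _ _).symm (Subalgebra.mem_center_iff.1 hn _)
    have e2 := mulMap_bracketMap A n'
    -- Bracketing the remainder with A kills both the central element and the powers of C, and
    -- leaves C^m times the derivative of t. The remainder has lower degree, so that derivative is
    -- zero.
    have e3 : uLie k A * mm n' - mm n' * uLie k A =
        -mm ((cubicMap k ^ m) (der (stdBasis k) A t ⊗ₜ[k] (1 : 𝔘))) := by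
      rw [← uCubic_pow_mul_mulMap, ← bracketMap_tmul_one, mulMap_bracketMap, mulMap_tmul_one, e1,
        mul_sub, sub_mul, hz.eq, ← mul_assoc, hC.eq, mul_sub]
      simp only [mul_assoc]
      abel
    rw [e3, ← map_neg] at e2
    have h := mulMap_injective _ e2
    refine eq_zero_of_cubicMap_pow_mem (m := m) ?_
    rw [← neg_mem_iff, ← h]
    exact bracketMap_mem A hn'm
  obtain ⟨p, rfl⟩ := exists_aeval_quadPoly_of_invariant hinv
  refine ⟨p, n', hn'm, ?_⟩
  rw [e1, ← Polynomial.aeval_algHom_apply, ofPoly_quadPoly]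

variable (k) in
/-- The homomorphism from the polynomial algebra to the centre given by the quadratic and the cubic
central elements. -/
def toCenter : MvPolynomial (Fin 2) k →ₐ[k] Subalgebra.center k (UV k) :=
  MvPolynomial.aeval ![⟨uQuad k, uQuad_mem_center⟩, ⟨uCubic k, uCubic_mem_center⟩]

theorem toCenter_surjective [CharZero k] : Function.Surjective (toCenter k) := by
  have h : ∀ (m : ℕ) (z : Subalgebra.center k (UV k)) (n : ℕ𝔘), mm n = z → n ∈ tfilt k m →
      z ∈ (toCenter k).range := by
    intro m
    induction m with
    | zero =>
      intro z n hz hn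
      rw [tfilt_zero.1 hn, map_zero] at hz
      rw [show z = 0 from Subtype.ext hz.symm]
      exact zero_mem _
    | succ m ih =>
      intro z n hz hn
      obtain ⟨p, n', hn', e⟩ := exists_leading_term_of_mem_center (by rw [hz]; exact z.2) hn
      set q : MvPolynomial (Fin 2) k := X 1 ^ m * Polynomial.aeval (X 0) p with hq
      have hq' : ((toCenter k q : Subalgebra.center k (UV k)) : UV k) =
          uCubic k ^ m * Polynomial.aeval (uQuad k) p := by
        rw [hq, map_mul, map_pow, ← Polynomial.aeval_algHom_apply]
        have h1 : toCenter k (X 1) = ⟨uCubic k, uCubic_mem_center⟩ := by simp [toCenter]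
        have h0 : toCenter k (X 0) = ⟨uQuad k, uQuad_mem_center⟩ := by simp [toCenter]
        rw [h0, h1, MulMemClass.coe_mul, SubmonoidClass.coe_pow]
        congr 1
        exact (Polynomial.aeval_algHom_apply (Subalgebra.center k (UV k)).val _ p).symm
      have h1 : (m.factorial : Subalgebra.center k (UV k)) * z - toCenter k q ∈ (toCenter k).range := by
        refine ih _ n' ?_ hn'
        rw [e, hz, ← hq']
        rfl
      have h2 := add_mem h1 (⟨q, rfl⟩ : toCenter k q ∈ (toCenter k).range)
      rw [sub_add_cancel] at h2
      -- The descent controls m! z; characteristic zero allows division by m!.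
      have h3 := Subalgebra.smul_mem _ h2 ((m.factorial : k)⁻¹)
      have hfac : (m.factorial : k) ≠ 0 := by exact_mod_cast m.factorial_ne_zero
      rwa [← nsmul_eq_mul, ← Nat.cast_smul_eq_nsmul k, inv_smul_smul₀ hfac] at h3
  intro z
  obtain ⟨n, hn⟩ := mulMap_surjective (L := Gl2 k) (stdBasis k) z.1
  obtain ⟨m, hm⟩ := exists_mem_baseChange_filt n
  exact h _ z n hn hm

/-- Lower powers of C have lower degree, so the top power must have zero coefficient. The pairing
satisfies no polynomial relation because it restricts to a coordinate on a line. -/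
theorem eq_zero_of_sum_uCubic_pow [CharZero k] (q : Polynomial (Polynomial k))
    (h : ∑ j ∈ Finset.range (q.natDegree + 1),
      uCubic k ^ j * Polynomial.aeval (uQuad k) (q.coeff j) = 0) : q = 0 := by
  set m := q.natDegree with hm
  have e : ∀ p : Polynomial k, Polynomial.aeval (uQuad k) p =
      mm (Polynomial.aeval (quadPoly k) p ⊗ₜ[k] (1 : 𝔘)) := by
    intro p
    rw [mulMap_tmul_one, ← Polynomial.aeval_algHom_apply, ofPoly_quadPoly]
  simp only [e, uCubic_pow_mul_mulMap, ← map_sum] at h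
  rw [← map_zero mm] at h
  have h1 := mulMap_injective _ h
  rw [Finset.sum_range_succ] at h1
  have h2 : (cubicMap k ^ m) (Polynomial.aeval (quadPoly k) (q.coeff m) ⊗ₜ[k] (1 : 𝔘)) ∈ tfilt k m := by
    rw [eq_neg_of_add_eq_zero_right h1]
    exact neg_mem (sum_mem fun j hj => tfilt_mono (Finset.mem_range.1 hj) (cubicMap_pow_tmul_one_mem _ j))
  have h3 := congrArg (restrict k) (eq_zero_of_cubicMap_pow_mem h2)
  rw [restrict_aeval_quadPoly, map_zero] at h3
  exact Polynomial.leadingCoeff_eq_zero.1 h3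

theorem toCenter_injective [CharZero k] : Function.Injective (toCenter k) := by
  rw [injective_iff_map_eq_zero]
  intro p hp
  -- Polynomials in two variables are viewed as polynomials in C with coefficients in k[pairing], so
  -- that there is a leading coefficient in C.
  let g : MvPolynomial (Fin 2) k →ₐ[k] Polynomial (Polynomial k) :=
    MvPolynomial.aeval ![Polynomial.C Polynomial.X, Polynomial.X]
  let g' : Polynomial (Polynomial k) →+* MvPolynomial (Fin 2) k :=
    Polynomial.eval₂RingHom (Polynomial.aeval (X 0 : MvPolynomial (Fin 2) k)).toRingHom (X 1)
  let c : Polynomial (Polynomial k) →+* Subalgebra.center k (UV k) :=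
    Polynomial.eval₂RingHom (Polynomial.aeval
      (⟨uQuad k, uQuad_mem_center⟩ : Subalgebra.center k (UV k))).toRingHom
      ⟨uCubic k, uCubic_mem_center⟩
  have hg : ∀ p, g' (g p) = p := by
    intro p
    have : g'.comp g.toRingHom = RingHom.id _ := by
      refine MvPolynomial.ringHom_ext (fun r => ?_) (fun i => ?_)
      · simp [g, g', Polynomial.algebraMap_apply, MvPolynomial.algebraMap_eq]
      · fin_cases i <;> simp [g, g']
    exact congrArg (fun φ : MvPolynomial (Fin 2) k →+* MvPolynomial (Fin 2) k => φ p) this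
  have hc : ∀ p, c (g p) = toCenter k p := by
    intro p
    have : c.comp g.toRingHom = (toCenter k).toRingHom := by
      refine MvPolynomial.ringHom_ext (fun r => ?_) (fun i => ?_)
      · simp [g, c, toCenter, Polynomial.algebraMap_apply]
      · fin_cases i <;> simp [g, c, toCenter]
    exact congrArg (fun φ : MvPolynomial (Fin 2) k →+* Subalgebra.center k (UV k) => φ p) this
  have h0 : g p = 0 := by
    refine eq_zero_of_sum_uCubic_pow _ ?_
    have h1 := congrArg (Subalgebra.center k (UV k)).val ((hc p).trans hp)
    simp only [c, Polynomial.coe_eval₂RingHom, Polynomial.eval₂_eq_sum_range, map_sum, map_mul,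
      map_pow, map_zero] at h1
    rw [← h1]
    refine Finset.sum_congr rfl fun j _ => ?_
    rw [← (Subalgebra.mem_center_iff.1 (pow_mem uCubic_mem_center j) _)]
    congr 1
    exact Polynomial.aeval_algHom_apply (Subalgebra.center k (UV k)).val
      ⟨uQuad k, uQuad_mem_center⟩ ((g p).coeff j)
  rw [← hg p, h0, map_zero]

end Gl2Center
end


/-! ### Passage from the pairing and the cubic to b and d. -/

noncomputable section

namespace Gl2Center

open InfCherednik SemidirectPBW Gl2Relations
open MvPolynomial (X)

variable {k : Type*} [Field k]

theorem b_eq : b k = -uQuad k := by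
  have hx : x k = uv k 0 := congrArg (uVec k) (Prod.ext (by ext i; fin_cases i <;> rfl) rfl)
  have hy : y k = uv k 1 := congrArg (uVec k) (Prod.ext (by ext i; fin_cases i <;> rfl) rfl)
  have hx₁ : x₁ k = uw k 1 := rfl
  have hy₁ : y₁ k = -uw k 0 := by
    rw [uw, ← vecLin_apply, ← map_neg, vecLin_apply]
    exact congrArg (uVec k) (Prod.ext neg_zero.symm rfl)
  rw [b, hx, hy, hx₁, hy₁, uQuad, quad]
  noncomm_ring

theorem d_eq : d k = 2 * uCubic k := by
  have hx : x k = uv k 0 := congrArg (uVec k) (Prod.ext (by ext i; fin_cases i <;> rfl) rfl)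
  have hy : y k = uv k 1 := congrArg (uVec k) (Prod.ext (by ext i; fin_cases i <;> rfl) rfl)
  have hx₁ : x₁ k = uw k 1 := rfl
  have hy₁ : y₁ k = -uw k 0 := by
    rw [uw, ← vecLin_apply, ← map_neg, vecLin_apply]
    exact congrArg (uVec k) (Prod.ext neg_zero.symm rfl)
  have he : e k = uUnit k 0 1 :=
    congrArg (uLie k) (by ext i j; fin_cases i <;> fin_cases j <;> simp)
  have hf : f k = uUnit k 1 0 :=
    congrArg (uLie k) (by ext i j; fin_cases i <;> fin_cases j <;> simp)
  have hh : h k = uUnit k 0 0 - uUnit k 1 1 := by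
    simp only [h, uUnit, ← ofU_ι, ← map_sub]
    exact congrArg _ (congrArg _ (by ext i j; fin_cases i <;> fin_cases j <;> simp))
  have hτ : τ k = uUnit k 0 0 + uUnit k 1 1 := by
    simp only [τ, uUnit, ← ofU_ι, ← map_add]
    exact congrArg _ (congrArg _ (by ext i j; fin_cases i <;> fin_cases j <;> simp))
  rw [d, b, hx, hy, hx₁, hy₁, he, hf, hh, hτ, uCubic, cubic]
  noncomm_ring

theorem b_mem_center : b k ∈ Subalgebra.center k (UV k) := by
  rw [b_eq]
  exact neg_mem uQuad_mem_center

theorem d_mem_center : d k ∈ Subalgebra.center k (UV k) := by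
  rw [d_eq]
  exact mul_mem (ofNat_mem _ 2) uCubic_mem_center

variable (k) in
/-- The elements `b` and `d` of the centre of `U(gl_2 ⋉ V)`. -/
def centerGen : Fin 2 → Subalgebra.center k (UV k) :=
  ![⟨b k, b_mem_center⟩, ⟨d k, d_mem_center⟩]

theorem aeval_centerGen_bijective [CharZero k] :
    Function.Bijective (MvPolynomial.aeval (centerGen k) :
      MvPolynomial (Fin 2) k →ₐ[k] Subalgebra.center k (UV k)) := by
  -- The substitution matching b = -`uQuad` and d = 2 `uCubic`, invertible because 2 is.
  let s : MvPolynomial (Fin 2) k →ₐ[k] MvPolynomial (Fin 2) k :=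
    MvPolynomial.aeval ![-X 0, (2 : k) • X 1]
  let t : MvPolynomial (Fin 2) k →ₐ[k] MvPolynomial (Fin 2) k :=
    MvPolynomial.aeval ![-X 0, (2 : k)⁻¹ • X 1]
  have hst : s.comp t = AlgHom.id k _ := by
    refine MvPolynomial.algHom_ext fun i => ?_
    fin_cases i <;> simp [s, t]
  have hts : t.comp s = AlgHom.id k _ := by
    refine MvPolynomial.algHom_ext fun i => ?_
    fin_cases i <;> simp [s, t]
  have h : (MvPolynomial.aeval (centerGen k) :
      MvPolynomial (Fin 2) k →ₐ[k] Subalgebra.center k (UV k)) = (toCenter k).comp s := by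
    refine MvPolynomial.algHom_ext fun i => Subtype.ext ?_
    fin_cases i
    · simp [s, toCenter, centerGen, b_eq]
    · simp [s, toCenter, centerGen, d_eq]
      rfl
  rw [h, AlgHom.coe_comp]
  refine Function.Bijective.comp ⟨toCenter_injective, toCenter_surjective⟩ ?_
  exact Function.bijective_iff_has_inverse.2
    ⟨t, fun p => DFunLike.congr_fun hts p, fun p => DFunLike.congr_fun hst p⟩

end Gl2Center
end


/-! ### Lifting generators of the centre from the associated graded algebra. -/

noncomputable section

namespace FilteredCenter

open InfCherednik

variable {R A : Type*} [CommRing R] [Ring A] [Algebra R A] {F : Filtr R A}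

variable (F) in
/-- `a` lies in the step `F_n` of the filtration and has class `g` in degree `n` of the associated
graded algebra. -/
def HasSymbol (n : ℕ) (a : A) (g : F.Gr) : Prop :=
  ∃ ha : a ∈ F.toFun n, F.symbol n ⟨a, ha⟩ = g

theorem hasSymbol_symbol {n : ℕ} (a : F.toFun n) : HasSymbol F n a (F.symbol n a) := ⟨a.2, rfl⟩

theorem HasSymbol.unique {n : ℕ} {a : A} {g g' : F.Gr} (h : HasSymbol F n a g)
    (h' : HasSymbol F n a g') : g = g' := by
  obtain ⟨ha, rfl⟩ := h
  obtain ⟨_, rfl⟩ := h'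
  rfl

theorem HasSymbol.add {n : ℕ} {a a' : A} {g g' : F.Gr} (h : HasSymbol F n a g)
    (h' : HasSymbol F n a' g') : HasSymbol F n (a + a') (g + g') := by
  obtain ⟨ha, rfl⟩ := h
  obtain ⟨ha', rfl⟩ := h'
  exact ⟨add_mem ha ha', map_add (F.symbol n) ⟨a, ha⟩ ⟨a', ha'⟩⟩

theorem HasSymbol.smul {n : ℕ} {a : A} {g : F.Gr} (h : HasSymbol F n a g) (r : R) :
    HasSymbol F n (r • a) (r • g) := by
  obtain ⟨ha, rfl⟩ := h
  exact ⟨Submodule.smul_mem _ r ha, map_smul (F.symbol n) r ⟨a, ha⟩⟩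

theorem HasSymbol.neg {n : ℕ} {a : A} {g : F.Gr} (h : HasSymbol F n a g) :
    HasSymbol F n (-a) (-g) := by
  obtain ⟨ha, rfl⟩ := h
  exact ⟨neg_mem ha, map_neg (F.symbol n) ⟨a, ha⟩⟩

theorem HasSymbol.sub {n : ℕ} {a a' : A} {g g' : F.Gr} (h : HasSymbol F n a g)
    (h' : HasSymbol F n a' g') : HasSymbol F n (a - a') (g - g') := by
  rw [sub_eq_add_neg, sub_eq_add_neg]
  exact h.add h'.neg

theorem HasSymbol.mul {n n' : ℕ} {a a' : A} {g g' : F.Gr} (h : HasSymbol F n a g)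
    (h' : HasSymbol F n' a' g') : HasSymbol F (n + n') (a * a') (g * g') := by
  obtain ⟨ha, rfl⟩ := h
  obtain ⟨ha', rfl⟩ := h'
  exact ⟨F.mul_mem ha ha', (F.symbol_mul ⟨a, ha⟩ ⟨a', ha'⟩).symm⟩

variable (F) in
theorem hasSymbol_zero (n : ℕ) : HasSymbol F n 0 0 := ⟨zero_mem _, map_zero (F.symbol n)⟩

variable (F) in
theorem hasSymbol_one : HasSymbol F 0 1 1 := ⟨F.one_mem, rfl⟩

variable (F) in
theorem hasSymbol_algebraMap (r : R) : HasSymbol F 0 (algebraMap R A r) (algebraMap R F.Gr r) := by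
  rw [Algebra.algebraMap_eq_smul_one, Algebra.algebraMap_eq_smul_one]
  exact (hasSymbol_one F).smul r

theorem HasSymbol.sum {ι : Type*} {s : Finset ι} {n : ℕ} {a : ι → A} {g : ι → F.Gr}
    (h : ∀ i ∈ s, HasSymbol F n (a i) (g i)) : HasSymbol F n (∑ i ∈ s, a i) (∑ i ∈ s, g i) := by
  classical
  induction s using Finset.induction_on with
  | empty => exact hasSymbol_zero F n
  | insert i s hi ih =>
    rw [Finset.sum_insert hi, Finset.sum_insert hi]
    exact (h i (Finset.mem_insert_self i s)).add (ih fun j hj => h j (Finset.mem_insert_of_mem hj))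

theorem HasSymbol.pow {n : ℕ} {a : A} {g : F.Gr} (h : HasSymbol F n a g) (m : ℕ) :
    HasSymbol F (m * n) (a ^ m) (g ^ m) := by
  induction m with
  | zero => simpa using hasSymbol_one F
  | succ m ih =>
    rw [pow_succ, pow_succ, Nat.succ_mul]
    exact ih.mul h

theorem hasSymbol_zero_iff {n : ℕ} {a : A} : HasSymbol F n a 0 ↔ a ∈ F.lt n := by
  constructor
  · rintro ⟨ha, h⟩
    have h' := DirectSum.of_injective (β := F.Piece) n (h.trans (map_zero (F.symbol n)).symm)
    have := F.proj_eq_proj.1 h'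
    simpa using this
  · intro h
    have ha : a ∈ F.toFun n := by
      cases n with
      | zero => rw [show a = 0 from h]; exact zero_mem _
      | succ n => exact F.mono (Nat.le_succ n) h
    exact ⟨ha, (F.symbol_eq rfl ⟨a, ha⟩ 0 (by simpa using h)).trans (map_zero _)⟩

theorem HasSymbol.eq_zero_of_sum_eq_zero {s : Finset ℕ} {a : ℕ → A} {g : ℕ → F.Gr}
    (h : ∀ n ∈ s, HasSymbol F n (a n) (g n)) (h0 : ∑ n ∈ s, g n = 0) {n : ℕ} (hn : n ∈ s) :
    g n = 0 := by
  have hc : ∀ m ∈ s, m ≠ n → DirectSum.component R ℕ F.Piece n (g m) = 0 := by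
    intro m hm hmn
    obtain ⟨ha, e⟩ := h m hm
    rw [← e]
    exact (DirectSum.component.of R (M := F.Piece) n m (F.proj m ⟨a m, ha⟩)).trans (dif_neg hmn)
  have h1 : DirectSum.component R ℕ F.Piece n (g n) = 0 := by
    rw [← Finset.sum_eq_single_of_mem (f := fun m => DirectSum.component R ℕ F.Piece n (g m)) n hn hc]
    exact (map_sum (DirectSum.component R ℕ F.Piece n) g s).symm.trans
      ((congrArg (DirectSum.component R ℕ F.Piece n) h0).trans (map_zero _))
  obtain ⟨ha, e⟩ := h n hn
  rw [← e] at h1 ⊢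
  have h2 : F.proj n ⟨a n, ha⟩ = 0 :=
    (DirectSum.component.lof_self R (M := F.Piece) n (F.proj n ⟨a n, ha⟩)).symm.trans h1
  exact (congrArg (DirectSum.lof R ℕ F.Piece n) h2).trans (map_zero _)

/-- It is enough to commute with homogeneous elements, each of which is a symbol; both products are
symbols of the same element of A. -/
theorem HasSymbol.mem_center {n : ℕ} {a : A} {g : F.Gr} (h : HasSymbol F n a g)
    (ha : a ∈ Subalgebra.center R A) : g ∈ Subalgebra.center R F.Gr := by
  rw [Subalgebra.mem_center_iff] at ha ⊢
  intro y
  induction y using DirectSum.induction_on with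
  | zero => exact (zero_mul g).trans (mul_zero g).symm
  | of m p =>
    obtain ⟨c, rfl⟩ := F.proj_surj p
    have h1 := (hasSymbol_symbol c).mul h
    have h2 := h.mul (hasSymbol_symbol c)
    rw [ha, add_comm] at h1
    exact h1.unique h2
  | add y y' hy hy' => exact (add_mul y y' g).trans ((congrArg₂ _ hy hy').trans (mul_add g y y').symm)

section Generators

variable {σ : Type*} {w : σ → ℕ} {z : σ → Subalgebra.center R A} {g : σ → Subalgebra.center R F.Gr}
  (hz : ∀ i, HasSymbol F (w i) (z i) (g i))

include hz

theorem hasSymbol_aeval {n : ℕ} {p : MvPolynomial σ R} (hp : p.IsWeightedHomogeneous w n) :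
    HasSymbol F n (MvPolynomial.aeval z p : Subalgebra.center R A)
      (MvPolynomial.aeval g p : Subalgebra.center R F.Gr) := by
  have hprod : ∀ (m : σ →₀ ℕ) (s : Finset σ), HasSymbol F (∑ i ∈ s, m i * w i)
      (∏ i ∈ s, z i ^ m i : Subalgebra.center R A)
      (∏ i ∈ s, g i ^ m i : Subalgebra.center R F.Gr) := by
    classical
    intro m s
    induction s using Finset.induction_on with
    | empty => exact hasSymbol_one F
    | insert i s hi ih =>
      rw [Finset.prod_insert hi, Finset.prod_insert hi, Finset.sum_insert hi]
      exact ((hz i).pow (m i)).mul ih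
  rw [p.as_sum, map_sum, map_sum, AddSubmonoidClass.coe_finsetSum,
    AddSubmonoidClass.coe_finsetSum]
  refine HasSymbol.sum fun m hm => ?_
  have hw : ∑ i ∈ m.support, m i * w i = n := by
    rw [← hp (MvPolynomial.mem_support_iff.1 hm), Finsupp.weight_apply]
    rfl
  rw [MvPolynomial.aeval_monomial, MvPolynomial.aeval_monomial, ← hw, ← zero_add (Finset.sum _ _)]
  exact (hasSymbol_algebraMap F _).mul (hprod m _)

theorem eq_zero_of_aeval_mem_lt (hg : Function.Injective (MvPolynomial.aeval (R := R) g))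
    {n : ℕ} {p : MvPolynomial σ R} (hp : p.IsWeightedHomogeneous w n)
    (h : ((MvPolynomial.aeval z p : Subalgebra.center R A) : A) ∈ F.lt n) : p = 0 := by
  refine hg (Subtype.ext ?_)
  rw [map_zero]
  exact (hasSymbol_aeval hz hp).unique (hasSymbol_zero_iff.2 h)

omit hz in
theorem exists_sum_weightedHomogeneousComponent_eq (w : σ → ℕ) (p : MvPolynomial σ R) :
    ∃ N₀, ∀ N ≥ N₀, ∑ n ∈ Finset.range N, MvPolynomial.weightedHomogeneousComponent w n p = p := by
  refine ⟨MvPolynomial.weightedTotalDegree w p + 1, fun N hN => ?_⟩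
  conv_rhs => rw [← MvPolynomial.sum_weightedHomogeneousComponent w p]
  refine (finsum_eq_sum_of_support_subset _ fun n hn => ?_).symm
  simp only [Finset.coe_range, Set.mem_Iio]
  by_contra hn'
  exact hn (MvPolynomial.weightedHomogeneousComponent_eq_zero _ _ (by omega))

/-- In a relation among the z_i, the top weighted-homogeneous component has the same relation as its
symbol, so it vanishes by independence of the g_i; then the weight descends. -/
theorem aeval_injective (hg : Function.Injective (MvPolynomial.aeval (R := R) g)) :
    Function.Injective (MvPolynomial.aeval (R := R) z) := by
  have key : ∀ (N : ℕ) (q : ℕ → MvPolynomial σ R), (∀ n, (q n).IsWeightedHomogeneous w n) →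
      MvPolynomial.aeval z (∑ n ∈ Finset.range N, q n) = 0 → ∀ n ∈ Finset.range N, q n = 0 := by
    intro N
    induction N with
    | zero => simp
    | succ N ih =>
      intro q hq h
      rw [Finset.sum_range_succ, map_add] at h
      have hN : q N = 0 := by
        refine eq_zero_of_aeval_mem_lt hz hg (hq N) ?_
        rw [eq_neg_of_add_eq_zero_right h, map_sum]
        rw [NegMemClass.coe_neg, AddSubmonoidClass.coe_finsetSum]
        refine neg_mem (sum_mem fun n hn => ?_)
        obtain ⟨m, rfl⟩ := Nat.exists_eq_add_of_lt (Finset.mem_range.1 hn)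
        exact F.mono (Nat.le_add_right n m) (hasSymbol_aeval hz (hq n)).1
      rw [hN, map_zero, add_zero] at h
      intro n hn
      rcases (Nat.lt_succ_iff_lt_or_eq.1 (Finset.mem_range.1 hn)) with hn | rfl
      · exact ih q hq h n (Finset.mem_range.2 hn)
      · exact hN
  rw [injective_iff_map_eq_zero]
  intro p hp
  obtain ⟨N, hN⟩ := exists_sum_weightedHomogeneousComponent_eq w p
  rw [← hN N le_rfl] at hp ⊢
  exact Finset.sum_eq_zero (key N _
    (fun n => MvPolynomial.weightedHomogeneousComponent_isWeightedHomogeneous n p) hp)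

theorem exists_isWeightedHomogeneous_of_hasSymbol
    (hg : Function.Surjective (MvPolynomial.aeval (R := R) g)) {n : ℕ} {a : A} {y : F.Gr}
    (h : HasSymbol F n a y) (hy : y ∈ Subalgebra.center R F.Gr) :
    ∃ q : MvPolynomial σ R, q.IsWeightedHomogeneous w n ∧
      (MvPolynomial.aeval g q : Subalgebra.center R F.Gr) = y := by
  obtain ⟨p, hp⟩ := hg ⟨y, hy⟩
  obtain ⟨N, hN⟩ := exists_sum_weightedHomogeneousComponent_eq w p
  have hq := fun m =>
    MvPolynomial.weightedHomogeneousComponent_isWeightedHomogeneous (w := w) m p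
  refine ⟨_, hq n, ?_⟩
  -- The range must contain n even when p has no component of weight n.
  have hn : n ∈ Finset.range (max N (n + 1)) :=
    Finset.mem_range.2 (lt_of_lt_of_le n.lt_succ_self (le_max_right _ _))
  have h1 : ∀ m ∈ Finset.range (max N (n + 1)), HasSymbol F m
      ((MvPolynomial.aeval z (MvPolynomial.weightedHomogeneousComponent w m p) :
        Subalgebra.center R A) - if m = n then a else 0)
      ((MvPolynomial.aeval g (MvPolynomial.weightedHomogeneousComponent w m p) :
        Subalgebra.center R F.Gr) - if m = n then y else 0) := by
    intro m _
    refine (hasSymbol_aeval hz (hq m)).sub ?_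
    split_ifs with hm
    · rwa [hm]
    · exact hasSymbol_zero F m
  have h2 := HasSymbol.eq_zero_of_sum_eq_zero h1 (by
    rw [Finset.sum_sub_distrib, Finset.sum_ite_eq' _ _ (fun _ => y), if_pos hn,
      ← AddSubmonoidClass.coe_finsetSum, ← map_sum, hN _ (le_max_left _ _), hp, sub_self]) hn
  rw [if_pos rfl] at h2
  exact sub_eq_zero.1 h2

/-- The symbol of a central element is central, so it is a weighted-homogeneous polynomial in the
g_i. Subtracting the same polynomial in the z_i lowers the filtration degree. -/
theorem aeval_surjective (hg : Function.Surjective (MvPolynomial.aeval (R := R) g))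
    (hF : ∀ a, ∃ n, a ∈ F.toFun n) : Function.Surjective (MvPolynomial.aeval (R := R) z) := by
  have key : ∀ (n : ℕ) (c : Subalgebra.center R A), (c : A) ∈ F.lt n →
      c ∈ (MvPolynomial.aeval (R := R) z).range := by
    intro n
    induction n with
    | zero =>
      intro c hc
      rw [show c = 0 from Subtype.ext hc]
      exact zero_mem _
    | succ n ih =>
      intro c hc
      have hs : HasSymbol F n c (F.symbol n ⟨c, hc⟩) := ⟨hc, rfl⟩
      obtain ⟨q, hq, e⟩ :=
        exists_isWeightedHomogeneous_of_hasSymbol hz hg hs (hs.mem_center c.2)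
      have h := hs.sub (hasSymbol_aeval hz hq)
      rw [e, sub_self] at h
      have h1 := add_mem (ih (c - MvPolynomial.aeval z q) (hasSymbol_zero_iff.1 h))
        (⟨q, rfl⟩ : MvPolynomial.aeval z q ∈ (MvPolynomial.aeval (R := R) z).range)
      rwa [sub_add_cancel] at h1
  intro c
  obtain ⟨n, hn⟩ := hF c
  exact key (n + 1) c hn

/-- Symbols of central elements are central; conversely, a polynomial in the g_i is a sum of symbols
of the corresponding homogeneous polynomials in the central z_i. -/
theorem grSub_center (hg : Function.Surjective (MvPolynomial.aeval (R := R) g)) :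
    F.grSub (Subalgebra.toSubmodule (Subalgebra.center R A)) =
      Subalgebra.toSubmodule (Subalgebra.center R F.Gr) := by
  refine le_antisymm (iSup_le fun n => ?_) fun y hy => ?_
  · rw [Submodule.map_le_iff_le_comap]
    exact fun a ha => (hasSymbol_symbol a).mem_center ha
  · obtain ⟨p, hp⟩ := hg ⟨y, hy⟩
    obtain ⟨N, hN⟩ := exists_sum_weightedHomogeneousComponent_eq w p
    have hy' : y = (MvPolynomial.aeval g p : Subalgebra.center R F.Gr) := by rw [hp]
    rw [hy', ← hN N le_rfl, map_sum, AddSubmonoidClass.coe_finsetSum]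
    refine sum_mem fun n _ => Submodule.mem_iSup_of_mem n ?_
    obtain ⟨ha, e⟩ := hasSymbol_aeval hz
      (MvPolynomial.weightedHomogeneousComponent_isWeightedHomogeneous (w := w) n p)
    exact ⟨⟨_, ha⟩, Subtype.prop (MvPolynomial.aeval z _), e⟩

end Generators

end FilteredCenter
end


/-! ### Generators, symbols and PBW independence in H_γ. -/

noncomputable section

namespace HeckeCenter

open InfCherednik SemidirectPBW UniversalEnvelopingAlgebra TensorProduct FilteredCenter

/-! ### Generation and symbols in `H_γ` -/

section General

variable {k L M : Type*} [CommRing k] [LieRing L] [LieAlgebra k L]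
  [AddCommGroup M] [Module k M] [LieRingModule L M]
  {γ : M →ₗ[k] M →ₗ[k] UniversalEnvelopingAlgebra k L}

theorem induct {P : Hecke γ → Prop} (hC : ∀ r : k, P (algebraMap k (Hecke γ) r))
    (hL : ∀ a : L, P (Hecke.ofU γ (ι k a))) (hM : ∀ m : M, P (Hecke.ofV γ m))
    (hadd : ∀ u v, P u → P v → P (u + v)) (hmul : ∀ u v, P u → P v → P (u * v)) (u : Hecke γ) :
    P u := by
  obtain ⟨u, rfl⟩ := RingQuot.mkAlgHom_surjective k (HeckeRel γ) u
  obtain ⟨u, rfl⟩ := RingQuot.mkAlgHom_surjective k (SmashRel k L M) u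
  change P (Hecke.mk γ (Smash.mk k L M u))
  induction u using TensorAlgebra.induction with
  | algebraMap r =>
    rw [AlgHom.commutes, AlgHom.commutes]
    exact hC r
  | ι p =>
    obtain ⟨a, m⟩ := p
    have h : Hecke.mk γ (Smash.mk k L M (TensorAlgebra.ι k (a, m))) =
        Hecke.ofU γ (ι k a) + Hecke.ofV γ m := by
      have h1 : Hecke.ofU γ (ι k a) = Hecke.mk γ (Smash.mk k L M (TensorAlgebra.ι k (a, (0 : M)))) :=
        congrArg (Hecke.mk γ) (UniversalEnvelopingAlgebra.lift_ι_apply k _ a)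
      have h2 : Hecke.ofV γ m = Hecke.mk γ (Smash.mk k L M (TensorAlgebra.ι k ((0 : L), m))) := rfl
      rw [h1, h2, ← map_add, ← map_add, ← map_add, Prod.mk_add_mk, add_zero, zero_add]
    rw [h]
    exact hadd _ _ (hL a) (hM m)
  | mul u v hu hv => rw [map_mul, map_mul]; exact hmul _ _ hu hv
  | add u v hu hv => rw [map_add, map_add]; exact hadd _ _ hu hv

theorem exists_mem_filtr (u : Hecke γ) : ∃ n, u ∈ (Hecke.filtr γ).toFun n := by
  induction u using induct with
  | hC r => exact ⟨0, (hasSymbol_algebraMap _ r).1⟩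
  | hL a => exact ⟨0, Hecke.ofU_mem γ _⟩
  | hM m => exact ⟨1, Hecke.ofV_mem γ m⟩
  | hadd u v hu hv =>
    obtain ⟨m, hm⟩ := hu
    obtain ⟨n, hn⟩ := hv
    exact ⟨max m n, add_mem ((Hecke.filtr γ).mono (le_max_left m n) hm)
      ((Hecke.filtr γ).mono (le_max_right m n) hn)⟩
  | hmul u v hu hv =>
    obtain ⟨m, hm⟩ := hu
    obtain ⟨n, hn⟩ := hv
    exact ⟨m + n, (Hecke.filtr γ).mul_mem hm hn⟩

variable [LieModule k L M]

theorem hasSymbol_ofV (m : M) :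
    HasSymbol (Hecke.filtr γ) 1 (Hecke.ofV γ m) (Hecke.natMap γ (uVec k m)) := by
  refine ⟨Hecke.ofV_mem γ m, ?_⟩
  rw [uVec, Hecke.natMap, UniversalEnvelopingAlgebra.lift_ι_apply]
  change _ = Hecke.cls0 γ 0 + Hecke.cls1 γ m
  rw [map_zero, zero_add]
  rfl

theorem hasSymbol_ofU (u : UniversalEnvelopingAlgebra k L) :
    HasSymbol (Hecke.filtr γ) 0 (Hecke.ofU γ u) (Hecke.natMap γ (ofU k L M u)) := by
  induction u using UniversalEnvelopingAlgebra.induct with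
  | hC r =>
    rw [AlgHom.commutes, AlgHom.commutes, AlgHom.commutes]
    exact hasSymbol_algebraMap _ r
  | hι a =>
    refine ⟨Hecke.ofU_mem γ _, ?_⟩
    rw [ofU_ι, uLie, Hecke.natMap, UniversalEnvelopingAlgebra.lift_ι_apply]
    change _ = Hecke.cls0 γ a + Hecke.cls1 γ 0
    rw [map_zero, add_zero]
    rfl
  | hadd u v hu hv =>
    have h := hu.add hv
    rw [← map_add (Hecke.ofU γ), ← map_add (Hecke.natMap γ), ← map_add (ofU k L M)] at h
    exact h
  | hmul u v hu hv =>
    have h := hu.mul hv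
    rw [← map_mul (Hecke.ofU γ), ← map_mul (Hecke.natMap γ), ← map_mul (ofU k L M)] at h
    exact h

end General

/-! ### Independence of monomials -/

section Independence

variable {k L M σ : Type*} [Field k] [LieRing L] [LieAlgebra k L]
  [AddCommGroup M] [Module k M] [LieRingModule L M] [LieModule k L M] (B : Module.Basis σ k M)
  {γ : M →ₗ[k] M →ₗ[k] UniversalEnvelopingAlgebra k L}

theorem eq_zero_of_sum_monomial_tmul_eq_zero {ι : Type*} {s : Finset ι} {m : ι → σ →₀ ℕ}
    (hm : Function.Injective m) {u : ι → UniversalEnvelopingAlgebra k L}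
    (h : ∑ i ∈ s, MvPolynomial.monomial (m i) (1 : k) ⊗ₜ[k] u i = 0) {i : ι} (hi : i ∈ s) :
    u i = 0 := by
  classical
  have h1 := congrArg (fun t => TensorProduct.lid k _
    ((MvPolynomial.lcoeff k (m i)).rTensor (UniversalEnvelopingAlgebra k L) t)) h
  simp only [map_sum, map_zero, LinearMap.rTensor_tmul, TensorProduct.lid_tmul,
    MvPolynomial.lcoeff_apply, MvPolynomial.coeff_monomial, hm.eq_iff, ite_smul, one_smul, zero_smul,
    Finset.sum_ite_eq', hi, if_true] at h1
  exact h1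

variable (hγ : Function.Injective (Hecke.natMap γ))

include hγ

/-- Pass to symbols of degree one, pull back along the injective `natMap`, and compare coefficients
in S(M) ⊗ U(L). This is what allows the coefficients of a bracket to be read off. -/
theorem eq_zero_of_sum_ofV_mul_ofU {n : Type*} [Fintype n] {c : n → σ} (hc : Function.Injective c)
    {u : n → UniversalEnvelopingAlgebra k L}
    (h : ∑ i, Hecke.ofV γ (B (c i)) * Hecke.ofU γ (u i) = 0) (i : n) : u i = 0 := by
  have h1 : HasSymbol (Hecke.filtr γ) 1 (∑ i, Hecke.ofV γ (B (c i)) * Hecke.ofU γ (u i))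
      (∑ i, Hecke.natMap γ (uVec k (B (c i))) * Hecke.natMap γ (ofU k L M (u i))) :=
    HasSymbol.sum fun i _ => HasSymbol.mul (n := 1) (n' := 0) (hasSymbol_ofV (γ := γ) (B (c i)))
      (hasSymbol_ofU (γ := γ) (u i))
  rw [h] at h1
  have h2 := h1.unique (hasSymbol_zero _ 1)
  simp only [← map_mul, ← map_sum] at h2
  rw [← map_zero (Hecke.natMap γ)] at h2
  have h3 : mulMap B (∑ i, MvPolynomial.X (c i) ⊗ₜ[k] u i) = 0 := by
    rw [← hγ h2, map_sum]
    exact Finset.sum_congr rfl fun i _ => by rw [mulMap_tmul, ofPoly_X]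
  rw [← map_zero (mulMap B)] at h3
  exact eq_zero_of_sum_monomial_tmul_eq_zero (m := fun i => Finsupp.single (c i) 1)
    ((Finsupp.single_left_injective one_ne_zero).comp hc) (mulMap_injective B h3) (Finset.mem_univ i)

theorem eq_zero_of_sum_ofV_mul_ofV_mul_ofU {n n' : Type*} [Fintype n] [Fintype n'] {c : n → σ}
    {c' : n' → σ} (hc : Function.Injective c) (hc' : Function.Injective c')
    (hcc : ∀ i j, c i ≠ c' j) {u : n → n' → UniversalEnvelopingAlgebra k L}
    (h : ∑ i, ∑ j, Hecke.ofV γ (B (c i)) * Hecke.ofV γ (B (c' j)) * Hecke.ofU γ (u i j) ∈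
      (Hecke.filtr γ).toFun 1) (i : n) (j : n') : u i j = 0 := by
  have h1 : HasSymbol (Hecke.filtr γ) 2
      (∑ i, ∑ j, Hecke.ofV γ (B (c i)) * Hecke.ofV γ (B (c' j)) * Hecke.ofU γ (u i j))
      (∑ i, ∑ j, Hecke.natMap γ (uVec k (B (c i))) * Hecke.natMap γ (uVec k (B (c' j))) *
        Hecke.natMap γ (ofU k L M (u i j))) :=
    HasSymbol.sum fun i _ => HasSymbol.sum fun j _ =>
      HasSymbol.mul (n := 2) (n' := 0) (HasSymbol.mul (n := 1) (n' := 1)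
        (hasSymbol_ofV (γ := γ) (B (c i))) (hasSymbol_ofV (γ := γ) (B (c' j))))
        (hasSymbol_ofU (γ := γ) (u i j))
  have h2 := h1.unique (hasSymbol_zero_iff.2 h)
  simp only [← map_mul, ← map_sum] at h2
  rw [← map_zero (Hecke.natMap γ)] at h2
  have h3 : mulMap B (∑ p : n × n', MvPolynomial.monomial
      (Finsupp.single (c p.1) 1 + Finsupp.single (c' p.2) 1) (1 : k) ⊗ₜ[k] u p.1 p.2) = 0 := by
    rw [← hγ h2, map_sum, Fintype.sum_prod_type]
    refine Finset.sum_congr rfl fun i _ => Finset.sum_congr rfl fun j _ => ?_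
    rw [mulMap_tmul, ← one_mul (1 : k), ← MvPolynomial.monomial_mul, map_mul]
    congr 2 <;> exact ofPoly_X _ _
  rw [← map_zero (mulMap B)] at h3
  refine eq_zero_of_sum_monomial_tmul_eq_zero
    (m := fun p : n × n' => Finsupp.single (c p.1) 1 + Finsupp.single (c' p.2) 1)
    ?_ (mulMap_injective B h3) (i := (i, j)) (Finset.mem_univ _)
  -- Since c and c' have disjoint images, the exponent of the monomial determines i and j.
  classical
  rintro ⟨i, j⟩ ⟨i', j'⟩ e
  have e1 := DFunLike.congr_fun e (c i)
  have e2 := DFunLike.congr_fun e (c' j)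
  simp only [Finsupp.add_apply, Finsupp.single_apply, if_true, (hcc _ _).symm, if_false, hcc] at e1 e2
  refine Prod.ext (hc ?_) (hc' ?_)
  · by_contra hne
    simp [Ne.symm hne] at e1
  · by_contra hne
    simp [Ne.symm hne] at e2

end Independence

end HeckeCenter
end


/-! ### Correcting an element of H_γ to a central one. -/

noncomputable section

namespace HeckeCenter

open InfCherednik SemidirectPBW UniversalEnvelopingAlgebra FilteredCenter Gl2Relations Gl2Center

variable {k : Type*} [Field k] {γ : V k →ₗ[k] V k →ₗ[k] UniversalEnvelopingAlgebra k (Gl2 k)}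

local notation "𝔘" => UniversalEnvelopingAlgebra k (Gl2 k)

variable (γ) in
/-- The matrix units in `H_γ`. -/
def hUnit (i j : Fin 2) : Hecke γ := Hecke.ofU γ (unit k i j)

variable (γ) in
/-- The basis of `k²` in `H_γ`. -/
def hv (i : Fin 2) : Hecke γ := Hecke.ofV γ (vec k i)

variable (γ) in
/-- The basis of `(k²)*` in `H_γ`. -/
def hw (i : Fin 2) : Hecke γ := Hecke.ofV γ (covec k i)

theorem ofU_ι_mul_hv (A : Gl2 k) (l : Fin 2) : Hecke.ofU γ (ι k A) * hv γ l =
    hv γ l * Hecke.ofU γ (ι k A) + ∑ i, (LieHom.id : Gl2 k →ₗ⁅k⁆ Gl2 k) A i l • hv γ i := by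
  rw [hv, Hecke.act, lie_vec, map_sum]
  simp only [map_smul]
  rfl

theorem ofU_ι_mul_hw (A : Gl2 k) (l : Fin 2) : Hecke.ofU γ (ι k A) * hw γ l =
    hw γ l * Hecke.ofU γ (ι k A) + ∑ i, dualRep k (Fin 2) A i l • hw γ i := by
  rw [hw, Hecke.act, lie_covec, map_sum]
  simp only [map_smul]
  rfl

theorem hw_commutator_hv (i j : Fin 2) :
    hw γ i * hv γ j - hv γ j * hw γ i = Hecke.ofU γ (γ (covec k i) (vec k j)) := by
  rw [hw, hv, Hecke.ofV_comm, add_sub_cancel_left]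

theorem hv_commutator_hw (i j : Fin 2) :
    hv γ i * hw γ j - hw γ j * hv γ i = Hecke.ofU γ (γ (vec k i) (covec k j)) := by
  rw [hw, hv, Hecke.ofV_comm, add_sub_cancel_left]

theorem hRel (hγ : IsInfinitesimalCherednik γ) : Rel (hUnit γ) (hv γ) (hw γ) where
  lie a b i j := by
    have h := congrArg (Hecke.ofU γ) (unit_commutator (k := k) a b i j)
    simp only [map_sub, map_mul, apply_ite (Hecke.ofU γ), map_zero] at h
    exact h
  act_v i j l := by
    rw [hUnit, hv, UniversalEnvelopingAlgebra.unit, Hecke.act, add_sub_cancel_left, lie_single_vec,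
      apply_ite (Hecke.ofV γ), map_zero]
    rfl
  act_w i j l := by
    rw [hUnit, hw, UniversalEnvelopingAlgebra.unit, Hecke.act, add_sub_cancel_left,
      lie_single_covec, map_neg, apply_ite (Hecke.ofV γ), map_zero]
    rfl
  comm_v i j := by
    rw [hv, hv, Hecke.ofV_comm, vec, vec, hγ.zero_left, map_zero, add_zero]
  comm_w i j := by
    rw [hw, hw, Hecke.ofV_comm, covec, covec, hγ.zero_right, map_zero, add_zero]

theorem mem_center_of_commute {z : Hecke γ} (hE : ∀ u : 𝔘, Commute (Hecke.ofU γ u) z)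
    (hV : ∀ i, Commute (hv γ i) z) (hW : ∀ i, Commute (hw γ i) z) :
    z ∈ Subalgebra.center k (Hecke γ) := by
  rw [Subalgebra.mem_center_iff]
  intro u
  change Commute u z
  induction u using HeckeCenter.induct with
  | hC r => exact Algebra.commutes r z
  | hL A => exact hE _
  | hM m =>
    rw [← (stdBasis k).sum_repr m, map_sum]
    refine Commute.sum_left _ _ _ fun c _ => ?_
    rw [map_smul]
    refine Commute.smul_left ?_ _
    rcases c with i | i
    · rw [stdBasis_inl]; exact hV i
    · rw [stdBasis_inr]; exact hW i
  | hadd u v hu hv => exact hu.add_left hv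
  | hmul u v hu hv => exact hu.mul_left hv

theorem commute_ofU_of_commute_hUnit {z : Hecke γ} (h : ∀ i j, Commute (hUnit γ i j) z) (u : 𝔘) :
    Commute (Hecke.ofU γ u) z := by
  induction u using UniversalEnvelopingAlgebra.induct with
  | hC r => rw [AlgHom.commutes]; exact Algebra.commutes r z
  | hι a =>
    rw [ι_eq_sum_unit, map_sum]
    refine Commute.sum_left _ _ _ fun i _ => ?_
    rw [map_sum]
    refine Commute.sum_left _ _ _ fun j _ => ?_
    rw [map_smul]
    exact (h i j).smul_left _
  | hadd u v hu hv => rw [map_add]; exact hu.add_left hv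
  | hmul u v hu hv => rw [map_mul]; exact hu.mul_left hv

/-! ### Elements commuting with `gl_2` and their brackets with vectors -/

variable (γ) in
/-- `z` commutes with `gl_2` and its brackets with the basis vectors `v j`, `w j` are
`∑ i, v i * G i j` and `∑ i, w i * G' i j`. -/
structure HasBracket (z : Hecke γ) (G G' : Fin 2 → Fin 2 → 𝔘) : Prop where
  comm : ∀ u : 𝔘, Commute (Hecke.ofU γ u) z
  bracket_v : ∀ j, z * hv γ j - hv γ j * z = ∑ i, hv γ i * Hecke.ofU γ (G i j)
  bracket_w : ∀ j, z * hw γ j - hw γ j * z = ∑ i, hw γ i * Hecke.ofU γ (G' i j)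

namespace HasBracket

/-- An invariant c in U(gl_2) changes the brackets by its own gradients, so finding a central
correction means writing G and G' as gradients of a common c. -/
theorem sub_ofU {z : Hecke γ} {G G' : Fin 2 → Fin 2 → 𝔘} (h : HasBracket γ z G G') {c : 𝔘} (hc : ∀ a b, Commute (unit k a b) c) :
    HasBracket γ (z - Hecke.ofU γ c) (fun i j => G i j - dV k i j c)
      (fun i j => G' i j - dW k i j c) where
  comm u := (h.comm u).sub_right ((commute_of_commute_unit hc u).map (Hecke.ofU γ))
  bracket_v j := by
    have e := commutator_eq_sum_diff LieHom.id (Hecke.ofU γ) (hv γ) ofU_ι_mul_hv c j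
    simp only [map_sub, mul_sub, Finset.sum_sub_distrib]
    rw [← e, ← h.bracket_v, sub_mul]
    abel
  bracket_w j := by
    have e := commutator_eq_sum_diff (dualRep k (Fin 2)) (Hecke.ofU γ) (hw γ) ofU_ι_mul_hw c j
    simp only [map_sub, mul_sub, Finset.sum_sub_distrib]
    rw [← e, ← h.bracket_w, sub_mul]
    abel

theorem mem_center {z : Hecke γ} (h : HasBracket γ z (fun _ _ => 0) fun _ _ => 0) :
    z ∈ Subalgebra.center k (Hecke γ) := by
  refine mem_center_of_commute h.comm (fun j => ?_) fun j => ?_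
  · have e := h.bracket_v j
    simp only [map_zero, mul_zero, Finset.sum_const_zero] at e
    exact (sub_eq_zero.1 e).symm
  · have e := h.bracket_w j
    simp only [map_zero, mul_zero, Finset.sum_const_zero] at e
    exact (sub_eq_zero.1 e).symm

/-- As z commutes with gl_2, bracketing [z, v_j] with E_ab can be carried out on v_j or on ∑ v_i
G_ij; independence over U(gl_2) equates the coefficients. -/
theorem equivariant_v {z : Hecke γ} {G G' : Fin 2 → Fin 2 → 𝔘} (hγ : IsInfinitesimalCherednik γ) (h : HasBracket γ z G G') :
    Equivariant G := by
  intro a b i j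
  have hz := h.comm (unit k a b)
  have e1 : hUnit γ a b * (z * hv γ j - hv γ j * z) - (z * hv γ j - hv γ j * z) * hUnit γ a b =
      z * (hUnit γ a b * hv γ j - hv γ j * hUnit γ a b) -
        (hUnit γ a b * hv γ j - hv γ j * hUnit γ a b) * z := by
    rw [hUnit]
    simp only [mul_sub, sub_mul, mul_assoc, ← hz.eq]
    simp only [← mul_assoc, ← hz.eq]
    abel
  have e2 : ∀ i, hUnit γ a b * (hv γ i * Hecke.ofU γ (G i j)) -
      hv γ i * Hecke.ofU γ (G i j) * hUnit γ a b = hv γ i * Hecke.ofU γ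
        (unit k a b * G i j - G i j * unit k a b) +
        (if b = i then hv γ a * Hecke.ofU γ (G i j) else 0) := by
    intro i
    rw [commutator_mul, (hRel hγ).act_v, map_sub, map_mul, map_mul, add_comm]
    congr 1
    split_ifs <;> simp
  have e3 : ∑ i, hv γ i * Hecke.ofU γ (unit k a b * G i j - G i j * unit k a b -
      ((if b = j then G i a else 0) - if i = a then G b j else 0)) = 0 := by
    have h4 : z * (if b = j then hv γ a else 0) - (if b = j then hv γ a else 0) * z =
        ∑ i, hv γ i * Hecke.ofU γ (if b = j then G i a else 0) := by
      split_ifs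
      · exact h.bracket_v a
      · simp
    have h5 : ∑ i, (if b = i then hv γ a * Hecke.ofU γ (G i j) else 0) =
        ∑ i, hv γ i * Hecke.ofU γ (if i = a then G b j else 0) := by
      simp [apply_ite (Hecke.ofU γ)]
    rw [(hRel hγ).act_v, h4, h.bracket_v, Finset.mul_sum, Finset.sum_mul,
      ← Finset.sum_sub_distrib] at e1
    simp only [e2, Finset.sum_add_distrib, h5] at e1
    simp only [map_sub, mul_sub, Finset.sum_sub_distrib] at e1 ⊢
    rw [← e1]
    abel
  refine sub_eq_zero.1 (eq_zero_of_sum_ofV_mul_ofU (stdBasis k) hγ.pbw.1 Sum.inl_injective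
    (u := fun i => unit k a b * G i j - G i j * unit k a b -
      ((if b = j then G i a else 0) - if i = a then G b j else 0)) ?_ i)
  simp only [stdBasis_inl]
  exact e3

theorem equivariant_w {z : Hecke γ} {G G' : Fin 2 → Fin 2 → 𝔘} (hγ : IsInfinitesimalCherednik γ)
    (h : HasBracket γ z G G') : Equivariant fun i j => G' j i := by
  intro a b j i
  have hz := h.comm (unit k a b)
  have e1 : hUnit γ a b * (z * hw γ j - hw γ j * z) - (z * hw γ j - hw γ j * z) * hUnit γ a b =
      z * (hUnit γ a b * hw γ j - hw γ j * hUnit γ a b) -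
        (hUnit γ a b * hw γ j - hw γ j * hUnit γ a b) * z := by
    rw [hUnit]
    simp only [mul_sub, sub_mul, mul_assoc, ← hz.eq]
    simp only [← mul_assoc, ← hz.eq]
    abel
  have e2 : ∀ i, hUnit γ a b * (hw γ i * Hecke.ofU γ (G' i j)) -
      hw γ i * Hecke.ofU γ (G' i j) * hUnit γ a b = hw γ i * Hecke.ofU γ
        (unit k a b * G' i j - G' i j * unit k a b) -
        (if a = i then hw γ b * Hecke.ofU γ (G' i j) else 0) := by
    intro i
    rw [commutator_mul, (hRel hγ).act_w, map_sub, map_mul, map_mul, add_comm,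
      sub_eq_add_neg (hw γ i * _)]
    congr 1
    split_ifs <;> simp
  have e3 : ∑ i, hw γ i * Hecke.ofU γ (unit k a b * G' i j - G' i j * unit k a b -
      ((if b = i then G' a j else 0) - if j = a then G' i b else 0)) = 0 := by
    have h4 : z * (-if a = j then hw γ b else 0) - (-if a = j then hw γ b else 0) * z =
        -∑ i, hw γ i * Hecke.ofU γ (if j = a then G' i b else 0) := by
      by_cases hj : a = j
      · simp only [hj, if_true]
        rw [← h.bracket_w b]
        noncomm_ring
      · simp [hj, Ne.symm hj]
    have h5 : ∑ i, (if a = i then hw γ b * Hecke.ofU γ (G' i j) else 0) =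
        ∑ i, hw γ i * Hecke.ofU γ (if b = i then G' a j else 0) := by
      simp [apply_ite (Hecke.ofU γ)]
    rw [(hRel hγ).act_w, h4, h.bracket_w, Finset.mul_sum, Finset.sum_mul,
      ← Finset.sum_sub_distrib] at e1
    simp only [e2, Finset.sum_sub_distrib, h5] at e1
    rw [sub_eq_iff_eq_add] at e1
    simp only [map_sub, mul_sub, Finset.sum_sub_distrib] at e1 ⊢
    rw [e1]
    abel
  refine sub_eq_zero.1 (eq_zero_of_sum_ofV_mul_ofU (stdBasis k) hγ.pbw.1 Sum.inr_injective
    (u := fun i => unit k a b * G' i j - G' i j * unit k a b -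
      ((if b = i then G' a j else 0) - if j = a then G' i b else 0)) ?_ i)
  simp only [stdBasis_inr]
  exact e3

/-- The Jacobi identity for z, v_j, w_l, with [z, [v_j, w_l]] = 0 because [v_j, w_l] lies in
U(gl_2), compared at the coefficient of v_i w_a in degree two. -/
theorem cocycle {z : Hecke γ} {G G' : Fin 2 → Fin 2 → 𝔘} (hγ : IsInfinitesimalCherednik γ)
    (h : HasBracket γ z G G') (i j a l : Fin 2) : dW k a l (G i j) = dV k i j (G' a l) := by
  set g : Fin 2 → Fin 2 → Hecke γ := fun i j => Hecke.ofU γ (γ (vec k i) (covec k j)) with hg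
  have hvw : ∀ i j, hw γ j * hv γ i = hv γ i * hw γ j - g i j := fun i j => by
    simp only [hg]
    rw [← hv_commutator_hw, sub_sub_cancel]
  have hz : (z * hv γ j - hv γ j * z) * hw γ l + hv γ j * (z * hw γ l - hw γ l * z) =
      hw γ l * (z * hv γ j - hv γ j * z) + (z * hw γ l - hw γ l * z) * hv γ j := by
    have e := h.comm (γ (vec k j) (covec k l))
    rw [← hv_commutator_hw, commute_iff_eq] at e
    rw [← sub_eq_zero] at e ⊢
    rw [← neg_eq_zero, ← e]
    noncomm_ring
  have hv' : ∀ i, Hecke.ofU γ (G i j) * hw γ l = hw γ l * Hecke.ofU γ (G i j) +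
      ∑ a, hw γ a * Hecke.ofU γ (dW k a l (G i j)) := fun i => by
    rw [← commutator_eq_sum_diff (dualRep k (Fin 2)) (Hecke.ofU γ) (hw γ) ofU_ι_mul_hw,
      add_sub_cancel]
  have hw' : ∀ a, Hecke.ofU γ (G' a l) * hv γ j = hv γ j * Hecke.ofU γ (G' a l) +
      ∑ i, hv γ i * Hecke.ofU γ (dV k i j (G' a l)) := fun a => by
    rw [← commutator_eq_sum_diff LieHom.id (Hecke.ofU γ) (hv γ) ofU_ι_mul_hv, add_sub_cancel]
  -- Putting every v to the left of every w leaves only terms g · U(gl_2), which have degree zero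
  -- and do not reach the degree-two comparison.
  have key : ∑ i, ∑ a, hv γ i * hw γ a * Hecke.ofU γ (dW k a l (G i j) - dV k i j (G' a l)) =
      -(∑ i, g i l * Hecke.ofU γ (G i j) + ∑ a, g j a * Hecke.ofU γ (G' a l) +
        ∑ i, ∑ a, g i a * Hecke.ofU γ (dV k i j (G' a l))) := by
    rw [h.bracket_v, h.bracket_w] at hz
    simp only [Finset.sum_mul, Finset.mul_sum, mul_assoc, hv', hw'] at hz
    simp only [mul_add, Finset.mul_sum, ← mul_assoc, hvw, sub_mul, Finset.sum_add_distrib,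
      Finset.sum_sub_distrib] at hz
    rw [Finset.sum_comm (f := fun a i => hv γ i * hw γ a * Hecke.ofU γ (dV k i j (G' a l))),
      Finset.sum_comm (f := fun a i => g i a * Hecke.ofU γ (dV k i j (G' a l)))] at hz
    simp only [map_sub, mul_sub, Finset.sum_sub_distrib]
    rw [← sub_eq_zero] at hz ⊢
    rw [← hz]
    abel
  refine sub_eq_zero.1 (eq_zero_of_sum_ofV_mul_ofV_mul_ofU (stdBasis k) hγ.pbw.1 Sum.inl_injective
    Sum.inr_injective (fun _ _ => Sum.inl_ne_inr)
    (u := fun i a => dW k a l (G i j) - dV k i j (G' a l)) ?_ i a)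
  simp only [stdBasis_inl, stdBasis_inr]
  change ∑ i, ∑ a, hv γ i * hw γ a * _ ∈ _
  rw [key]
  have h0 : ∀ i j (u : 𝔘), g i j * Hecke.ofU γ u ∈ (Hecke.filtr γ).toFun 1 := fun i j u => by
    rw [hg, ← map_mul]
    exact (Hecke.filtr γ).mono zero_le_one (Hecke.ofU_mem γ _)
  exact neg_mem (add_mem (add_mem (sum_mem fun i _ => h0 _ _ _) (sum_mem fun a _ => h0 _ _ _))
    (sum_mem fun i _ => sum_mem fun a _ => h0 _ _ _))

theorem exists_sub_mem_center_of_filt_one [CharZero k] {z : Hecke γ} {G G' : Fin 2 → Fin 2 → 𝔘}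
    (hγ : IsInfinitesimalCherednik γ) (hg : ∃ i j, hw γ i * hv γ j - hv γ j * hw γ i ≠ 0)
    (h : HasBracket γ z G G') (hG : ∀ i j, G i j ∈ filt k (Gl2 k) 1)
    (hG' : ∀ i j, G' i j ∈ filt k (Gl2 k) 1) :
    ∃ c : 𝔘, z - Hecke.ofU γ c ∈ Subalgebra.center k (Hecke γ) := by
  obtain ⟨p, hp⟩ := (h.equivariant_v hγ).eq_scalar hG
  obtain ⟨p', hp'⟩ := (h.equivariant_w hγ).eq_scalar fun i j => hG' j i
  set τ : 𝔘 := unit k 0 0 + unit k 1 1 with hτ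
  -- The gradients of τ are the identity for `dV` and minus the identity for `dW`, so this multiple
  -- of τ makes the two scalars equal.
  set r : k := (p - p') / 2 with hr
  have hc : ∀ a b, Commute (unit k a b) (r • τ) := by
    intro a b
    refine Commute.smul_right ?_ r
    rw [commute_iff_eq, ← sub_eq_zero, hτ]
    have e : unit k a b * (unit k 0 0 + unit k 1 1) - (unit k 0 0 + unit k 1 1) * unit k a b =
      (unit k a b * unit k 0 0 - unit k 0 0 * unit k a b) +
        (unit k a b * unit k 1 1 - unit k 1 1 * unit k a b) := by noncomm_ring
    rw [e, unit_commutator, unit_commutator]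
    fin_cases a <;> fin_cases b <;> simp
  have e1 : ∀ i j, G i j - dV k i j (r • τ) = if i = j then algebraMap k 𝔘 (p - r) else 0 := by
    intro i j
    rw [hp, hτ, map_smul, map_add, dV_unit, dV_unit]
    fin_cases i <;> fin_cases j <;> simp [Algebra.algebraMap_eq_smul_one, sub_smul]
  have e2 : ∀ i j, G' i j - dW k i j (r • τ) = if i = j then algebraMap k 𝔘 (p' + r) else 0 := by
    intro i j
    have hd : ∀ a, dW k i j (unit k a a) = if a = i ∧ a = j then -1 else 0 := fun a => by
      rw [dW, UniversalEnvelopingAlgebra.unit, diff_ι, dualRep_apply, Matrix.neg_apply,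
        Matrix.transpose_apply, Matrix.single_apply, map_neg, apply_ite (algebraMap k 𝔘), map_one,
        map_zero, ← neg_zero (G := 𝔘), ← apply_ite Neg.neg, neg_zero]
      simp only [and_comm]
    rw [hp' j i, hτ, map_smul, map_add, hd, hd]
    fin_cases i <;> fin_cases j <;> simp [Algebra.algebraMap_eq_smul_one, add_smul]
  have hpr : p - r = p' + r := by rw [hr]; ring
  set z' := z - Hecke.ofU γ (r • τ)
  have h' := h.sub_ofU hc
  simp only [e1, e2, ← hpr] at h'
  have hv' : ∀ j, z' * hv γ j - hv γ j * z' = (p - r) • hv γ j := by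
    intro j
    rw [h'.bracket_v]
    simp [apply_ite (Hecke.ofU γ), Algebra.algebraMap_eq_smul_one]
  have hw' : ∀ j, z' * hw γ j - hw γ j * z' = (p - r) • hw γ j := by
    intro j
    rw [h'.bracket_w]
    simp [apply_ite (Hecke.ofU γ), Algebra.algebraMap_eq_smul_one]
  obtain ⟨i, j, hij⟩ := hg
  -- Now z' acts by the same scalar on both v and w, hence by twice that scalar on [w_i, v_j]; but
  -- it commutes with U(gl_2), where this bracket lies.
  have h0 : (2 * (p - r)) • (hw γ i * hv γ j - hv γ j * hw γ i) = 0 := by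
    have e : Commute _ z' := h'.comm (γ (covec k i) (vec k j))
    rw [← hw_commutator_hv, commute_iff_eq] at e
    have e3 : (z' * hw γ i - hw γ i * z') * hv γ j + hw γ i * (z' * hv γ j - hv γ j * z') -
        ((z' * hv γ j - hv γ j * z') * hw γ i + hv γ j * (z' * hw γ i - hw γ i * z')) = 0 := by
      rw [← sub_eq_zero] at e
      rw [← neg_eq_zero, ← e]
      noncomm_ring
    rw [hv', hw'] at e3
    simp only [smul_mul_assoc, mul_smul_comm] at e3
    rw [← e3, two_mul, add_smul, smul_sub]
    abel
  have hpr0 : p - r = 0 := by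
    rcases smul_eq_zero.1 h0 with h0 | h0
    · simpa using h0
    · exact absurd h0 hij
  simp only [hpr0, map_zero, ite_self] at h'
  exact ⟨_, h'.mem_center⟩

/-- Descent on the degree of the brackets: subtract a potential of their top parts until only
scalars remain. -/
theorem exists_sub_mem_center_of_filt [CharZero k] {m : ℕ} {z : Hecke γ}
    {G G' : Fin 2 → Fin 2 → 𝔘} (hγ : IsInfinitesimalCherednik γ)
    (hg : ∃ i j, hw γ i * hv γ j - hv γ j * hw γ i ≠ 0)
    (h : HasBracket γ z G G') (hG : ∀ i j, G i j ∈ filt k (Gl2 k) (m + 1))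
    (hG' : ∀ i j, G' i j ∈ filt k (Gl2 k) (m + 1)) :
    ∃ c : 𝔘, z - Hecke.ofU γ c ∈ Subalgebra.center k (Hecke γ) := by
  induction m generalizing z G G' with
  | zero => exact h.exists_sub_mem_center_of_filt_one hγ hg hG hG'
  | succ m ih =>
    obtain ⟨c, hc, hGc, hGc'⟩ := exists_central_diff_sub_mem (h.cocycle hγ) (h.equivariant_v hγ)
      (h.equivariant_w hγ) hG hG'
    obtain ⟨c', hc'⟩ := ih (h.sub_ofU hc) hGc hGc'
    exact ⟨c + c', by rwa [map_add, ← sub_sub]⟩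

theorem exists_sub_mem_center [CharZero k] {z : Hecke γ}
    {G G' : Fin 2 → Fin 2 → 𝔘} (hγ : IsInfinitesimalCherednik γ)
    (hg : ∃ i j, hw γ i * hv γ j - hv γ j * hw γ i ≠ 0) (h : HasBracket γ z G G') :
    ∃ c : 𝔘, z - Hecke.ofU γ c ∈ Subalgebra.center k (Hecke γ) := by
  choose n hn using fun i j => exists_mem_filt (G i j)
  choose n' hn' using fun i j => exists_mem_filt (G' i j)
  refine h.exists_sub_mem_center_of_filt (m := ∑ i, ∑ j, (n i j + n' i j)) hγ hg
    (fun i j => filt_mono ?_ (hn i j)) fun i j => filt_mono ?_ (hn' i j)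
  all_goals
    have h1 := Finset.single_le_sum (f := fun j => n i j + n' i j) (fun _ _ => Nat.zero_le _)
      (Finset.mem_univ j)
    have h2 := Finset.single_le_sum (f := fun i => ∑ j, (n i j + n' i j)) (fun _ _ => Nat.zero_le _)
      (Finset.mem_univ i)
    omega

end HasBracket

end HeckeCenter
end


/-! ### Central lifts of b and d, and the centre of gr(H_γ). -/

noncomputable section

namespace HeckeCenter

open InfCherednik SemidirectPBW UniversalEnvelopingAlgebra FilteredCenter Gl2Relations Gl2Center

variable {k : Type*} [Field k] {γ : V k →ₗ[k] V k →ₗ[k] UniversalEnvelopingAlgebra k (Gl2 k)}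

local notation "𝔘" => UniversalEnvelopingAlgebra k (Gl2 k)

/-! ### The right `U(gl_2)`-module spanned by a family of vectors -/

/-- The set of the elements `∑ i, v i * u i` with `u i` in `U(gl_2)`. -/
def vecSpan (v : Fin 2 → Hecke γ) : Submodule k (Hecke γ) :=
  LinearMap.range (∑ i, LinearMap.mulLeft k (v i) ∘ₗ (Hecke.ofU γ).toLinearMap ∘ₗ
    (LinearMap.proj i : (Fin 2 → 𝔘) →ₗ[k] 𝔘))

theorem mem_vecSpan {v : Fin 2 → Hecke γ} {X : Hecke γ} :
    X ∈ vecSpan v ↔ ∃ u : Fin 2 → 𝔘, X = ∑ i, v i * Hecke.ofU γ (u i) := by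
  simp only [vecSpan, LinearMap.mem_range, LinearMap.sum_apply, eq_comm]
  rfl

theorem vec_mul_mem_vecSpan (v : Fin 2 → Hecke γ) (i : Fin 2) {X : Hecke γ}
    (hX : X ∈ (Hecke.ofU γ).range) : v i * X ∈ vecSpan v := by
  obtain ⟨u, rfl⟩ := hX
  refine mem_vecSpan.2 ⟨Pi.single i u, ?_⟩
  rw [Finset.sum_eq_single_of_mem i (Finset.mem_univ i) fun j _ hj => by
    rw [Pi.single_eq_of_ne hj, map_zero, mul_zero], Pi.single_eq_same]
  rfl

section

variable {θ : Gl2 k →ₗ⁅k⁆ Matrix (Fin 2) (Fin 2) k} {v : Fin 2 → Hecke γ}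
  (hv : ∀ A l, Hecke.ofU γ (ι k A) * v l =
    v l * Hecke.ofU γ (ι k A) + ∑ i, θ A i l • v i)

include hv

theorem mul_vec_mem_vecSpan (i : Fin 2) {X : Hecke γ} (hX : X ∈ (Hecke.ofU γ).range) :
    X * v i ∈ vecSpan v := by
  obtain ⟨u, rfl⟩ := hX
  exact mem_vecSpan.2 ⟨fun j => twist θ u j i, mul_eq_sum_twist θ (Hecke.ofU γ) v hv u i⟩

theorem mul_vec_mul_mem_vecSpan (i : Fin 2) {X Y : Hecke γ} (hX : X ∈ (Hecke.ofU γ).range)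
    (hY : Y ∈ (Hecke.ofU γ).range) : X * (v i * Y) ∈ vecSpan v := by
  obtain ⟨u, hu⟩ := mem_vecSpan.1 (mul_vec_mem_vecSpan hv i hX)
  rw [← mul_assoc, hu, Finset.sum_mul]
  refine sum_mem fun j _ => ?_
  rw [mul_assoc]
  exact vec_mul_mem_vecSpan v j (mul_mem ⟨u j, rfl⟩ hY)

end

theorem exists_hasBracket {z : Hecke γ} (hE : ∀ i j, Commute (hUnit γ i j) z)
    (hV : ∀ j, z * hv γ j - hv γ j * z ∈ vecSpan (hv γ))
    (hW : ∀ j, z * hw γ j - hw γ j * z ∈ vecSpan (hw γ)) : ∃ G G', HasBracket γ z G G' := by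
  choose G hG using fun j => mem_vecSpan.1 (hV j)
  choose G' hG' using fun j => mem_vecSpan.1 (hW j)
  exact ⟨fun i j => G j i, fun i j => G' j i, commute_ofU_of_commute_hUnit hE, hG, hG'⟩

theorem hw_commutator_hv_mem (i j : Fin 2) :
    hw γ i * hv γ j - hv γ j * hw γ i ∈ (Hecke.ofU γ).range := by
  rw [hw_commutator_hv]
  exact ⟨_, rfl⟩

theorem hUnit_mem (i j : Fin 2) : hUnit γ i j ∈ (Hecke.ofU γ).range := ⟨_, rfl⟩

/-- All brackets [w, v] lie in U(gl_2), and that subalgebra can be moved across a vector at the cost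
of a twist, so the commutator formulas land in `vecSpan`. -/
theorem exists_hasBracket_quad (hγ : IsInfinitesimalCherednik γ) :
    ∃ G G', HasBracket γ (quad (hv γ) (hw γ)) G G' := by
  refine exists_hasBracket (hRel hγ).commute_quad (fun l => ?_) fun l => ?_
  · rw [(hRel hγ).quad_mul_v]
    exact sum_mem fun i _ => mul_vec_mem_vecSpan ofU_ι_mul_hv i (hw_commutator_hv_mem i l)
  · rw [(hRel hγ).quad_mul_w]
    refine sum_mem fun i _ => vec_mul_mem_vecSpan _ i ?_
    rw [← neg_sub]
    exact neg_mem (hw_commutator_hv_mem l i)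

theorem exists_hasBracket_cubic (hγ : IsInfinitesimalCherednik γ) :
    ∃ G G', HasBracket γ (cubic (hUnit γ) (hv γ) (hw γ)) G G' := by
  have hg := hw_commutator_hv_mem (γ := γ)
  refine exists_hasBracket (hRel hγ).commute_cubic (fun l => ?_) fun l => ?_
  · rw [(hRel hγ).cubic_mul_v (fun _ _ => rfl)]
    refine add_mem (mul_vec_mem_vecSpan ofU_ι_mul_hv _ ?_) (mul_vec_mem_vecSpan ofU_ι_mul_hv _ ?_)
    all_goals
      refine add_mem (sub_mem (mul_mem (hUnit_mem _ _) (hg _ _)) (mul_mem (hUnit_mem _ _) (hg _ _))) ?_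
      split_ifs
    exacts [hg _ _, neg_mem (hg _ _), neg_mem (hg _ _), hg _ _]
  · rw [(hRel hγ).cubic_mul_w (fun _ _ => rfl)]
    have h := fun i j m n => mul_vec_mul_mem_vecSpan ofU_ι_mul_hw n (hUnit_mem (γ := γ) i j) (hg l m)
    exact add_mem (sub_mem (h _ _ _ _) (h _ _ _ _)) (sub_mem (h _ _ _ _) (h _ _ _ _))

/-! ### The generators of the centre of `H_γ` -/

theorem exists_quad_sub_mem_center [CharZero k] (hγ : IsInfinitesimalCherednik γ) :
    ∃ c : 𝔘, quad (hv γ) (hw γ) - Hecke.ofU γ c ∈ Subalgebra.center k (Hecke γ) := by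
  -- A nonzero bracket is needed to exclude the residual scalar; without one, the commutators of the
  -- pairing with V vanish outright.
  by_cases hg : ∃ i j, hw γ i * hv γ j - hv γ j * hw γ i ≠ 0
  · obtain ⟨G, G', h⟩ := exists_hasBracket_quad hγ
    exact h.exists_sub_mem_center hγ hg
  · push Not at hg
    have hg' : ∀ i j, hv γ i * hw γ j - hw γ j * hv γ i = 0 := fun i j => by
      rw [← neg_sub, hg, neg_zero]
    refine ⟨0, ?_⟩
    rw [map_zero, sub_zero]
    refine mem_center_of_commute (commute_ofU_of_commute_hUnit (hRel hγ).commute_quad)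
      (fun l => ?_) fun l => ?_
    · have h := (hRel hγ).quad_mul_v l
      simp only [hg, zero_mul, Finset.sum_const_zero] at h
      exact (sub_eq_zero.1 h).symm
    · have h := (hRel hγ).quad_mul_w l
      simp only [hg', mul_zero, Finset.sum_const_zero] at h
      exact (sub_eq_zero.1 h).symm

theorem exists_cubic_sub_mem_center [CharZero k] (hγ : IsInfinitesimalCherednik γ) :
    ∃ c : 𝔘, cubic (hUnit γ) (hv γ) (hw γ) - Hecke.ofU γ c ∈ Subalgebra.center k (Hecke γ) := by
  by_cases hg : ∃ i j, hw γ i * hv γ j - hv γ j * hw γ i ≠ 0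
  · obtain ⟨G, G', h⟩ := exists_hasBracket_cubic hγ
    exact h.exists_sub_mem_center hγ hg
  · push Not at hg
    refine ⟨0, ?_⟩
    rw [map_zero, sub_zero]
    refine mem_center_of_commute (commute_ofU_of_commute_hUnit (hRel hγ).commute_cubic)
      (fun l => ?_) fun l => ?_
    · have h := (hRel hγ).cubic_mul_v (g := fun _ _ => 0) hg l
      simp only [mul_zero, neg_zero, ite_self, sub_self, add_zero, zero_mul] at h
      exact (sub_eq_zero.1 h).symm
    · have h := (hRel hγ).cubic_mul_w (g := fun _ _ => 0) hg l
      simp only [mul_zero, sub_self, add_zero] at h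
      exact (sub_eq_zero.1 h).symm

theorem hasSymbol_hUnit (i j : Fin 2) :
    HasSymbol (Hecke.filtr γ) 0 (hUnit γ i j) (Hecke.natMap γ (uUnit k i j)) := by
  have h := hasSymbol_ofU (γ := γ) (unit k i j)
  rwa [UniversalEnvelopingAlgebra.unit, ofU_ι] at h

theorem hasSymbol_hw_mul_hv (i j : Fin 2) :
    HasSymbol (Hecke.filtr γ) 2 (hw γ i * hv γ j) (Hecke.natMap γ (uw k i * uv k j)) := by
  rw [map_mul]
  exact HasSymbol.mul (n := 1) (n' := 1) (hasSymbol_ofV _) (hasSymbol_ofV _)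

theorem hasSymbol_quad :
    HasSymbol (Hecke.filtr γ) 2 (quad (hv γ) (hw γ)) (Hecke.natMap γ (quad (uv k) (uw k))) := by
  rw [quad, quad, map_add]
  exact (hasSymbol_hw_mul_hv 0 0).add (hasSymbol_hw_mul_hv 1 1)

theorem hasSymbol_cubic : HasSymbol (Hecke.filtr γ) 2 (cubic (hUnit γ) (hv γ) (hw γ))
    (Hecke.natMap γ (cubic (uUnit k) (uv k) (uw k))) := by
  have h : ∀ i j a b, HasSymbol (Hecke.filtr γ) 2 (hUnit γ i j * (hw γ a * hv γ b))
      (Hecke.natMap γ (uUnit k i j * (uw k a * uv k b))) := by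
    intro i j a b
    rw [map_mul]
    exact HasSymbol.mul (n := 0) (n' := 2) (hasSymbol_hUnit i j) (hasSymbol_hw_mul_hv a b)
  rw [cubic, cubic, map_add, map_sub, map_sub]
  exact (((h 0 0 1 1).sub (h 0 1 0 1)).sub (h 1 0 1 0)).add (h 1 1 0 0)

/-- The correction lies in degree zero, so it does not change a symbol of degree two. -/
theorem hasSymbol_sub_ofU {X : Hecke γ} {g : Hecke.Gr γ} (h : HasSymbol (Hecke.filtr γ) 2 X g)
    (c : 𝔘) : HasSymbol (Hecke.filtr γ) 2 (X - Hecke.ofU γ c) g := by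
  have h0 : HasSymbol (Hecke.filtr γ) 2 (Hecke.ofU γ c) 0 :=
    hasSymbol_zero_iff.2 ((Hecke.filtr γ).mono zero_le_one (Hecke.ofU_mem γ c))
  have h1 := h.sub h0
  rwa [sub_zero] at h1

variable (γ) in
/-- The images of `b` and `d` in `gr(H_γ)`. -/
def leadingTerm : Fin 2 → Hecke.Gr γ := ![Hecke.natMap γ (b k), Hecke.natMap γ (d k)]

theorem exists_center_hasSymbol [CharZero k] (hγ : IsInfinitesimalCherednik γ) :
    ∃ z : Fin 2 → Subalgebra.center k (Hecke γ),
      ∀ i, HasSymbol (Hecke.filtr γ) 2 (z i) (leadingTerm γ i) := by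
  obtain ⟨c, hc⟩ := exists_quad_sub_mem_center hγ
  obtain ⟨c', hc'⟩ := exists_cubic_sub_mem_center hγ
  have hb : leadingTerm γ 0 = -Hecke.natMap γ (quad (uv k) (uw k)) := by
    rw [← map_neg]
    exact congrArg (Hecke.natMap γ) b_eq
  -- The scalar combines d = 2 `uCubic` with the sign in `uCubic`.
  have hd : leadingTerm γ 1 = (-2 : k) • Hecke.natMap γ (cubic (uUnit k) (uv k) (uw k)) := by
    rw [← map_smul]
    refine congrArg (Hecke.natMap γ) (d_eq.trans ?_)
    rw [uCubic, neg_smul, mul_neg, two_smul, two_mul]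
  refine ⟨![-⟨_, hc⟩, (-2 : k) • ⟨_, hc'⟩], fun i => ?_⟩
  fin_cases i
  · refine Eq.subst (motive := HasSymbol (Hecke.filtr γ) 2 _) hb.symm ?_
    exact (hasSymbol_sub_ofU hasSymbol_quad c).neg
  · refine Eq.subst (motive := HasSymbol (Hecke.filtr γ) 2 _) hd.symm ?_
    exact (hasSymbol_sub_ofU hasSymbol_cubic c').smul (-2 : k)

/-- By the PBW hypothesis `natMap` is an isomorphism, so it carries the centre of U(gl_2 ⋉ V) and
its free generators onto the centre of gr(H_γ). -/
theorem aeval_bijective_of_leadingTerm [CharZero k] (hγ : IsInfinitesimalCherednik γ)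
    {g : Fin 2 → Subalgebra.center k (Hecke.Gr γ)} (hg : ∀ i, (g i : Hecke.Gr γ) = leadingTerm γ i) :
    Function.Bijective (MvPolynomial.aeval (R := k) g) := by
  have h : ∀ p, (MvPolynomial.aeval g p : Subalgebra.center k (Hecke.Gr γ)) =
      Hecke.natMap γ (MvPolynomial.aeval (R := k) (centerGen k) p) := by
    have e : (Subalgebra.center k (Hecke.Gr γ)).val.comp (MvPolynomial.aeval g) =
        ((Hecke.natMap γ).comp (Subalgebra.center k (UV k)).val).comp
          (MvPolynomial.aeval (centerGen k)) := by
      refine MvPolynomial.algHom_ext fun i => ?_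
      rw [AlgHom.comp_apply, AlgHom.comp_apply, MvPolynomial.aeval_X, MvPolynomial.aeval_X]
      refine (hg i).trans ?_
      fin_cases i <;> rfl
    exact fun p => DFunLike.congr_fun e p
  have hb := aeval_centerGen_bijective (k := k)
  refine ⟨fun p q hpq => ?_, fun c => ?_⟩
  · have e := congrArg Subtype.val hpq
    rw [h, h] at e
    exact hb.1 (Subtype.ext (hγ.pbw.1 e))
  · obtain ⟨u, hu⟩ := hγ.pbw.2 c
    have hu' : u ∈ Subalgebra.center k (UV k) := by
      rw [Subalgebra.mem_center_iff]
      intro v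
      refine hγ.pbw.1 ?_
      rw [map_mul, map_mul, hu]
      exact Subalgebra.mem_center_iff.1 c.2 _
    obtain ⟨p, hp⟩ := hb.2 ⟨u, hu'⟩
    refine ⟨p, Subtype.ext ?_⟩
    rw [h, hp, hu]

theorem leadingTerm_ne_zero [CharZero k] (hγ : IsInfinitesimalCherednik γ) (i : Fin 2) :
    leadingTerm γ i ≠ 0 := by
  have h : leadingTerm γ i = Hecke.natMap γ (centerGen k i) := by fin_cases i <;> rfl
  rw [h, Ne, map_eq_zero_iff _ hγ.pbw.1]
  intro h0
  have h1 : MvPolynomial.aeval (R := k) (centerGen k) (MvPolynomial.X i) = 0 := by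
    rw [MvPolynomial.aeval_X]
    exact Subtype.ext h0
  rw [map_eq_zero_iff _ aeval_centerGen_bijective.1] at h1
  exact MvPolynomial.X_ne_zero i h1

end HeckeCenter

end

/-! ### Assembly of the theorem. -/

open InfCherednik in
theorem theorem1 {k : Type*} [Field k] [CharZero k]
    (γ : V k →ₗ[k] V k →ₗ[k] UniversalEnvelopingAlgebra k (Gl2 k))
    (hγ : IsInfinitesimalCherednik γ) :
    -- there are central elements of `H_γ` with leading terms `b` and `d`
    (∃ z : Fin 2 → Subalgebra.center k (Hecke γ),
      (Hecke.filtr γ).IsLeadingTerm (z 0 : Hecke γ) (Hecke.natMap γ (b k)) ∧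
      (Hecke.filtr γ).IsLeadingTerm (z 1 : Hecke γ) (Hecke.natMap γ (d k))) ∧
    -- any two such elements freely generate the centre of `H_γ` as a polynomial algebra
    (∀ z : Fin 2 → Subalgebra.center k (Hecke γ),
      (Hecke.filtr γ).IsLeadingTerm (z 0 : Hecke γ) (Hecke.natMap γ (b k)) →
      (Hecke.filtr γ).IsLeadingTerm (z 1 : Hecke γ) (Hecke.natMap γ (d k)) →
      Function.Bijective
        (MvPolynomial.aeval z : MvPolynomial (Fin 2) k →ₐ[k] Subalgebra.center k (Hecke γ))) ∧
    -- `gr(Z(H_γ)) = Z(gr(H_γ))`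
    (Hecke.filtr γ).grSub (Subalgebra.toSubmodule (Subalgebra.center k (Hecke γ))) =
      Subalgebra.toSubmodule (Subalgebra.center k (Hecke.Gr γ)) ∧
    -- the centre of `U(gl_2 ⋉ V)` is the polynomial algebra `k[b, d]`
    (∃ (hb : b k ∈ Subalgebra.center k (UV k)) (hd : d k ∈ Subalgebra.center k (UV k)),
      Function.Bijective
        (MvPolynomial.aeval ![⟨b k, hb⟩, ⟨d k, hd⟩] :
          MvPolynomial (Fin 2) k →ₐ[k] Subalgebra.center k (UV k))) := by
  obtain ⟨z, hz⟩ := HeckeCenter.exists_center_hasSymbol hγ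
  refine ⟨⟨z, ⟨HeckeCenter.leadingTerm_ne_zero hγ 0, 2, hz 0⟩,
    ⟨HeckeCenter.leadingTerm_ne_zero hγ 1, 2, hz 1⟩⟩, ?_, ?_,
    Gl2Center.b_mem_center, Gl2Center.d_mem_center, Gl2Center.aeval_centerGen_bijective⟩
  · rintro z ⟨-, m, hm⟩ ⟨-, n, hn⟩
    -- `IsLeadingTerm` leaves the degrees unspecified. The lifting argument accepts arbitrary
    -- weights, so m and n need not be shown to equal 2.
    have hz : ∀ i, FilteredCenter.HasSymbol (Hecke.filtr γ) ((![m, n] : Fin 2 → ℕ) i) (z i)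
        (HeckeCenter.leadingTerm γ i) := by
      intro i
      fin_cases i
      exacts [hm, hn]
    have hb := HeckeCenter.aeval_bijective_of_leadingTerm hγ
      (g := fun i => ⟨_, (hz i).mem_center (z i).2⟩) fun _ => rfl
    exact ⟨FilteredCenter.aeval_injective hz hb.1,
      FilteredCenter.aeval_surjective hz hb.2 HeckeCenter.exists_mem_filtr⟩
  · have hb := HeckeCenter.aeval_bijective_of_leadingTerm hγ
      (g := fun i => ⟨_, (hz i).mem_center (z i).2⟩) fun _ => rfl
    exact FilteredCenter.grSub_center (w := fun _ => 2) hz hb.2
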